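/- Let $k$ be a field, let $H$ be a Hopf algebra over $k$ with bijective antipode $S$, and let $X$ be a left $H$-module and left $H$-comodule, with coaction $x\mapsto x_{(-1)}\otimes x_{(0)}$. Assume that $X$ is an anti-Yetter–Drinfeld module, $$(hx)_{(-1)}\otimes (hx)_{(0)} = h_{(1)}x_{(-1)}S^{-1}(h_{(3)})\otimes h_{(2)}x_{(0)}\qquad (h\in H,\ x\in X),$$ and that it is stable: $x_{(-1)}x_{(0)}=x$ and $S(x_{(-1)})x_{(0)}=x$ for all $x\in X$. *The algebra side.* Let $\mathbf T^a_n=H^{\otimes n+1}\otimes X$ with $$\tau_n(h^0\otimes\cdots\otimes h^n\otimes x)=h^n_{(1)}\otimes h^0\otimes\cdots\otimes h^{n-1}\otimes h^n_{(2)}x,$$ $\partial_0(h^0\otimes h^1\otimes\cdots\otimes x)=h^0h^1\otimes\cdots\otimes x$, $\sigma_0(h^0\otimes h^1\otimes\cdots\otimes x)=h^0\otimes 1\otimes h^1\otimes\cdots\otimes x$, $\partial_j=\tau^j\partial_0\tau^{-j}$ and $\sigma_j=\tau^j\sigma_0\tau^{-j}$. Let $$\rho_R(h^0\otimes\cdots\otimes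 h^n\otimes x)=(h^0_{(1)}\otimes\cdots\otimes h^n_{(1)}\otimes x_{(0)})\otimes h^0_{(2)}\cdots h^n_{(2)}S(x_{(-1)})$$ and $(\mathbf T^a_n)^H=\{m:\rho_R(m)=m\otimes 1\}$. Let $\mathbf{CM}^a_n(H,X)=H^{\otimes n}\otimes X$, and let $p_n:\mathbf{CM}^a_n\to \mathbf T^a_n$ and $i_n:\mathbf T^a_n\to\mathbf{CM}^a_n$ be $$p_n(h^1\otimes\cdots\otimes h^n\otimes x)=h^1_{(1)}\otimes\cdots\otimes h^n_{(1)}\otimes x_{(-1)}S^{-1}(h^1_{(3)}\cdots h^n_{(3)})\otimes h^1_{(2)}\cdots h^n_{(2)}x_{(0)},$$ $$i_n(h^0\otimes\cdots\otimes h^n\otimes x)=h^0\otimes\cdots\otimes h^{n-1}\otimes h^nx .$$ Equip $\mathbf{CM}^a_*$ with $t_n=i_n\tau_np_n$ (and $t_n^{-1}=i_n\tau_n^{-1}p_n$); with $d_0(h^1\otimes x)=h^1x$, $d_0(h^1\otimes h^2\otimes\cdots\otimes x)=h^1h^2\otimes\cdots\otimes x$ and $d_j=t^jd_0t^{-j}$;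 and with degeneracies $i_{n+1}\sigma_jp_n$. *The coalgebra side.* Let $\mathbf T^c_n=H^{\otimes n+1}\otimes X$ with $$\tau_{c,n}(h^0\otimes\cdots\otimes h^n\otimes x)=h^1\otimes\cdots\otimes h^n\otimes x_{(-1)}h^0\otimes x_{(0)},$$ $\partial^c_0(h^0\otimes\cdots\otimes x)=h^0_{(1)}\otimes h^0_{(2)}\otimes h^1\otimes\cdots\otimes x$, $\sigma^c_0(h^0\otimes h^1\otimes h^2\otimes\cdots\otimes x)=\epsilon(h^1)\,h^0\otimes h^2\otimes\cdots\otimes x$, $\partial^c_j=\tau_c^{-j}\partial^c_0\tau_c^{j}$ and $\sigma^c_j=\tau_c^{-j}\sigma^c_0\tau_c^{j}$. Let $H$ act diagonally on $\mathbf T^c_n$, let $\mathbf{CM}^c_n(H,X)=k\otimes_H\mathbf T^c_n$ with the induced structure maps, and let $q_n:\mathbf T^c_n\to\mathbf{CM}^c_n$ be the quotient map. The cyclic dual $A^\vee$ of a (para-)cocyclic module $A$ has $A^\vee_n=A_n$ and, from degree $n$ to degree $n-1$, $\partial^\vee_0=\sigma_{n-1}\tau_n$ and $\partial^\vee_{i+1}=\sigma_i$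 for $0\le i\le n-1$; moreover $\sigma^\vee_j=\partial_j$ for $0\le j\le n$, and $\tau^\vee_n=\tau_n^{-1}$. Let $\alpha_n:\mathbf T^a_n\to(\mathbf T^c_n)^\vee$ be $$\alpha_n(h^0\otimes\cdots\otimes h^n\otimes x)=h^0_{(1)}\otimes h^0_{(2)}h^1_{(1)}\otimes\cdots\otimes h^0_{(n+1)}h^1_{(n)}\cdots h^n_{(1)}\otimes h^0_{(n+2)}h^1_{(n+1)}\cdots h^n_{(2)}x .$$ **Theorem.** $\mathbf{CM}^a_*(H,X)$ is a cyclic module; $p_*$ commutes with all structure maps and is injective with image $\mathbf T^a_*(H,X)^H$, so that $\mathbf{CM}^a_*(H,X)$ is identified with $\mathbf T^a_*(H,X)^H$; the structure maps of $\mathbf T^c_*(H,X)$ descend to $\mathbf{CM}^c_*(H,X)$, which is a cocyclic module, and $\mathbf{CM}^c_*(H,X)^\vee$ is a cyclic module. Under the identification, $q_*\alpha_*$, that is $q_*\alpha_*p_*:\mathbf{CM}^a_*(H,X)\to\mathbf{CM}^c_*(H,X)^\vee$, is an isomorphism of cyclic modules (bijective in every degree and commuting with all faces, degeneracies and cyclic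 operators). -/

import Mathlib

universe u v

noncomputable section

namespace HopfCyclic

open TensorProduct Coalgebra HopfAlgebra

/-! ### (Para-)cyclic and (para-)cocyclic modules -/

/-- The structure maps of a para-cyclic module: faces `∂_i : A_{n+1} → A_n`, degeneracies
`σ_j : A_n → A_{n+1}`, the cyclic operators `τ_n` and their inverses. The identities between
them are the predicates `IsParaCyclic` and `IsCyclic`. -/
structure ParaCyclicData (k : Type v) [Field k] where
  obj : ℕ → ModuleCat.{u} k
  face (n : ℕ) (i : Fin (n + 2)) : obj (n + 1) →ₗ[k] obj n
  degen (n : ℕ) (j : Fin (n + 1)) : obj n →ₗ[k] obj (n + 1)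
  cyc (n : ℕ) : obj n →ₗ[k] obj n
  cycInv (n : ℕ) : obj n →ₗ[k] obj n

/-- The structure maps of a para-cocyclic module: cofaces `∂_i : A_n → A_{n+1}`, codegeneracies
`σ_j : A_{n+1} → A_n`, the cocyclic operators `τ_n` and their inverses. -/
structure ParaCocyclicData (k : Type v) [Field k] where
  obj : ℕ → ModuleCat.{u} k
  coface (n : ℕ) (i : Fin (n + 2)) : obj n →ₗ[k] obj (n + 1)
  codegen (n : ℕ) (j : Fin (n + 1)) : obj (n + 1) →ₗ[k] obj n
  cyc (n : ℕ) : obj n →ₗ[k] obj n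
  cycInv (n : ℕ) : obj n →ₗ[k] obj n

variable {k : Type v} [Field k]

/-- The identities of a para-cyclic module: all identities of a cyclic module except
`τ_n ^ (n + 1) = id`. -/
structure ParaCyclicData.IsParaCyclic (A : ParaCyclicData.{u} k) : Prop where
  face_face : ∀ (n : ℕ) (i j : Fin (n + 2)), i ≤ j →
    A.face n i ∘ₗ A.face (n + 1) j.succ = A.face n j ∘ₗ A.face (n + 1) i.castSucc
  degen_degen : ∀ (n : ℕ) (i j : Fin (n + 1)), i ≤ j →
    A.degen (n + 1) i.castSucc ∘ₗ A.degen n j = A.degen (n + 1) j.succ ∘ₗ A.degen n i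
  face_degen_of_le : ∀ (n : ℕ) (i : Fin (n + 2)) (j : Fin (n + 1)), i ≤ j.castSucc →
    A.face (n + 1) i.castSucc ∘ₗ A.degen (n + 1) j.succ = A.degen n j ∘ₗ A.face n i
  face_degen_self : ∀ (n : ℕ) (j : Fin (n + 1)),
    A.face n j.castSucc ∘ₗ A.degen n j = LinearMap.id
  face_degen_succ : ∀ (n : ℕ) (j : Fin (n + 1)),
    A.face n j.succ ∘ₗ A.degen n j = LinearMap.id
  face_degen_of_gt : ∀ (n : ℕ) (i : Fin (n + 2)) (j : Fin (n + 1)), j.castSucc < i →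
    A.face (n + 1) i.succ ∘ₗ A.degen (n + 1) j.castSucc = A.degen n j ∘ₗ A.face n i
  cyc_cycInv : ∀ n : ℕ, A.cyc n ∘ₗ A.cycInv n = LinearMap.id
  cycInv_cyc : ∀ n : ℕ, A.cycInv n ∘ₗ A.cyc n = LinearMap.id
  face_succ_cyc : ∀ (n : ℕ) (i : Fin (n + 1)),
    A.face n i.succ ∘ₗ A.cyc (n + 1) = A.cyc n ∘ₗ A.face n i.castSucc
  face_zero_cyc : ∀ n : ℕ, A.face n 0 ∘ₗ A.cyc (n + 1) = A.face n (Fin.last (n + 1))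
  degen_succ_cyc : ∀ (n : ℕ) (j : Fin n),
    A.degen n j.succ ∘ₗ A.cyc n = A.cyc (n + 1) ∘ₗ A.degen n j.castSucc
  degen_zero_cyc : ∀ n : ℕ,
    A.degen n 0 ∘ₗ A.cyc n = A.cyc (n + 1) ∘ₗ A.cyc (n + 1) ∘ₗ A.degen n (Fin.last n)

/-- A cyclic module. -/
structure ParaCyclicData.IsCyclic (A : ParaCyclicData.{u} k) : Prop
    extends A.IsParaCyclic where
  cyc_pow : ∀ n : ℕ, (A.cyc n) ^ (n + 1) = (1 : Module.End k (A.obj n))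

/-- The identities of a para-cocyclic module. -/
structure ParaCocyclicData.IsParaCocyclic (A : ParaCocyclicData.{u} k) : Prop where
  coface_coface : ∀ (n : ℕ) (i j : Fin (n + 2)), i ≤ j →
    A.coface (n + 1) j.succ ∘ₗ A.coface n i = A.coface (n + 1) i.castSucc ∘ₗ A.coface n j
  codegen_codegen : ∀ (n : ℕ) (i j : Fin (n + 1)), i ≤ j →
    A.codegen n j ∘ₗ A.codegen (n + 1) i.castSucc = A.codegen n i ∘ₗ A.codegen (n + 1) j.succ
  codegen_coface_of_le : ∀ (n : ℕ) (i : Fin (n + 2)) (j : Fin (n + 1)), i ≤ j.castSucc →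
    A.codegen (n + 1) j.succ ∘ₗ A.coface (n + 1) i.castSucc = A.coface n i ∘ₗ A.codegen n j
  codegen_coface_self : ∀ (n : ℕ) (j : Fin (n + 1)),
    A.codegen n j ∘ₗ A.coface n j.castSucc = LinearMap.id
  codegen_coface_succ : ∀ (n : ℕ) (j : Fin (n + 1)),
    A.codegen n j ∘ₗ A.coface n j.succ = LinearMap.id
  codegen_coface_of_gt : ∀ (n : ℕ) (i : Fin (n + 2)) (j : Fin (n + 1)), j.castSucc < i →
    A.codegen (n + 1) j.castSucc ∘ₗ A.coface (n + 1) i.succ = A.coface n i ∘ₗ A.codegen n j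
  cyc_cycInv : ∀ n : ℕ, A.cyc n ∘ₗ A.cycInv n = LinearMap.id
  cycInv_cyc : ∀ n : ℕ, A.cycInv n ∘ₗ A.cyc n = LinearMap.id
  cyc_coface_succ : ∀ (n : ℕ) (i : Fin (n + 1)),
    A.cyc (n + 1) ∘ₗ A.coface n i.succ = A.coface n i.castSucc ∘ₗ A.cyc n
  cyc_coface_zero : ∀ n : ℕ, A.cyc (n + 1) ∘ₗ A.coface n 0 = A.coface n (Fin.last (n + 1))
  cyc_codegen_succ : ∀ (n : ℕ) (j : Fin n),
    A.cyc n ∘ₗ A.codegen n j.succ = A.codegen n j.castSucc ∘ₗ A.cyc (n + 1)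
  cyc_codegen_zero : ∀ n : ℕ,
    A.cyc n ∘ₗ A.codegen n 0 = A.codegen n (Fin.last n) ∘ₗ A.cyc (n + 1) ∘ₗ A.cyc (n + 1)

/-- A cocyclic module. -/
structure ParaCocyclicData.IsCocyclic (A : ParaCocyclicData.{u} k) : Prop
    extends A.IsParaCocyclic where
  cyc_pow : ∀ n : ℕ, (A.cyc n) ^ (n + 1) = (1 : Module.End k (A.obj n))

/-- The cyclic dual `A^∨`: `∂^∨_0 = σ_n τ_{n+1}` and `∂^∨_{i+1} = σ_i` from degree `n + 1` to
degree `n`, `σ^∨_j = ∂_j`, `τ^∨ = τ⁻¹`. -/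
def ParaCocyclicData.dual (A : ParaCocyclicData.{u} k) : ParaCyclicData.{u} k where
  obj := A.obj
  face n := Fin.cases (A.codegen n (Fin.last n) ∘ₗ A.cyc (n + 1)) (fun i => A.codegen n i)
  degen n j := A.coface n j.castSucc
  cyc := A.cycInv
  cycInv := A.cyc

/-- The quotient of a para-cocyclic module by a graded submodule stable under all structure
maps. -/
def ParaCocyclicData.quotient (A : ParaCocyclicData.{u} k) (N : ∀ n, Submodule k (A.obj n))
    (hcoface : ∀ n i, N n ≤ (N (n + 1)).comap (A.coface n i))
    (hcodegen : ∀ n j, N (n + 1) ≤ (N n).comap (A.codegen n j))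
    (hcyc : ∀ n, N n ≤ (N n).comap (A.cyc n))
    (hcycInv : ∀ n, N n ≤ (N n).comap (A.cycInv n)) : ParaCocyclicData.{u} k where
  obj n := ModuleCat.of k (A.obj n ⧸ N n)
  coface n i := (N n).mapQ (N (n + 1)) (A.coface n i) (hcoface n i)
  codegen n j := (N (n + 1)).mapQ (N n) (A.codegen n j) (hcodegen n j)
  cyc n := (N n).mapQ (N n) (A.cyc n) (hcyc n)
  cycInv n := (N n).mapQ (N n) (A.cycInv n) (hcycInv n)

/-- Morphisms of (para-)cyclic modules: graded linear maps commuting with faces, degeneracies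
and cyclic operators. -/
structure ParaCyclicData.IsMorphism (A B : ParaCyclicData.{u} k)
    (f : ∀ n, A.obj n →ₗ[k] B.obj n) : Prop where
  face : ∀ (n : ℕ) (i : Fin (n + 2)), f n ∘ₗ A.face n i = B.face n i ∘ₗ f (n + 1)
  degen : ∀ (n : ℕ) (j : Fin (n + 1)), f (n + 1) ∘ₗ A.degen n j = B.degen n j ∘ₗ f n
  cyc : ∀ n : ℕ, f n ∘ₗ A.cyc n = B.cyc n ∘ₗ f n

/-! ### Module/comodules over a Hopf algebra -/

/-- The antipode of `H` is bijective. -/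
class HasBijectiveAntipode (k : Type v) [Field k] (H : Type u) [Ring H] [HopfAlgebra k H] :
    Prop where
  bijective : Function.Bijective (antipode k : H →ₗ[k] H)

/-- The inverse `S⁻¹` of the antipode. -/
def sInv (k : Type v) [Field k] (H : Type u) [Ring H] [HopfAlgebra k H]
    [HasBijectiveAntipode k H] : H →ₗ[k] H :=
  (LinearEquiv.ofBijective (antipode k : H →ₗ[k] H) HasBijectiveAntipode.bijective).symm

/-- A left comodule `ρ_X : X → H ⊗ X`, written `x ↦ x_(-1) ⊗ x_(0)`. -/
class LeftComodule (k : Type v) [Field k] (H : Type u) [Ring H] [HopfAlgebra k H]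
    (X : Type u) [AddCommGroup X] [Module k X] where
  coact : X →ₗ[k] H ⊗[k] X
  coassoc : (TensorProduct.assoc k H H X).toLinearMap ∘ₗ comul.rTensor X ∘ₗ coact =
    coact.lTensor H ∘ₗ coact
  counit_coact : counit.rTensor X ∘ₗ coact = TensorProduct.mk k k X 1

variable (k) (H : Type u) [Ring H] [HopfAlgebra k H]
  (X : Type u) [AddCommGroup X] [Module k X] [Module H X] [IsScalarTower k H X]

/-- The action `h ↦ (x ↦ h x)`. -/
def actHom : H →ₗ[k] X →ₗ[k] X := (Algebra.lsmul k k X).toLinearMap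

/-- The action `h ⊗ x ↦ h x`. -/
def act : H ⊗[k] X →ₗ[k] X := TensorProduct.lift (actHom k H X)

/-- The coaction `x ↦ x_(-1) ⊗ x_(0)`. -/
def coact (k : Type v) [Field k] (H : Type u) [Ring H] [HopfAlgebra k H]
    (X : Type u) [AddCommGroup X] [Module k X] [LeftComodule k H X] : X →ₗ[k] H ⊗[k] X :=
  LeftComodule.coact

/-- Anti-Yetter-Drinfeld module/comodules:
`(h x)_(-1) ⊗ (h x)_(0) = h_(1) x_(-1) S⁻¹(h_(3)) ⊗ h_(2) x_(0)`. Here `h_(1)` is `left i`, and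
`h_(2)`, `h_(3)` are the `left j` and `right j` of `right i`. -/
class IsAntiYetterDrinfeld [HasBijectiveAntipode k H] [LeftComodule k H X] : Prop where
  coact_smul : ∀ (h : H) (x : X), coact k H X (h • x) =
    ∑ i ∈ (ℛ k h).index, ∑ j ∈ (ℛ k ((ℛ k h).right i)).index,
      TensorProduct.map
        (LinearMap.mulLeft k ((ℛ k h).left i) ∘ₗ
          LinearMap.mulRight k (sInv k H ((ℛ k ((ℛ k h).right i)).right j)))
        (actHom k H X ((ℛ k ((ℛ k h).right i)).left j))
        (coact k H X x)

/-- Stability: `x_(-1) x_(0) = x` and `S(x_(-1)) x_(0) = x`. -/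
class IsStable [LeftComodule k H X] : Prop where
  zero_stable : ∀ x : X, act k H X (coact k H X x) = x
  one_stable : ∀ x : X, act k H X ((antipode k).rTensor X (coact k H X x)) = x

/-! ### The modules `H^{⊗ n} ⊗ X` -/

/-- `H^{⊗ n} ⊗ X`, as `H ⊗ (H ⊗ (⋯ ⊗ (H ⊗ X)))`. -/
def Tens : ℕ → ModuleCat.{u} k
  | 0 => ModuleCat.of k X
  | n + 1 => ModuleCat.of k (H ⊗[k] Tens n)

/-- `h^0 ⊗ ⋯ ⊗ h^n ⊗ x ↦ h^n ⊗ h^0 ⊗ ⋯ ⊗ h^{n-1} ⊗ x`. -/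
def rot : (n : ℕ) → Tens k H X (n + 1) →ₗ[k] Tens k H X (n + 1)
  | 0 => LinearMap.id
  | n + 1 => (TensorProduct.leftComm k H H (Tens k H X n)).toLinearMap ∘ₗ (rot n).lTensor H

/-- `h^0 ⊗ ⋯ ⊗ h^n ⊗ x ↦ h^1 ⊗ ⋯ ⊗ h^n ⊗ h^0 ⊗ x`. -/
def rotInv : (n : ℕ) → Tens k H X (n + 1) →ₗ[k] Tens k H X (n + 1)
  | 0 => LinearMap.id
  | n + 1 => (rotInv n).lTensor H ∘ₗ (TensorProduct.leftComm k H H (Tens k H X n)).toLinearMap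

/-- `h^0 ⊗ ⋯ ⊗ h^n ⊗ x ↦ h^0 ⊗ ⋯ ⊗ h^{n-1} ⊗ f (h^n ⊗ x)`. -/
def onLast (f : H ⊗[k] X →ₗ[k] H ⊗[k] X) :
    (n : ℕ) → Tens k H X (n + 1) →ₗ[k] Tens k H X (n + 1)
  | 0 => f
  | n + 1 => (onLast f n).lTensor H

/-- `i_n (h^0 ⊗ ⋯ ⊗ h^n ⊗ x) = h^0 ⊗ ⋯ ⊗ h^{n-1} ⊗ h^n x`. -/
def absorb : (n : ℕ) → Tens k H X (n + 1) →ₗ[k] Tens k H X n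
  | 0 => act k H X
  | n + 1 => (absorb n).lTensor H

/-- From an action-like map `d : H → End M`, the diagonal one `h · (g ⊗ m) = h_(1) g ⊗ h_(2) · m`
on `H ⊗ M`. -/
def diagStep {M : Type u} [AddCommGroup M] [Module k M] (d : H →ₗ[k] M →ₗ[k] M) :
    H →ₗ[k] (H ⊗[k] M) →ₗ[k] (H ⊗[k] M) :=
  TensorProduct.homTensorHomMap (RingHom.id k) H M H M ∘ₗ
    TensorProduct.map (LinearMap.mul k H) d ∘ₗ comul

/-- The diagonal action `h · (h^1 ⊗ ⋯ ⊗ h^n ⊗ x) = h_(1) h^1 ⊗ ⋯ ⊗ h_(n) h^n ⊗ h_(n+1) x`. -/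
def diag : (n : ℕ) → H →ₗ[k] Tens k H X n →ₗ[k] Tens k H X n
  | 0 => actHom k H X
  | n + 1 => diagStep k H (diag n)

/-- For `b x = x_[-1] ⊗ x_[0]`, the map
`h^1 ⊗ ⋯ ⊗ h^n ⊗ x ↦ h^1_(2) ⋯ h^n_(2) x_[-1] ⊗ (h^1_(1) ⊗ ⋯ ⊗ h^n_(1) ⊗ x_[0])`. -/
def diagCoact (b : X →ₗ[k] H ⊗[k] X) : (n : ℕ) → Tens k H X n →ₗ[k] H ⊗[k] Tens k H X n
  | 0 => b
  | n + 1 => (LinearMap.mul' k H).rTensor (H ⊗[k] Tens k H X n) ∘ₗ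
      (TensorProduct.tensorTensorTensorComm k H H H (Tens k H X n)).toLinearMap ∘ₗ
      TensorProduct.map ((TensorProduct.comm k H H).toLinearMap ∘ₗ comul) (diagCoact b n)

/-! ### The para-cyclic module `T^a_*(H, X)` -/

/-- `h ⊗ x ↦ h_(1) ⊗ h_(2) x`. -/
def twist : H ⊗[k] X →ₗ[k] H ⊗[k] X :=
  (act k H X).lTensor H ∘ₗ (TensorProduct.assoc k H H X).toLinearMap ∘ₗ comul.rTensor X

/-- `h ⊗ x ↦ h_(1) ⊗ S(h_(2)) x`. -/
def twistInv : H ⊗[k] X →ₗ[k] H ⊗[k] X :=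
  (act k H X ∘ₗ (antipode k).rTensor X).lTensor H ∘ₗ
    (TensorProduct.assoc k H H X).toLinearMap ∘ₗ comul.rTensor X

/-- `τ_n (h^0 ⊗ ⋯ ⊗ h^n ⊗ x) = h^n_(1) ⊗ h^0 ⊗ ⋯ ⊗ h^{n-1} ⊗ h^n_(2) x`. -/
def cycA (n : ℕ) : Tens k H X (n + 1) →ₗ[k] Tens k H X (n + 1) :=
  rot k H X n ∘ₗ onLast k H X (twist k H X) n

/-- `τ_n⁻¹ (h^0 ⊗ ⋯ ⊗ h^n ⊗ x) = h^1 ⊗ ⋯ ⊗ h^n ⊗ h^0_(1) ⊗ S(h^0_(2)) x`. -/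
def cycInvA (n : ℕ) : Tens k H X (n + 1) →ₗ[k] Tens k H X (n + 1) :=
  onLast k H X (twistInv k H X) n ∘ₗ rotInv k H X n

/-- `h^0 ⊗ h^1 ⊗ ⋯ ⊗ x ↦ h^0 h^1 ⊗ ⋯ ⊗ x`. -/
def mulFirst (n : ℕ) : Tens k H X (n + 2) →ₗ[k] Tens k H X (n + 1) :=
  (LinearMap.mul' k H).rTensor (Tens k H X n) ∘ₗ
    (TensorProduct.assoc k H H (Tens k H X n)).symm.toLinearMap

/-- `h^0 ⊗ h^1 ⊗ ⋯ ⊗ x ↦ h^0 ⊗ 1 ⊗ h^1 ⊗ ⋯ ⊗ x`. -/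
def insertOne (n : ℕ) : Tens k H X (n + 1) →ₗ[k] Tens k H X (n + 2) :=
  (TensorProduct.mk k H (Tens k H X n) 1).lTensor H

/-- `T^a_*(H, X)`, with `∂_j = τ^j ∂_0 τ^{-j}` and `σ_j = τ^j σ_0 τ^{-j}`. -/
def Ta : ParaCyclicData.{u} k where
  obj n := Tens k H X (n + 1)
  face n i := (cycA k H X n ^ (i : ℕ) : Module.End k _) ∘ₗ mulFirst k H X n ∘ₗ
    (cycInvA k H X (n + 1) ^ (i : ℕ) : Module.End k _)
  degen n j := (cycA k H X (n + 1) ^ (j : ℕ) : Module.End k _) ∘ₗ insertOne k H X n ∘ₗ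
    (cycInvA k H X n ^ (j : ℕ) : Module.End k _)
  cyc := cycA k H X
  cycInv := cycInvA k H X

/-- The coaction `ρ_R (h^1 ⊗ ⋯ ⊗ h^n ⊗ x) =
(h^1_(1) ⊗ ⋯ ⊗ h^n_(1) ⊗ x_(0)) ⊗ h^1_(2) ⋯ h^n_(2) S(x_(-1))`, with its `H`-factor written on
the left. -/
def coactR [LeftComodule k H X] (n : ℕ) : Tens k H X n →ₗ[k] H ⊗[k] Tens k H X n :=
  diagCoact k H X ((antipode k).rTensor X ∘ₗ coact k H X) n

/-- The space `T^a_n(H, X)^H` of coinvariants `{m | ρ_R m = m ⊗ 1}`. -/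
def invA [LeftComodule k H X] (n : ℕ) : Submodule k (Tens k H X (n + 1)) :=
  LinearMap.eqLocus (coactR k H X (n + 1)) (TensorProduct.mk k H (Tens k H X (n + 1)) 1)

/-! ### The cyclic module `CM^a_*(H, X)` -/

/-- `z ⊗ x ↦ x_(-1) S⁻¹(z_(2)) ⊗ z_(1) x_(0)`. -/
def shear [HasBijectiveAntipode k H] [LeftComodule k H X] : H ⊗[k] X →ₗ[k] H ⊗[k] X :=
  TensorProduct.map
    (LinearMap.mul' k H ∘ₗ (TensorProduct.comm k H H).toLinearMap ∘ₗ (sInv k H).rTensor H)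
    (act k H X) ∘ₗ
  (TensorProduct.tensorTensorTensorComm k H H H X).toLinearMap ∘ₗ
  TensorProduct.map ((TensorProduct.comm k H H).toLinearMap ∘ₗ comul) (coact k H X)

/-- `p_n (h^1 ⊗ ⋯ ⊗ h^n ⊗ x) = h^1_(1) ⊗ ⋯ ⊗ h^n_(1) ⊗ x_(-1) S⁻¹(h^1_(3) ⋯ h^n_(3)) ⊗
h^1_(2) ⋯ h^n_(2) x_(0)`: first pass to `h^1_(1) ⊗ ⋯ ⊗ h^n_(1) ⊗ z ⊗ x` with
`z = h^1_(2) ⋯ h^n_(2)`, then apply `shear` to `z ⊗ x`. -/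
def pA [HasBijectiveAntipode k H] [LeftComodule k H X] (n : ℕ) :
    Tens k H X n →ₗ[k] Tens k H X (n + 1) :=
  onLast k H X (shear k H X) n ∘ₗ rotInv k H X n ∘ₗ
    diagCoact k H X (TensorProduct.mk k H X 1) n

/-- `d_0`: `h^1 ⊗ x ↦ h^1 x`, and `h^1 ⊗ h^2 ⊗ ⋯ ⊗ x ↦ h^1 h^2 ⊗ ⋯ ⊗ x`. -/
def faceZeroCMa : (n : ℕ) → Tens k H X (n + 1) →ₗ[k] Tens k H X n
  | 0 => act k H X
  | n + 1 => mulFirst k H X n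

/-- `t_n = i_n τ_n p_n`. -/
def cycCMa [HasBijectiveAntipode k H] [LeftComodule k H X] (n : ℕ) :
    Tens k H X n →ₗ[k] Tens k H X n :=
  absorb k H X n ∘ₗ cycA k H X n ∘ₗ pA k H X n

/-- `t_n⁻¹ = i_n τ_n⁻¹ p_n`. -/
def cycInvCMa [HasBijectiveAntipode k H] [LeftComodule k H X] (n : ℕ) :
    Tens k H X n →ₗ[k] Tens k H X n :=
  absorb k H X n ∘ₗ cycInvA k H X n ∘ₗ pA k H X n

/-- `CM^a_n(H, X) = H^{⊗ n} ⊗ X`, with `d_j = t^j d_0 t^{-j}` and degeneracies induced from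
`T^a_*(H, X)` along `p` and `i`. -/
def CMa [HasBijectiveAntipode k H] [LeftComodule k H X] : ParaCyclicData.{u} k where
  obj n := Tens k H X n
  face n i := (cycCMa k H X n ^ (i : ℕ) : Module.End k _) ∘ₗ faceZeroCMa k H X n ∘ₗ
    (cycInvCMa k H X (n + 1) ^ (i : ℕ) : Module.End k _)
  degen n j := absorb k H X (n + 1) ∘ₗ (Ta k H X).degen n j ∘ₗ pA k H X n
  cyc := cycCMa k H X
  cycInv := cycInvCMa k H X

/-! ### The para-cocyclic module `T^c_*(H, X)` -/

/-- `h ⊗ x ↦ x_(-1) h ⊗ x_(0)`. -/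
def cotwist [LeftComodule k H X] : H ⊗[k] X →ₗ[k] H ⊗[k] X :=
  (LinearMap.mul' k H ∘ₗ (TensorProduct.comm k H H).toLinearMap).rTensor X ∘ₗ
    (TensorProduct.assoc k H H X).symm.toLinearMap ∘ₗ (coact k H X).lTensor H

/-- `h ⊗ x ↦ S⁻¹(x_(-1)) h ⊗ x_(0)`. -/
def cotwistInv [HasBijectiveAntipode k H] [LeftComodule k H X] : H ⊗[k] X →ₗ[k] H ⊗[k] X :=
  (LinearMap.mul' k H ∘ₗ (TensorProduct.comm k H H).toLinearMap).rTensor X ∘ₗ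
    (TensorProduct.assoc k H H X).symm.toLinearMap ∘ₗ
    ((sInv k H).rTensor X ∘ₗ coact k H X).lTensor H

/-- `τ_n (h^0 ⊗ ⋯ ⊗ h^n ⊗ x) = h^1 ⊗ ⋯ ⊗ h^n ⊗ x_(-1) h^0 ⊗ x_(0)`. -/
def cycC [LeftComodule k H X] (n : ℕ) : Tens k H X (n + 1) →ₗ[k] Tens k H X (n + 1) :=
  onLast k H X (cotwist k H X) n ∘ₗ rotInv k H X n

/-- `τ_n⁻¹ (h^0 ⊗ ⋯ ⊗ h^n ⊗ x) = S⁻¹(x_(-1)) h^n ⊗ h^0 ⊗ ⋯ ⊗ h^{n-1} ⊗ x_(0)`. -/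
def cycInvC [HasBijectiveAntipode k H] [LeftComodule k H X] (n : ℕ) :
    Tens k H X (n + 1) →ₗ[k] Tens k H X (n + 1) :=
  rot k H X n ∘ₗ onLast k H X (cotwistInv k H X) n

/-- `h^0 ⊗ h^1 ⊗ ⋯ ⊗ x ↦ h^0_(1) ⊗ h^0_(2) ⊗ h^1 ⊗ ⋯ ⊗ x`. -/
def comulFirst (n : ℕ) : Tens k H X (n + 1) →ₗ[k] Tens k H X (n + 2) :=
  (TensorProduct.assoc k H H (Tens k H X n)).toLinearMap ∘ₗ comul.rTensor (Tens k H X n)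

/-- `h^0 ⊗ h^1 ⊗ h^2 ⊗ ⋯ ⊗ x ↦ ε(h^1) h^0 ⊗ h^2 ⊗ ⋯ ⊗ x`. -/
def counitSecond (n : ℕ) : Tens k H X (n + 2) →ₗ[k] Tens k H X (n + 1) :=
  ((TensorProduct.lid k (Tens k H X n)).toLinearMap ∘ₗ counit.rTensor (Tens k H X n)).lTensor H

/-- `T^c_*(H, X)`, with `∂_j = τ^{-j} ∂_0 τ^j` and `σ_j = τ^{-j} σ_0 τ^j`. -/
def Tc [HasBijectiveAntipode k H] [LeftComodule k H X] : ParaCocyclicData.{u} k where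
  obj n := Tens k H X (n + 1)
  coface n i := (cycInvC k H X (n + 1) ^ (i : ℕ) : Module.End k _) ∘ₗ comulFirst k H X n ∘ₗ
    (cycC k H X n ^ (i : ℕ) : Module.End k _)
  codegen n j := (cycInvC k H X n ^ (j : ℕ) : Module.End k _) ∘ₗ counitSecond k H X n ∘ₗ
    (cycC k H X (n + 1) ^ (j : ℕ) : Module.End k _)
  cyc := cycC k H X
  cycInv := cycInvC k H X

/-! ### The cyclic dual of the coinvariants `CM^c_*(H, X)` -/

/-- The span of all `h · m - ε(h) m` in `H^{⊗ n} ⊗ X`, for the diagonal action. -/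
def augSub (n : ℕ) : Submodule k (Tens k H X n) :=
  Submodule.span k (Set.range fun a : H × Tens k H X n =>
    diag k H X n a.1 a.2 - (counit a.1 : k) • a.2)

set_option linter.unusedSectionVars false

section Descent

variable {k H X}
variable {M : Type u} [AddCommGroup M] [Module k M] {Q : Type*} [AddCommGroup Q] [Module k Q]

lemma sInv_antipode [HasBijectiveAntipode k H] (h : H) :
    sInv k H (antipode k h) = h :=
  LinearEquiv.symm_apply_apply
    (LinearEquiv.ofBijective (antipode k : H →ₗ[k] H) HasBijectiveAntipode.bijective) h

lemma antipode_sInv [HasBijectiveAntipode k H] (h : H) :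
    antipode k (sInv k H h) = h :=
  LinearEquiv.apply_symm_apply
    (LinearEquiv.ofBijective (antipode k : H →ₗ[k] H) HasBijectiveAntipode.bijective) h

lemma sInv_mul [HasBijectiveAntipode k H] (a b : H) :
    sInv k H (a * b) = sInv k H b * sInv k H a := by
  apply (HasBijectiveAntipode.bijective (k := k) (H := H)).1
  simp [antipode_mul_antidistrib, antipode_sInv]

lemma sum_sInv_mul [HasBijectiveAntipode k H] (a : H) :
    ∑ i ∈ (ℛ k a).index, sInv k H ((ℛ k a).right i) * (ℛ k a).left i =
      (counit a : k) • (1 : H) := by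
  apply (HasBijectiveAntipode.bijective (k := k) (H := H)).1
  simp [antipode_mul_antidistrib, antipode_sInv, sum_antipode_mul_eq_smul]

lemma sum_mul_sInv [HasBijectiveAntipode k H] (a : H) :
    ∑ i ∈ (ℛ k a).index, (ℛ k a).right i * sInv k H ((ℛ k a).left i) =
      (counit a : k) • (1 : H) := by
  apply (HasBijectiveAntipode.bijective (k := k) (H := H)).1
  simp [antipode_mul_antidistrib, antipode_sInv, sum_mul_antipode_eq_smul]

lemma sum_coassoc (F : H →ₗ[k] H →ₗ[k] H →ₗ[k] Q) (a : H) :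
    ∑ i ∈ (ℛ k a).index, ∑ j ∈ (ℛ k ((ℛ k a).right i)).index,
      F ((ℛ k a).left i) ((ℛ k ((ℛ k a).right i)).left j) ((ℛ k ((ℛ k a).right i)).right j) =
    ∑ i ∈ (ℛ k a).index, ∑ j ∈ (ℛ k ((ℛ k a).left i)).index,
      F ((ℛ k ((ℛ k a).left i)).left j) ((ℛ k ((ℛ k a).left i)).right j) ((ℛ k a).right i) := by
  have h := congrArg (TensorProduct.lift ((TensorProduct.uncurry (RingHom.id k) H H Q) ∘ₗ F))
    (Coalgebra.sum_tmul_tmul_eq (ℛ k a) (fun i => ℛ k ((ℛ k a).left i))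
      (fun i => ℛ k ((ℛ k a).right i)))
  simpa using h.symm

lemma diagStep_tmul (d : H →ₗ[k] M →ₗ[k] M) (h g : H) (w : M) :
    diagStep k H d h (g ⊗ₜ[k] w) =
      ∑ i ∈ (ℛ k h).index, ((ℛ k h).left i * g) ⊗ₜ[k] d ((ℛ k h).right i) w := by
  simp only [diagStep, LinearMap.comp_apply]
  nth_rw 1 [← (ℛ k h).eq]
  simp [LinearMap.sum_apply]

lemma sum_coassoc' (f : H → H → H → Q) (h₁ : ∀ b c, IsLinearMap k fun a => f a b c)
    (h₂ : ∀ a c, IsLinearMap k fun b => f a b c) (h₃ : ∀ a b, IsLinearMap k fun c => f a b c)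
    (a : H) :
    ∑ i ∈ (ℛ k a).index, ∑ j ∈ (ℛ k ((ℛ k a).right i)).index,
      f ((ℛ k a).left i) ((ℛ k ((ℛ k a).right i)).left j) ((ℛ k ((ℛ k a).right i)).right j) =
    ∑ i ∈ (ℛ k a).index, ∑ j ∈ (ℛ k ((ℛ k a).left i)).index,
      f ((ℛ k ((ℛ k a).left i)).left j) ((ℛ k ((ℛ k a).left i)).right j) ((ℛ k a).right i) :=
  sum_coassoc
    { toFun := fun a => LinearMap.mk₂ k (f a) (fun _ _ _ => (h₂ _ _).map_add _ _)
        (fun _ _ _ => (h₂ _ _).map_smul _ _) (fun _ _ _ => (h₃ _ _).map_add _ _)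
        (fun _ _ _ => (h₃ _ _).map_smul _ _)
      map_add' := fun _ _ => by ext b c; exact (h₁ b c).map_add _ _
      map_smul' := fun _ _ => by ext b c; exact (h₁ b c).map_smul _ _ } a

lemma comul_equivariant (d : H →ₗ[k] M →ₗ[k] M) (h : H) (m : H ⊗[k] M) :
    TensorProduct.assoc k H H M (comul.rTensor M (diagStep k H d h m)) =
      diagStep k H (diagStep k H d) h (TensorProduct.assoc k H H M (comul.rTensor M m)) := by
  induction m with
  | zero => simp
  | add x y hx hy => simp only [map_add, hx, hy]
  | tmul g w =>
    simp only [diagStep_tmul, map_sum, LinearMap.rTensor_tmul, Bialgebra.comul_mul]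
    generalize comul (R := k) g = t
    induction t with
    | zero => simp
    | add x y hx hy => simp only [mul_add, TensorProduct.add_tmul, Finset.sum_add_distrib, map_add, hx, hy]
    | tmul g₁ g₂ =>
      simp only [TensorProduct.assoc_tmul, diagStep_tmul, TensorProduct.tmul_sum]
      rw [sum_coassoc' (fun a b c => (a * g₁) ⊗ₜ[k] ((b * g₂) ⊗ₜ[k] d c w))]
      · refine Finset.sum_congr rfl fun i _ => ?_
        conv_lhs => rw [← (ℛ k ((ℛ k h).left i)).eq]
        simp [Finset.sum_mul, TensorProduct.sum_tmul]
      all_goals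
        intros
        constructor <;> intros <;>
          simp [add_mul, TensorProduct.tmul_add, TensorProduct.add_tmul, ← TensorProduct.smul_tmul']

lemma counit_equivariant (d : H →ₗ[k] M →ₗ[k] M) (h : H) (m : H ⊗[k] (H ⊗[k] M)) :
    ((TensorProduct.lid k M).toLinearMap ∘ₗ counit.rTensor M).lTensor H
      (diagStep k H (diagStep k H d) h m) =
      diagStep k H d h
        (((TensorProduct.lid k M).toLinearMap ∘ₗ counit.rTensor M).lTensor H m) := by
  induction m with
  | zero => simp
  | add x y hx hy => simp only [map_add, hx, hy]
  | tmul g m =>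
    induction m with
    | zero => simp
    | add x y hx hy => simp only [TensorProduct.tmul_add, map_add, hx, hy]
    | tmul g₁ w =>
      simp only [diagStep_tmul, map_sum, LinearMap.lTensor_tmul, LinearMap.comp_apply,
        LinearMap.rTensor_tmul, LinearEquiv.coe_coe, TensorProduct.lid_tmul,
        Bialgebra.counit_mul, map_smul]
      refine Finset.sum_congr rfl fun i _ => ?_
      congr 1
      conv_rhs => rw [← sum_counit_smul (ℛ k ((ℛ k h).right i))]
      simp [Finset.smul_sum, smul_smul, mul_comm]

/-- The commutation rule of `τ` with the diagonal action. -/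
def CycRule [HasBijectiveAntipode k H] (d : H →ₗ[k] M →ₗ[k] M)
    (R : H ⊗[k] M →ₗ[k] H ⊗[k] M) : Prop :=
  ∀ (a g : H) (w : M), R (g ⊗ₜ[k] d a w) = ∑ i ∈ (ℛ k a).index,
    diagStep k H d ((ℛ k a).left i) (R ((sInv k H ((ℛ k a).right i) * g) ⊗ₜ[k] w))

/-- The commutation rule of `τ⁻¹` with the diagonal action. -/
def CycInvRule [HasBijectiveAntipode k H] (d : H →ₗ[k] M →ₗ[k] M)
    (E : H ⊗[k] M →ₗ[k] H ⊗[k] M) : Prop :=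
  ∀ (a : H) (m : H ⊗[k] M), E (diagStep k H d a m) = ∑ i ∈ (ℛ k a).index,
    TensorProduct.map (LinearMap.mulLeft k (sInv k H (sInv k H ((ℛ k a).right i))))
      (d ((ℛ k a).left i)) (E m)

lemma CycRule.step [HasBijectiveAntipode k H] {d : H →ₗ[k] M →ₗ[k] M}
    {R : H ⊗[k] M →ₗ[k] H ⊗[k] M} (hR : CycRule d R) :
    CycRule (diagStep k H d) (R.lTensor H ∘ₗ (TensorProduct.leftComm k H H M).toLinearMap) := by
  intro a g m
  induction m with
  | zero => simp
  | add x y hx hy => simp only [TensorProduct.tmul_add, map_add, hx, hy, Finset.sum_add_distrib]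
  | tmul h w =>
    simp only [diagStep_tmul, TensorProduct.tmul_sum, map_sum, LinearMap.comp_apply,
      LinearEquiv.coe_coe, TensorProduct.leftComm_tmul, LinearMap.lTensor_tmul, hR _ g w]
    rw [sum_coassoc' (fun a b c =>
      (a * h) ⊗ₜ[k] diagStep k H d b (R ((sInv k H c * g) ⊗ₜ[k] w)))]
    all_goals
      intros
      constructor <;> intros <;>
        simp [add_mul, TensorProduct.tmul_add, TensorProduct.add_tmul, ← TensorProduct.smul_tmul']

lemma CycInvRule.step [HasBijectiveAntipode k H] {d : H →ₗ[k] M →ₗ[k] M}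
    {E : H ⊗[k] M →ₗ[k] H ⊗[k] M} (hE : CycInvRule d E) :
    CycInvRule (diagStep k H d)
      ((TensorProduct.leftComm k H H M).toLinearMap ∘ₗ E.lTensor H) := by
  intro a m
  induction m with
  | zero => simp
  | add x y hx hy => simp only [map_add, hx, hy, Finset.sum_add_distrib]
  | tmul h m =>
    simp only [diagStep_tmul, map_sum, LinearMap.comp_apply, LinearEquiv.coe_coe,
      LinearMap.lTensor_tmul, hE _ m, TensorProduct.tmul_sum]
    generalize E m = t
    induction t with
    | zero => simp
    | add x y hx hy => simp only [TensorProduct.tmul_add, map_add, Finset.sum_add_distrib, hx, hy]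
    | tmul y u =>
      simp only [TensorProduct.map_tmul, TensorProduct.leftComm_tmul, diagStep_tmul,
        LinearMap.mulLeft_apply, TensorProduct.tmul_sum]
      rw [sum_coassoc' (fun a b c =>
        (sInv k H (sInv k H c) * y) ⊗ₜ[k] ((a * h) ⊗ₜ[k] d b u))]
      all_goals
        intros
        constructor <;> intros <;>
          simp [add_mul, TensorProduct.tmul_add, TensorProduct.add_tmul,
            ← TensorProduct.smul_tmul']

lemma CycRule.descend [HasBijectiveAntipode k H] {d : H →ₗ[k] M →ₗ[k] M}
    {R : H ⊗[k] M →ₗ[k] H ⊗[k] M} (hR : CycRule d R) (q : H ⊗[k] M →ₗ[k] Q)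
    (hq : ∀ a m, q (diagStep k H d a m) = (counit a : k) • q m) (a : H) (m : H ⊗[k] M) :
    q (R (diagStep k H d a m)) = (counit a : k) • q (R m) := by
  induction m with
  | zero => simp
  | add x y hx hy => simp only [map_add, hx, hy, smul_add]
  | tmul g w =>
    simp only [diagStep_tmul, map_sum, hR _ _ w, hq]
    have key : ∀ b g : H, ∑ j ∈ (ℛ k b).index, (counit ((ℛ k b).left j) : k) •
        q (R ((sInv k H ((ℛ k b).right j) * g) ⊗ₜ[k] w)) = q (R ((sInv k H b * g) ⊗ₜ[k] w)) := by
      intro b g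
      conv_rhs => rw [← sum_counit_smul (ℛ k b)]
      simp [Finset.sum_mul, TensorProduct.sum_tmul, ← TensorProduct.smul_tmul']
    simp only [key]
    simp only [← mul_assoc, ← map_sum, ← TensorProduct.sum_tmul, ← Finset.sum_mul, sum_sInv_mul]
    simp [← TensorProduct.smul_tmul']

lemma CycInvRule.descend [HasBijectiveAntipode k H] {d : H →ₗ[k] M →ₗ[k] M}
    {E : H ⊗[k] M →ₗ[k] H ⊗[k] M} (hE : CycInvRule d E) (q : H ⊗[k] M →ₗ[k] Q)
    (hq : ∀ a m, q (diagStep k H d a m) = (counit a : k) • q m) (a : H) (m : H ⊗[k] M) :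
    q (E (diagStep k H d a m)) = (counit a : k) • q (E m) := by
  have move : ∀ (a c : H) (w : M), q (c ⊗ₜ[k] d a w) = q ((sInv k H a * c) ⊗ₜ[k] w) := by
    intro a c w
    have h1 : ∑ i ∈ (ℛ k a).index, diagStep k H d ((ℛ k a).right i)
        ((sInv k H ((ℛ k a).left i) * c) ⊗ₜ[k] w) = c ⊗ₜ[k] d a w := by
      simp only [diagStep_tmul]
      rw [sum_coassoc' (fun x y z => (y * (sInv k H x * c)) ⊗ₜ[k] d z w)]
      · simp only [← mul_assoc, ← TensorProduct.sum_tmul, ← Finset.sum_mul, sum_mul_sInv]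
        conv_rhs => rw [← sum_counit_smul (ℛ k a)]
        simp [TensorProduct.tmul_sum, TensorProduct.smul_tmul]
      all_goals
        intros
        constructor <;> intros <;>
          simp [add_mul, mul_add, TensorProduct.tmul_add, TensorProduct.add_tmul,
            ← TensorProduct.smul_tmul']
    rw [← h1, map_sum]
    simp only [hq]
    have h2 : ∑ i ∈ (ℛ k a).index, (counit ((ℛ k a).right i) : k) • (ℛ k a).left i = a := by
      have := congrArg (TensorProduct.rid k H) (sum_tmul_counit_eq (ℛ k a))
      simpa only [map_sum, TensorProduct.rid_tmul, one_smul] using this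
    conv_rhs => rw [← h2]
    simp [Finset.sum_mul, TensorProduct.sum_tmul, ← TensorProduct.smul_tmul']
  rw [hE]
  generalize E m = t
  induction t with
  | zero => simp
  | add x y hx hy => simp only [map_add, Finset.sum_add_distrib, hx, hy, smul_add]
  | tmul y u =>
    simp only [TensorProduct.map_tmul, LinearMap.mulLeft_apply, map_sum, move, ← mul_assoc,
      ← sInv_mul]
    simp only [← map_sum, ← TensorProduct.sum_tmul, ← Finset.sum_mul, sum_sInv_mul]
    have h3 : sInv k H 1 = 1 := by
      rw [← antipode_one (R := k) (A := H), sInv_antipode, antipode_one]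
    simp [h3, ← TensorProduct.smul_tmul']

lemma actHom_apply (h : H) (x : X) : actHom k H X h x = h • x := rfl

lemma cotwist_tmul [LeftComodule k H X] (g : H) (x : X) :
    cotwist k H X (g ⊗ₜ[k] x) = (LinearMap.mulRight k g).rTensor X (coact k H X x) := by
  simp only [cotwist, LinearMap.comp_apply, LinearMap.lTensor_tmul]
  generalize coact k H X x = t
  induction t with
  | zero => simp
  | add x y hx hy => simp only [TensorProduct.tmul_add, map_add, hx, hy]
  | tmul y u => simp

lemma cotwistInv_tmul [HasBijectiveAntipode k H] [LeftComodule k H X] (g : H) (x : X) :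
    cotwistInv k H X (g ⊗ₜ[k] x) =
      (LinearMap.mulRight k g ∘ₗ sInv k H).rTensor X (coact k H X x) := by
  simp only [cotwistInv, LinearMap.comp_apply, LinearMap.lTensor_tmul]
  generalize coact k H X x = t
  induction t with
  | zero => simp
  | add x y hx hy => simp only [TensorProduct.tmul_add, map_add, hx, hy]
  | tmul y u => simp

lemma cycRule_zero [HasBijectiveAntipode k H] [LeftComodule k H X] [IsAntiYetterDrinfeld k H X] :
    CycRule (actHom k H X) (cotwist k H X) := by
  intro a g x
  simp only [actHom_apply, cotwist_tmul, IsAntiYetterDrinfeld.coact_smul]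
  generalize coact k H X x = t
  induction t with
  | zero => simp
  | add x y hx hy => simp only [map_add, Finset.sum_add_distrib, hx, hy]
  | tmul y u =>
    simp only [TensorProduct.map_tmul, map_sum, LinearMap.rTensor_tmul, diagStep_tmul,
      LinearMap.comp_apply, LinearMap.mulLeft_apply, LinearMap.mulRight_apply]
    rw [sum_coassoc' (fun a b c => (a * (y * sInv k H c) * g) ⊗ₜ[k] actHom k H X b u)]
    · simp only [mul_assoc]
    all_goals
      intros
      constructor <;> intros <;>
        simp [add_mul, mul_add, TensorProduct.tmul_add, TensorProduct.add_tmul,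
          ← TensorProduct.smul_tmul']

lemma cycInvRule_zero [HasBijectiveAntipode k H] [LeftComodule k H X]
    [IsAntiYetterDrinfeld k H X] : CycInvRule (actHom k H X) (cotwistInv k H X) := by
  intro a m
  induction m with
  | zero => simp
  | add x y hx hy => simp only [map_add, hx, hy, Finset.sum_add_distrib]
  | tmul g x =>
    simp only [diagStep_tmul, map_sum, actHom_apply, cotwistInv_tmul,
      IsAntiYetterDrinfeld.coact_smul]
    generalize coact k H X x = t
    induction t with
    | zero => simp
    | add x y hx hy => simp only [map_add, Finset.sum_add_distrib, hx, hy]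
    | tmul y u =>
      let Ψ : H → H → H ⊗[k] X := fun c z =>
        TensorProduct.map (LinearMap.mulRight k (sInv k H y * z) ∘ₗ sInv k H ∘ₗ sInv k H)
          ((actHom k H X).flip u) (TensorProduct.comm k H H (comul c))
      have hΨ : ∀ c z, ∑ i ∈ (ℛ k c).index,
          (sInv k H (sInv k H ((ℛ k c).right i)) * (sInv k H y * z)) ⊗ₜ[k]
            (actHom k H X ((ℛ k c).left i) u) = Ψ c z := by
        intro c z
        simp only [Ψ]
        conv_rhs => rw [← (ℛ k c).eq]
        simp [mul_assoc]
      have hΨ₁ : ∀ z, IsLinearMap k fun c => Ψ c z := fun z =>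
        ⟨fun _ _ => by simp [Ψ], fun _ _ => by simp [Ψ]⟩
      have hΨ₂ : ∀ c, IsLinearMap k fun z => Ψ c z := fun c =>
        ⟨fun _ _ => by
            simp only [← hΨ, mul_add, TensorProduct.add_tmul, Finset.sum_add_distrib],
          fun _ _ => by
            simp only [← hΨ, mul_smul_comm, ← TensorProduct.smul_tmul', Finset.smul_sum]⟩
      simp only [TensorProduct.map_tmul, LinearMap.rTensor_tmul, LinearMap.comp_apply,
        LinearMap.mulLeft_apply, LinearMap.mulRight_apply, sInv_mul, mul_assoc, hΨ]
      rw [sum_coassoc' (fun a b c => Ψ c (sInv k H b * (a * g)))]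
      · have h1 : ∀ i, ∑ j ∈ (ℛ k ((ℛ k a).left i)).index,
            Ψ ((ℛ k a).right i) (sInv k H ((ℛ k ((ℛ k a).left i)).right j) *
              ((ℛ k ((ℛ k a).left i)).left j * g)) =
            (counit ((ℛ k a).left i) : k) • Ψ ((ℛ k a).right i) g := by
          intro i
          rw [← (hΨ₂ _).map_smul]
          have := map_sum (hΨ₂ ((ℛ k a).right i)).mk' (fun j =>
            sInv k H ((ℛ k ((ℛ k a).left i)).right j) * ((ℛ k ((ℛ k a).left i)).left j * g))
            (ℛ k ((ℛ k a).left i)).index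
          simp only [IsLinearMap.mk'_apply] at this
          rw [← this]
          simp only [← mul_assoc, ← Finset.sum_mul, sum_sInv_mul]
          simp
        simp only [h1]
        have h2 := map_sum (hΨ₁ g).mk' (fun i => (counit ((ℛ k a).left i) : k) • (ℛ k a).right i)
          (ℛ k a).index
        simp only [IsLinearMap.mk'_apply, (hΨ₁ g).map_smul, sum_counit_smul] at h2
        exact h2.symm
      · intro b c
        exact ⟨fun _ _ => by simp [add_mul, mul_add, (hΨ₂ _).map_add],
          fun _ _ => by simp [(hΨ₂ _).map_smul]⟩
      · intro b c
        exact ⟨fun _ _ => by simp [add_mul, (hΨ₂ _).map_add],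
          fun _ _ => by simp [(hΨ₂ _).map_smul]⟩
      · intro b c
        exact hΨ₁ _

lemma CycRule.step_comp [HasBijectiveAntipode k H] {d : H →ₗ[k] M →ₗ[k] M}
    {f g : H ⊗[k] M →ₗ[k] H ⊗[k] M} (h : CycRule d (f ∘ₗ g)) :
    CycRule (diagStep k H d)
      (f.lTensor H ∘ₗ g.lTensor H ∘ₗ (TensorProduct.leftComm k H H M).toLinearMap) := by
  have h := h.step
  rwa [LinearMap.lTensor_comp] at h

lemma CycInvRule.step_comp [HasBijectiveAntipode k H] {d : H →ₗ[k] M →ₗ[k] M}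
    {f g : H ⊗[k] M →ₗ[k] H ⊗[k] M} (h : CycInvRule d (f ∘ₗ g)) :
    CycInvRule (diagStep k H d)
      (((TensorProduct.leftComm k H H M).toLinearMap ∘ₗ f.lTensor H) ∘ₗ g.lTensor H) := by
  have h := h.step
  rwa [LinearMap.lTensor_comp] at h

lemma cycRule_cycC [HasBijectiveAntipode k H] [LeftComodule k H X] [IsAntiYetterDrinfeld k H X] :
    ∀ n, CycRule (diag k H X n) (cycC k H X n)
  | 0 => cycRule_zero (k := k) (H := H) (X := X)
  | n + 1 => (cycRule_cycC n).step_comp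

lemma cycInvRule_cycInvC [HasBijectiveAntipode k H] [LeftComodule k H X]
    [IsAntiYetterDrinfeld k H X] : ∀ n, CycInvRule (diag k H X n) (cycInvC k H X n)
  | 0 => cycInvRule_zero (k := k) (H := H) (X := X)
  | n + 1 => (cycInvRule_cycInvC n).step_comp

lemma mkQ_diag (n : ℕ) (a : H) (m : Tens k H X n) :
    (augSub k H X n).mkQ (diag k H X n a m) = (counit a : k) • (augSub k H X n).mkQ m := by
  rw [← map_smul, ← sub_eq_zero, ← map_sub]
  exact (Submodule.Quotient.mk_eq_zero _).2 (Submodule.subset_span ⟨(a, m), rfl⟩)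

lemma augSub_le_comap {a b : ℕ} (f : Tens k H X a →ₗ[k] Tens k H X b)
    (hf : ∀ h m, (augSub k H X b).mkQ (f (diag k H X a h m)) =
      (counit h : k) • (augSub k H X b).mkQ (f m)) :
    augSub k H X a ≤ (augSub k H X b).comap f := by
  refine Submodule.span_le.2 ?_
  rintro _ ⟨⟨h, m⟩, rfl⟩
  rw [SetLike.mem_coe, Submodule.mem_comap, ← Submodule.ker_mkQ (augSub k H X b),
    LinearMap.mem_ker]
  have := hf h m
  rw [← map_smul, ← sub_eq_zero, ← map_sub, ← map_smul, ← map_sub] at this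
  exact this

lemma augSub_le_cycC [HasBijectiveAntipode k H] [LeftComodule k H X]
    [IsAntiYetterDrinfeld k H X] (n : ℕ) :
    augSub k H X (n + 1) ≤ (augSub k H X (n + 1)).comap (cycC k H X n) :=
  augSub_le_comap _ fun h m =>
    (cycRule_cycC n).descend (augSub k H X (n + 1)).mkQ (mkQ_diag (n + 1)) h m

lemma augSub_le_cycInvC [HasBijectiveAntipode k H] [LeftComodule k H X]
    [IsAntiYetterDrinfeld k H X] (n : ℕ) :
    augSub k H X (n + 1) ≤ (augSub k H X (n + 1)).comap (cycInvC k H X n) :=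
  augSub_le_comap _ fun h m =>
    (cycInvRule_cycInvC n).descend (augSub k H X (n + 1)).mkQ (mkQ_diag (n + 1)) h m

lemma augSub_le_comulFirst (n : ℕ) :
    augSub k H X (n + 1) ≤ (augSub k H X (n + 2)).comap (comulFirst k H X n) :=
  augSub_le_comap _ fun h m => by
    rw [← mkQ_diag]
    exact congrArg _ (comul_equivariant (diag k H X n) h m)

lemma augSub_le_counitSecond (n : ℕ) :
    augSub k H X (n + 2) ≤ (augSub k H X (n + 1)).comap (counitSecond k H X n) :=
  augSub_le_comap _ fun h m => by
    rw [← mkQ_diag]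
    exact congrArg _ (counit_equivariant (diag k H X n) h m)

lemma augSub_le_pow {n : ℕ} {f : Module.End k (Tens k H X n)}
    (hf : augSub k H X n ≤ (augSub k H X n).comap f) (i : ℕ) :
    augSub k H X n ≤ (augSub k H X n).comap (f ^ i) := by
  induction i with
  | zero => exact fun x hx => hx
  | succ i ih =>
    intro x hx
    have : (f ^ (i + 1)) x = (f ^ i) (f x) := by rw [pow_succ]; rfl
    rw [Submodule.mem_comap, this]
    exact ih (hf hx)

lemma augSub_le_coface [HasBijectiveAntipode k H] [LeftComodule k H X]
    [IsAntiYetterDrinfeld k H X] (n : ℕ) (i : Fin (n + 2)) :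
    augSub k H X (n + 1) ≤ (augSub k H X (n + 2)).comap ((Tc k H X).coface n i) := by
  intro m hm
  have h₁ := augSub_le_pow (augSub_le_cycC (k := k) (H := H) (X := X) n) i hm
  have h₂ := augSub_le_comulFirst n h₁
  exact augSub_le_pow (augSub_le_cycInvC (k := k) (H := H) (X := X) (n + 1)) i h₂

lemma augSub_le_codegen [HasBijectiveAntipode k H] [LeftComodule k H X]
    [IsAntiYetterDrinfeld k H X] (n : ℕ) (j : Fin (n + 1)) :
    augSub k H X (n + 2) ≤ (augSub k H X (n + 1)).comap ((Tc k H X).codegen n j) := by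
  intro m hm
  have h₁ := augSub_le_pow (augSub_le_cycC (k := k) (H := H) (X := X) (n + 1)) j hm
  have h₂ := augSub_le_counitSecond n h₁
  exact augSub_le_pow (augSub_le_cycInvC (k := k) (H := H) (X := X) n) j h₂

end Descent

/-- `CM^c_*(H, X) = k ⊗_H T^c_*(H, X)`, with the structure maps induced from `T^c_*(H, X)`. -/
def CMc [HasBijectiveAntipode k H] [LeftComodule k H X] [IsAntiYetterDrinfeld k H X] :
    ParaCocyclicData.{u} k :=
  (Tc k H X).quotient (fun n => augSub k H X (n + 1))
    augSub_le_coface augSub_le_codegen augSub_le_cycC augSub_le_cycInvC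

/-- The quotient map `q_n : T^c_n(H, X) → CM^c_n(H, X)`. -/
def qC [HasBijectiveAntipode k H] [LeftComodule k H X] [IsAntiYetterDrinfeld k H X] (n : ℕ) :
    (Tc k H X).dual.obj n →ₗ[k] (CMc k H X).dual.obj n :=
  (augSub k H X (n + 1)).mkQ

/-- `h^1 ⊗ ⋯ ⊗ h^n ⊗ x ↦ h^1_(1) ⊗ h^1_(2) h^2_(1) ⊗ ⋯ ⊗ h^1_(n) h^2_(n-1) ⋯ h^n_(1) ⊗
h^1_(n+1) h^2_(n) ⋯ h^n_(2) x`, through the recursion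
`A_{n+1} (h ⊗ m) = h_(1) ⊗ h_(2) · A_n m` for the diagonal action. -/
def alphaAux : (n : ℕ) → Tens k H X n →ₗ[k] Tens k H X n
  | 0 => LinearMap.id
  | n + 1 => (TensorProduct.lift (diag k H X n)).lTensor H ∘ₗ
      (TensorProduct.assoc k H H (Tens k H X n)).toLinearMap ∘ₗ
      TensorProduct.map comul (alphaAux n)

/-- `α_n : T^a_n(H, X) → T^c_n(H, X)^∨`, `α_n (h^0 ⊗ ⋯ ⊗ h^n ⊗ x) =
h^0_(1) ⊗ h^0_(2) h^1_(1) ⊗ ⋯ ⊗ h^0_(n+1) h^1_(n) ⋯ h^n_(1) ⊗ h^0_(n+2) h^1_(n+1) ⋯ h^n_(2) x`. -/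
def alpha [HasBijectiveAntipode k H] [LeftComodule k H X] (n : ℕ) :
    (Ta k H X).obj n →ₗ[k] (Tc k H X).dual.obj n :=
  alphaAux k H X (n + 1)

end HopfCyclic

end

/-!
The coinvariants of `T^a_n(H, X)` and the quotient `CM^c_n(H, X)` are both copies of
`H^{⊗ n} ⊗ X`, and `q α` matches the two descriptions.

On the algebra side, `H^{⊗ n} ⊗ X` carries the right coaction `ρ` of the diagonal kind
(`isRightCoaction_coactR`). For any right comodule `M`, the map `s : m ↦ S⁻¹(m_(1)) ⊗ m_(0)` is a
bijection from `M` to the coinvariants of `H ⊗ M`, with inverse `ε ⊗ id`. The anti-Yetter-Drinfeld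
condition gives `s i = τ` on coinvariants (`sectionA_absorb`), so that `τ` preserves them, and the
stability condition `S(x_(-1)) x_(0) = x` gives `p = τ⁻¹ s` (`pA_eq`).

On the coalgebra side, `m ↦ [1 ⊗ m]` is a bijection from `H^{⊗ n} ⊗ X` to `CM^c_n(H, X)`
(`mkQ_one_tmul_bijective`), and there is a bijection `A` of `H^{⊗ n} ⊗ X`, the map `alphaAux`, with
`α (h ⊗ m) = h · (1 ⊗ A m)`. Hence `q α y = [1 ⊗ A (ε ⊗ id) y]`, which is bijective on coinvariants.
The main computation is `τ_c (1 ⊗ A (i y)) = α y` for coinvariant `y`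
(`cycC_one_tmul_alphaAux_absorb`); it shows that `q α` carries `τ` to `τ_c⁻¹`. The compatibilities
with `∂_0` and `σ_0` are formal, and these generate all structure maps.

That `CM^c_*(H, X)` is cocyclic rests on the relation `τ^{n+1} = 1`. The operator `τ_c^{n+1}`
multiplies the `H`-factors of a pure tensor by the iterated coaction of `x`; by stability this is the diagonal
action of `x_(-1)` on the tensor with `x_(0)` in place of `x`, which is trivial in the quotient
(`mkQ_cycC_pow`). Given this relation, all cocyclic identities follow from those among the operators
`τ^{-i} ∂_0 τ^i` and `τ^{-j} σ_0 τ^j` of `T^c_*(H, X)` that act as the comultiplication and the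
counit in one tensor factor (`IsGenerated.isCocyclic`). The cyclic dual is then cyclic. Since `q α` is
injective on coinvariants, `τ^{n+1} = 1` holds there too; this is why `τ⁻¹` preserves the
coinvariants, and why the image of `p = τ⁻¹ s` is all of them. The identities for `CM^a_*(H, X)` are pulled back
along the bijection `q α p`.
-/

noncomputable section

namespace HopfCyclic

open TensorProduct Coalgebra HopfAlgebra

/-! ### Hopf algebra identities -/

section Antipode

variable {k : Type v} [Field k] {H : Type u} [Ring H] [HopfAlgebra k H]
  {Q : Type*} [AddCommGroup Q] [Module k Q]

lemma sum_isLinearMap {R M ι : Type*} [AddCommGroup R] [Module k R] [AddCommGroup M] [Module k M]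
    {g : R → M} (hg : IsLinearMap k g) (s : Finset ι) (u : ι → R) :
    ∑ i ∈ s, g (u i) = g (∑ i ∈ s, u i) :=
  (map_sum hg.mk' u s).symm

lemma sInv_one [HasBijectiveAntipode k H] : sInv k H 1 = 1 := by
  rw [← antipode_one (R := k) (A := H), sInv_antipode, antipode_one]

lemma counit_sInv [HasBijectiveAntipode k H] (a : H) :
    (counit (sInv k H a) : k) = counit a := by
  conv_rhs => rw [← antipode_sInv (k := k) a, counit_antipode]

lemma sum_tmul_counit_smul (a : H) :
    ∑ i ∈ (ℛ k a).index, (counit ((ℛ k a).right i) : k) • (ℛ k a).left i = a := by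
  have := congrArg (TensorProduct.rid k H) (sum_tmul_counit_eq (ℛ k a))
  simpa only [map_sum, TensorProduct.rid_tmul, one_smul] using this

/-- `f(ε(a_(1)) 1, a_(2)) = f(1, a)` for bilinear `f`. -/
lemma sum_left_of_counit (f : H → H → Q) (h₁ : ∀ b, IsLinearMap k fun a => f a b)
    (h₂ : ∀ a, IsLinearMap k fun b => f a b) (a : H) :
    ∑ i ∈ (ℛ k a).index, f ((counit ((ℛ k a).left i) : k) • 1) ((ℛ k a).right i) = f 1 a := by
  simp only [(h₁ _).map_smul, ← (h₂ _).map_smul]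
  rw [sum_isLinearMap (h₂ 1), sum_counit_smul]

/-- `f(a_(1), ε(a_(2)) 1) = f(a, 1)` for bilinear `f`. -/
lemma sum_right_of_counit (f : H → H → Q) (h₁ : ∀ b, IsLinearMap k fun a => f a b)
    (h₂ : ∀ a, IsLinearMap k fun b => f a b) (a : H) :
    ∑ i ∈ (ℛ k a).index, f ((ℛ k a).left i) ((counit ((ℛ k a).right i) : k) • 1) = f a 1 := by
  simp only [(h₂ _).map_smul, ← (h₁ _).map_smul]
  rw [sum_isLinearMap (h₁ 1), sum_tmul_counit_smul]

/-- `f(S(a_(1)) a_(2), a_(3)) = f(1, a)`. -/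
lemma sum_antipode_mul_left (f : H → H → Q) (h₁ : ∀ b, IsLinearMap k fun a => f a b)
    (h₂ : ∀ a, IsLinearMap k fun b => f a b) (a : H) :
    ∑ i ∈ (ℛ k a).index, ∑ j ∈ (ℛ k ((ℛ k a).right i)).index,
      f (antipode k ((ℛ k a).left i) * (ℛ k ((ℛ k a).right i)).left j)
        ((ℛ k ((ℛ k a).right i)).right j) = f 1 a := by
  rw [sum_coassoc' (fun x y z => f (antipode k x * y) z)]
  · rw [← sum_left_of_counit f h₁ h₂ a]
    refine Finset.sum_congr rfl fun i _ => ?_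
    rw [sum_isLinearMap (h₁ _), sum_antipode_mul_eq_smul]
  · exact fun b c => ⟨fun _ _ => by simp [add_mul, (h₁ c).map_add],
      fun _ _ => by simp [(h₁ c).map_smul]⟩
  · exact fun b c => ⟨fun _ _ => by simp [mul_add, (h₁ c).map_add],
      fun _ _ => by simp [(h₁ c).map_smul]⟩
  · exact fun b c => h₂ _

/-- `f(a_(1), a_(2) S(a_(3))) = f(a, 1)`. -/
lemma sum_mul_antipode_right (f : H → H → Q) (h₁ : ∀ b, IsLinearMap k fun a => f a b)
    (h₂ : ∀ a, IsLinearMap k fun b => f a b) (a : H) :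
    ∑ i ∈ (ℛ k a).index, ∑ j ∈ (ℛ k ((ℛ k a).right i)).index,
      f ((ℛ k a).left i) ((ℛ k ((ℛ k a).right i)).left j *
        antipode k ((ℛ k ((ℛ k a).right i)).right j)) = f a 1 := by
  rw [← sum_right_of_counit f h₁ h₂ a]
  refine Finset.sum_congr rfl fun i _ => ?_
  rw [sum_isLinearMap (h₂ _), sum_mul_antipode_eq_smul]

/-- `f(a_(1), S(a_(2)) a_(3)) = f(a, 1)`. -/
lemma sum_antipode_mul_right (f : H → H → Q) (h₁ : ∀ b, IsLinearMap k fun a => f a b)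
    (h₂ : ∀ a, IsLinearMap k fun b => f a b) (a : H) :
    ∑ i ∈ (ℛ k a).index, ∑ j ∈ (ℛ k ((ℛ k a).right i)).index,
      f ((ℛ k a).left i) (antipode k ((ℛ k ((ℛ k a).right i)).left j) *
        (ℛ k ((ℛ k a).right i)).right j) = f a 1 := by
  rw [← sum_right_of_counit f h₁ h₂ a]
  refine Finset.sum_congr rfl fun i _ => ?_
  rw [sum_isLinearMap (h₂ _), sum_antipode_mul_eq_smul]

open scoped RingTheory.LinearMap in
/-- The antipode reverses comultiplication: both sides are convolution inverse to `Δ`. -/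
lemma comul_antipode (a : H) : comul (R := k) (antipode k a) =
    TensorProduct.map (antipode k) (antipode k) (TensorProduct.comm k H H (comul a)) := by
  let G : H →ₗ[k] H ⊗[k] H := TensorProduct.map (antipode k) (antipode k) ∘ₗ
    (TensorProduct.comm k H H).toLinearMap ∘ₗ comul
  have hG : WithConv.toConv G * WithConv.toConv (comul (R := k) (A := H)) = 1 := by
    ext a
    rw [(ℛ k a).convMul_apply]
    have hl : ∀ b, G b = ∑ j ∈ (ℛ k b).index,
        antipode k ((ℛ k b).right j) ⊗ₜ[k] antipode k ((ℛ k b).left j) := fun b => by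
      simp only [G, LinearMap.comp_apply]
      conv_lhs => rw [← (ℛ k b).eq]
      simp
    have h1 : ∀ b, ∑ j ∈ (ℛ k b).index,
        (antipode k ((ℛ k b).left j) ⊗ₜ[k] (1 : H)) * comul (R := k) ((ℛ k b).right j) =
        1 ⊗ₜ[k] b := by
      intro b
      rw [← sum_antipode_mul_left (k := k) (fun x y : H => x ⊗ₜ[k] y)
        (fun _ => ⟨fun _ _ => by simp [TensorProduct.add_tmul], fun _ _ => rfl⟩)
        (fun _ => ⟨fun _ _ => by simp [TensorProduct.tmul_add], fun _ _ => by simp⟩) b]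
      refine Finset.sum_congr rfl fun j _ => ?_
      conv_lhs => rw [← (ℛ k ((ℛ k b).right j)).eq]
      simp [Finset.mul_sum]
    simp only [hl, Finset.sum_mul]
    rw [← sum_coassoc' (fun x y z =>
      (antipode k y ⊗ₜ[k] antipode k x) * comul (R := k) z)]
    · have h2 : ∀ i, ∑ j ∈ (ℛ k ((ℛ k a).right i)).index,
          (antipode k ((ℛ k ((ℛ k a).right i)).left j) ⊗ₜ[k] antipode k ((ℛ k a).left i)) *
            comul (R := k) ((ℛ k ((ℛ k a).right i)).right j) =
          1 ⊗ₜ[k] (antipode k ((ℛ k a).left i) * (ℛ k a).right i) := by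
        intro i
        have := congrArg (fun z => ((1 : H) ⊗ₜ[k] antipode k ((ℛ k a).left i)) * z)
          (h1 ((ℛ k a).right i))
        simpa [Finset.mul_sum, ← mul_assoc] using this
      simp only [h2, ← TensorProduct.tmul_sum, sum_antipode_mul_eq_smul]
      simp [Algebra.algebraMap_eq_smul_one, Algebra.TensorProduct.one_def]
    all_goals
      intros
      constructor <;> intros <;>
        simp [add_mul, mul_add, TensorProduct.tmul_add, TensorProduct.add_tmul,
          ← TensorProduct.smul_tmul']
  have := left_inv_eq_right_inv hG (LinearMap.comul_right_inv (R := k) (C := H))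
  exact (congrArg (fun z => z.ofConv a) this).symm

lemma comul_sInv [HasBijectiveAntipode k H] (a : H) : comul (R := k) (sInv k H a) =
    TensorProduct.map (sInv k H) (sInv k H) (TensorProduct.comm k H H (comul a)) := by
  have h := comul_antipode (k := k) (sInv k H a)
  rw [antipode_sInv] at h
  rw [h]
  generalize comul (R := k) (sInv k H a) = t
  induction t with
  | zero => simp
  | add x y hx hy => simp only [map_add, ← hx, ← hy]
  | tmul x y => simp [sInv_antipode]

end Antipode

/-! ### Right coactions and their coinvariants -/

section Coaction

variable {k : Type v} [Field k] {H : Type u} [Ring H] [HopfAlgebra k H]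
  {M : Type u} [AddCommGroup M] [Module k M]

/-- A right `H`-comodule structure `m ↦ m_(0) ⊗ m_(1)`, with its `H`-factor written on the left:
`c m = m_(1) ⊗ m_(0)`. -/
structure IsRightCoaction (c : M →ₗ[k] H ⊗[k] M) : Prop where
  counit_apply : ∀ m, TensorProduct.lid k M (counit.rTensor M (c m)) = m
  coassoc_apply : ∀ m, c.lTensor H (c m) = TensorProduct.assoc k H H M
    (((TensorProduct.comm k H H).toLinearMap ∘ₗ comul).rTensor M (c m))

/-- The codiagonal coaction `h ⊗ m ↦ h_(2) m_(1) ⊗ (h_(1) ⊗ m_(0))` on `H ⊗ M`. -/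
def coactStep (c : M →ₗ[k] H ⊗[k] M) : H ⊗[k] M →ₗ[k] H ⊗[k] (H ⊗[k] M) :=
  (LinearMap.mul' k H).rTensor (H ⊗[k] M) ∘ₗ
    (TensorProduct.tensorTensorTensorComm k H H H M).toLinearMap ∘ₗ
    TensorProduct.map ((TensorProduct.comm k H H).toLinearMap ∘ₗ comul) c

lemma coactStep_tmul (c : M →ₗ[k] H ⊗[k] M) (h : H) (m : M) :
    coactStep c (h ⊗ₜ[k] m) = ∑ i ∈ (ℛ k h).index,
      TensorProduct.map (LinearMap.mul k H ((ℛ k h).right i))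
        (TensorProduct.mk k H M ((ℛ k h).left i)) (c m) := by
  simp only [coactStep, LinearMap.comp_apply, TensorProduct.map_tmul]
  generalize c m = t
  nth_rw 1 [← (ℛ k h).eq]
  induction t with
  | zero => simp
  | add x y hx hy => simp only [TensorProduct.tmul_add, map_add, hx, hy, Finset.sum_add_distrib]
  | tmul w u => simp [TensorProduct.sum_tmul]

lemma IsRightCoaction.step {c : M →ₗ[k] H ⊗[k] M} (hc : IsRightCoaction c) :
    IsRightCoaction (coactStep c) where
  counit_apply t := by
    induction t with
    | zero => simp
    | add x y hx hy => simp only [map_add, hx, hy]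
    | tmul h m =>
      have h1 : ∀ t : H ⊗[k] M, TensorProduct.lid k (H ⊗[k] M) (counit.rTensor (H ⊗[k] M)
          (∑ i ∈ (ℛ k h).index, TensorProduct.map (LinearMap.mul k H ((ℛ k h).right i))
            (TensorProduct.mk k H M ((ℛ k h).left i)) t)) =
          h ⊗ₜ[k] (TensorProduct.lid k M (counit.rTensor M t)) := by
        intro t
        induction t with
        | zero => simp
        | add x y hx hy =>
          simp only [map_add, TensorProduct.tmul_add, ← hx, ← hy, Finset.sum_add_distrib]
        | tmul w u =>
          conv_rhs => rw [← sum_tmul_counit_smul (k := k) h]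
          simp only [map_sum, TensorProduct.map_tmul, LinearMap.rTensor_tmul,
            TensorProduct.lid_tmul, LinearMap.mul_apply', Bialgebra.counit_mul,
            TensorProduct.mk_apply, TensorProduct.sum_tmul, mul_smul, TensorProduct.tmul_smul]
          simp only [← TensorProduct.smul_tmul', Finset.smul_sum]
          exact Finset.sum_congr rfl fun i _ => smul_comm _ _ _
      rw [coactStep_tmul, h1, hc.counit_apply]
  coassoc_apply t := by
    induction t with
    | zero => simp
    | add x y hx hy => simp only [map_add, hx, hy]
    | tmul h m =>
      let G : H → H → H → H ⊗[k] (H ⊗[k] M) →ₗ[k] H ⊗[k] (H ⊗[k] (H ⊗[k] M)) :=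
        fun x y z => TensorProduct.map (LinearMap.mul k H z)
          (TensorProduct.map (LinearMap.mul k H y) (TensorProduct.mk k H M x))
      have hL : ∀ t : H ⊗[k] M, (coactStep c).lTensor H (∑ i ∈ (ℛ k h).index,
          TensorProduct.map (LinearMap.mul k H ((ℛ k h).right i))
            (TensorProduct.mk k H M ((ℛ k h).left i)) t) =
          ∑ i ∈ (ℛ k h).index, ∑ j ∈ (ℛ k ((ℛ k h).left i)).index,
            G ((ℛ k ((ℛ k h).left i)).left j) ((ℛ k ((ℛ k h).left i)).right j)
              ((ℛ k h).right i) (c.lTensor H t) := by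
        intro t
        induction t with
        | zero => simp
        | add x y hx hy => simp only [map_add, ← hx, ← hy, Finset.sum_add_distrib]
        | tmul w u => simp [coactStep_tmul, TensorProduct.tmul_sum, G]
      have hR : ∀ t : H ⊗[k] M, TensorProduct.assoc k H H (H ⊗[k] M)
          (((TensorProduct.comm k H H).toLinearMap ∘ₗ comul).rTensor (H ⊗[k] M)
            (∑ i ∈ (ℛ k h).index,
              TensorProduct.map (LinearMap.mul k H ((ℛ k h).right i))
                (TensorProduct.mk k H M ((ℛ k h).left i)) t)) =
          ∑ i ∈ (ℛ k h).index, ∑ j ∈ (ℛ k ((ℛ k h).right i)).index,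
            G ((ℛ k h).left i) ((ℛ k ((ℛ k h).right i)).left j)
              ((ℛ k ((ℛ k h).right i)).right j) (TensorProduct.assoc k H H M
    (((TensorProduct.comm k H H).toLinearMap ∘ₗ comul).rTensor M t)) := by
        intro t
        induction t with
        | zero => simp
        | add x y hx hy => simp only [map_add, ← hx, ← hy, Finset.sum_add_distrib]
        | tmul w u =>
          simp only [map_sum, TensorProduct.map_tmul, LinearMap.rTensor_tmul,
            LinearMap.comp_apply, LinearMap.mul_apply', Bialgebra.comul_mul]
          refine Finset.sum_congr rfl fun i _ => ?_
          generalize comul (R := k) w = s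
          conv_lhs => rw [← (ℛ k ((ℛ k h).right i)).eq]
          induction s with
          | zero => simp
          | add x y hx hy =>
            simp only [map_add, mul_add, TensorProduct.add_tmul, hx, hy, Finset.sum_add_distrib]
          | tmul x y => simp [Finset.sum_mul, TensorProduct.sum_tmul, G]
      rw [coactStep_tmul, hL, hR, hc.coassoc_apply]
      generalize TensorProduct.assoc k H H M
        (((TensorProduct.comm k H H).toLinearMap ∘ₗ comul).rTensor M (c m)) = s
      rw [sum_coassoc' (fun x y z => G x y z s)]
      all_goals
        intro x y
        constructor <;> intros <;>
          simp [G, TensorProduct.map_add_left, TensorProduct.map_add_right,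
            TensorProduct.map_smul_left, TensorProduct.map_smul_right, map_add, map_smul]

/-- `m ↦ S⁻¹(m_(1)) ⊗ m_(0)`: the coinvariant element of `H ⊗ M` with component `m`. -/
def coinvSection [HasBijectiveAntipode k H] (c : M →ₗ[k] H ⊗[k] M) : M →ₗ[k] H ⊗[k] M :=
  (sInv k H).rTensor M ∘ₗ c

/-- `h ⊗ m ↦ ε(h) m`. -/
def dropFirst (k : Type v) [Field k] (H : Type u) [Ring H] [HopfAlgebra k H]
    (M : Type u) [AddCommGroup M] [Module k M] : H ⊗[k] M →ₗ[k] M :=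
  (TensorProduct.lid k M).toLinearMap ∘ₗ counit.rTensor M

@[simp] lemma dropFirst_tmul (h : H) (m : M) :
    dropFirst k H M (h ⊗ₜ[k] m) = (counit h : k) • m := by
  simp [dropFirst]

variable [HasBijectiveAntipode k H]

lemma dropFirst_coinvSection {c : M →ₗ[k] H ⊗[k] M} (hc : IsRightCoaction c) (m : M) :
    dropFirst k H M (coinvSection c m) = m := by
  have : dropFirst k H M ∘ₗ (sInv k H).rTensor M = dropFirst k H M := by
    ext h m
    simp [counit_sInv]
  exact (LinearMap.congr_fun this (c m)).trans (hc.counit_apply m)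

/-- The section takes values in the coinvariants: its coaction is
`S⁻¹(m_(2)) m_(1) ⊗ S⁻¹(m_(3)) ⊗ m_(0) = 1 ⊗ S⁻¹(m_(1)) ⊗ m_(0)`. -/
lemma coactStep_coinvSection {c : M →ₗ[k] H ⊗[k] M} (hc : IsRightCoaction c) (m : M) :
    coactStep c (coinvSection c m) = 1 ⊗ₜ[k] coinvSection c m := by
  let Θ : H → H → M → H ⊗[k] (H ⊗[k] M) := fun w x u =>
    ∑ i ∈ (ℛ k w).index, (sInv k H ((ℛ k w).left i) * x) ⊗ₜ[k]
      (sInv k H ((ℛ k w).right i) ⊗ₜ[k] u)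
  let Ψ : H ⊗[k] (H ⊗[k] M) →ₗ[k] H ⊗[k] (H ⊗[k] M) :=
    (LinearMap.mul' k H ∘ₗ (sInv k H).rTensor H).rTensor (H ⊗[k] M) ∘ₗ
    (TensorProduct.tensorTensorTensorComm k H H H M).toLinearMap ∘ₗ
    ((sInv k H).lTensor H ∘ₗ comul).rTensor (H ⊗[k] M)
  have hΨ : ∀ w x u, Ψ (w ⊗ₜ[k] (x ⊗ₜ[k] u)) = ∑ i ∈ (ℛ k w).index,
      (sInv k H ((ℛ k w).left i) * x) ⊗ₜ[k] (sInv k H ((ℛ k w).right i) ⊗ₜ[k] u) := by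
    intro w x u
    simp only [Ψ, LinearMap.comp_apply, LinearMap.rTensor_tmul]
    conv_lhs => rw [← (ℛ k w).eq]
    simp [TensorProduct.sum_tmul]
  have h1 : ∀ t : H ⊗[k] M, coactStep c ((sInv k H).rTensor M t) = Ψ (c.lTensor H t) := by
    intro t
    induction t with
    | zero => simp
    | add x y hx hy => simp only [map_add, hx, hy]
    | tmul w m =>
      simp only [LinearMap.rTensor_tmul, LinearMap.lTensor_tmul, coactStep, LinearMap.comp_apply,
        TensorProduct.map_tmul, comul_sInv, Ψ]
      generalize c m = t
      generalize comul (R := k) w = s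
      induction s with
      | zero => simp
      | add x y hx hy => simp only [map_add, TensorProduct.add_tmul, hx, hy]
      | tmul x y =>
        induction t with
        | zero => simp
        | add x y hx hy => simp only [map_add, TensorProduct.tmul_add, hx, hy]
        | tmul z u => simp
  have h2 : ∀ t : H ⊗[k] M, Ψ (TensorProduct.assoc k H H M
      (((TensorProduct.comm k H H).toLinearMap ∘ₗ comul).rTensor M t)) =
      1 ⊗ₜ[k] (sInv k H).rTensor M t := by
    intro t
    induction t with
    | zero => simp
    | add x y hx hy => simp only [map_add, hx, hy, TensorProduct.tmul_add]
    | tmul w u =>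
      simp only [LinearMap.rTensor_tmul, LinearMap.comp_apply]
      conv_lhs => rw [← (ℛ k w).eq]
      simp only [map_sum, TensorProduct.sum_tmul, LinearEquiv.coe_coe, TensorProduct.comm_tmul,
        TensorProduct.assoc_tmul, hΨ]
      rw [sum_coassoc' (fun x y z => (sInv k H y * x) ⊗ₜ[k] (sInv k H z ⊗ₜ[k] u))]
      · simp only [← TensorProduct.sum_tmul, sum_sInv_mul, TensorProduct.smul_tmul,
          ← TensorProduct.tmul_sum, TensorProduct.smul_tmul', ← map_smul, ← map_sum,
          sum_counit_smul]
      all_goals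
        intros
        constructor <;> intros <;>
          simp [add_mul, mul_add, TensorProduct.tmul_add, TensorProduct.add_tmul,
            ← TensorProduct.smul_tmul']
  rw [coinvSection, LinearMap.comp_apply, h1, hc.coassoc_apply, h2]

/-- A coinvariant element is determined by its component under `ε ⊗ id`. -/
lemma coinvSection_dropFirst {c : M →ₗ[k] H ⊗[k] M} {y : H ⊗[k] M}
    (hy : coactStep c y = 1 ⊗ₜ[k] y) :
    coinvSection c (dropFirst k H M y) = y := by
  -- apply `w ⊗ h ⊗ m ↦ S⁻¹(w) h ⊗ m` to the equation of coinvariance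
  let Ψ : H ⊗[k] (H ⊗[k] M) →ₗ[k] H ⊗[k] M :=
    (LinearMap.mul' k H ∘ₗ (sInv k H).rTensor H).rTensor M ∘ₗ
      (TensorProduct.assoc k H H M).symm.toLinearMap
  have h1 : ∀ y, Ψ (coactStep c y) = coinvSection c (dropFirst k H M y) := by
    intro y
    induction y with
    | zero => simp
    | add x y hx hy => simp only [map_add, hx, hy]
    | tmul h m =>
      simp only [coactStep_tmul, dropFirst_tmul, map_smul, coinvSection, LinearMap.comp_apply]
      generalize c m = t
      induction t with
      | zero => simp
      | add x y hx hy => simp only [map_add, smul_add, ← hx, ← hy, Finset.sum_add_distrib]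
      | tmul w u =>
        simp only [Ψ, map_sum, LinearMap.comp_apply, TensorProduct.map_tmul,
          TensorProduct.mk_apply, LinearEquiv.coe_coe, TensorProduct.assoc_symm_tmul,
          LinearMap.rTensor_tmul, LinearMap.mul'_apply, LinearMap.mul_apply', sInv_mul,
          mul_assoc, ← TensorProduct.sum_tmul, ← Finset.mul_sum, sum_sInv_mul]
        simp [TensorProduct.smul_tmul']
  have h2 : Ψ ∘ₗ TensorProduct.mk k H (H ⊗[k] M) 1 = LinearMap.id := by
    ext h m
    simp [Ψ, sInv_one]
  rw [← h1, hy]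
  exact LinearMap.congr_fun h2 y

end Coaction

/-! ### Recursion steps for the algebra side -/

section CoactionSteps

variable {k : Type v} [Field k] {H : Type u} [Ring H] [HopfAlgebra k H]
  {M : Type u} [AddCommGroup M] [Module k M]

/-- Multiplication of the first two factors is a map of comodules, because the comultiplication is
multiplicative. -/
lemma coactStep_coactStep_mul (c : M →ₗ[k] H ⊗[k] M) (y : H ⊗[k] (H ⊗[k] M)) :
    coactStep c (((LinearMap.mul' k H).rTensor M ∘ₗ
      (TensorProduct.assoc k H H M).symm.toLinearMap) y) =
    ((LinearMap.mul' k H).rTensor M ∘ₗ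
      (TensorProduct.assoc k H H M).symm.toLinearMap).lTensor H (coactStep (coactStep c) y) := by
  induction y with
  | zero => simp
  | add x y hx hy => simp only [map_add, hx, hy]
  | tmul g y =>
    induction y with
    | zero => simp
    | add x y hx hy => simp only [map_add, TensorProduct.tmul_add, hx, hy]
    | tmul h m =>
      simp only [LinearMap.comp_apply, LinearEquiv.coe_coe, TensorProduct.assoc_symm_tmul,
        LinearMap.rTensor_tmul, LinearMap.mul'_apply, coactStep, TensorProduct.map_tmul,
        Bialgebra.comul_mul]
      generalize c m = t
      generalize comul (R := k) g = a
      generalize comul (R := k) h = b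
      induction a with
      | zero => simp
      | add x y hx hy => simp only [add_mul, map_add, TensorProduct.add_tmul, hx, hy]
      | tmul a₁ a₂ =>
        induction b with
        | zero => simp
        | add x y hx hy =>
          simp only [mul_add, map_add, TensorProduct.add_tmul, TensorProduct.tmul_add, hx, hy]
        | tmul b₁ b₂ =>
          induction t with
          | zero => simp
          | add x y hx hy => simp only [map_add, TensorProduct.tmul_add, hx, hy]
          | tmul w u => simp [mul_assoc]

lemma coactStep_coactStep_insertOne (c : M →ₗ[k] H ⊗[k] M) (y : H ⊗[k] M) :
    coactStep (coactStep c) ((TensorProduct.mk k H M 1).lTensor H y) =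
      ((TensorProduct.mk k H M 1).lTensor H).lTensor H (coactStep c y) := by
  induction y with
  | zero => simp
  | add x y hx hy => simp only [map_add, hx, hy]
  | tmul h m =>
    simp only [LinearMap.lTensor_tmul, TensorProduct.mk_apply, coactStep, LinearMap.comp_apply,
      TensorProduct.map_tmul, LinearEquiv.coe_coe, Bialgebra.comul_one,
      Algebra.TensorProduct.one_def, TensorProduct.comm_tmul]
    generalize c m = t
    generalize comul (R := k) h = a
    induction a with
    | zero => simp
    | add x y hx hy => simp only [map_add, TensorProduct.add_tmul, hx, hy]
    | tmul a₁ a₂ =>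
      induction t with
      | zero => simp
      | add x y hx hy => simp only [map_add, TensorProduct.tmul_add, hx, hy]
      | tmul w u => simp

/-- `w ⊗ y ↦ w S(g) ⊗ u`, where `τ y = g ⊗ u`. -/
def antipodeShift (τ : H ⊗[k] M →ₗ[k] H ⊗[k] M) : H ⊗[k] (H ⊗[k] M) →ₗ[k] H ⊗[k] M :=
  (LinearMap.mul' k H ∘ₗ (antipode k).lTensor H).rTensor M ∘ₗ
    (TensorProduct.assoc k H H M).symm.toLinearMap ∘ₗ τ.lTensor H

lemma antipodeShift_mul_tmul (τ : H ⊗[k] M →ₗ[k] H ⊗[k] M) (a w : H) (u : H ⊗[k] M) :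
    antipodeShift τ ((a * w) ⊗ₜ[k] u) =
      (LinearMap.mul k H a).rTensor M (antipodeShift τ (w ⊗ₜ[k] u)) := by
  simp only [antipodeShift, LinearMap.comp_apply, LinearMap.lTensor_tmul]
  generalize τ u = t
  induction t with
  | zero => simp
  | add x y hx hy => simp only [map_add, TensorProduct.tmul_add, hx, hy]
  | tmul g m => simp [mul_assoc]

/-- The coaction of `ι y` in terms of the coaction of `y`, for an absorption map `ι` and a cyclic
operator `τ`: `c (ι y) = y_(1) S(g) ⊗ u` with `g ⊗ u = τ y_(0)`. -/
def AbsorbRule (c : M →ₗ[k] H ⊗[k] M) (ι : H ⊗[k] M →ₗ[k] M)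
    (τ : H ⊗[k] M →ₗ[k] H ⊗[k] M) : Prop :=
  ∀ y, c (ι y) = antipodeShift τ (coactStep c y)

lemma AbsorbRule.step {c : M →ₗ[k] H ⊗[k] M} {ι : H ⊗[k] M →ₗ[k] M}
    {τ : H ⊗[k] M →ₗ[k] H ⊗[k] M} (h : AbsorbRule c ι τ) :
    AbsorbRule (coactStep c) (ι.lTensor H)
      ((TensorProduct.leftComm k H H M).toLinearMap ∘ₗ τ.lTensor H) := by
  intro y
  induction y with
  | zero => simp
  | add x y hx hy => simp only [map_add, hx, hy]
  | tmul g y =>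
    simp only [LinearMap.lTensor_tmul, coactStep_tmul, h y, map_sum]
    refine Finset.sum_congr rfl fun i _ => ?_
    generalize coactStep c y = t
    induction t with
    | zero => simp
    | add x y hx hy => simp only [map_add, hx, hy]
    | tmul w u =>
      simp only [TensorProduct.map_tmul, LinearMap.mul_apply', antipodeShift_mul_tmul]
      simp only [antipodeShift, LinearMap.comp_apply, LinearMap.lTensor_tmul, LinearEquiv.coe_coe,
        TensorProduct.mk_apply]
      generalize τ u = s
      induction s with
      | zero => simp
      | add x y hx hy => simp only [map_add, TensorProduct.tmul_add, hx, hy]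
      | tmul z m => simp

/-- The operation on `τ` is the recursion of the cyclic operator of `T^a_*(H, X)`. -/
lemma dropFirst_comp_leftComm (τ : H ⊗[k] M →ₗ[k] H ⊗[k] M) :
    dropFirst k H (H ⊗[k] M) ∘ₗ (TensorProduct.leftComm k H H M).toLinearMap ∘ₗ τ.lTensor H =
      (dropFirst k H M ∘ₗ τ).lTensor H := by
  have : dropFirst k H (H ⊗[k] M) ∘ₗ (TensorProduct.leftComm k H H M).toLinearMap =
      (dropFirst k H M).lTensor H := by
    ext a b m
    simp
  rw [← LinearMap.comp_assoc, this, LinearMap.lTensor_comp]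

/-- `h_(1) ⊗ f(h_(2) m_(1)) ⊗ m_(0)`, with the sum over the comultiplication of `h` written out. -/
lemma leftComm_rTensor_coactStep (f : H →ₗ[k] H) (c : M →ₗ[k] H ⊗[k] M) (h : H) (m : M) :
    TensorProduct.leftComm k H H M (f.rTensor (H ⊗[k] M) (coactStep c (h ⊗ₜ[k] m))) =
      ∑ i ∈ (ℛ k h).index, (ℛ k h).left i ⊗ₜ[k]
        (f ∘ₗ LinearMap.mul k H ((ℛ k h).right i)).rTensor M (c m) := by
  rw [coactStep_tmul]
  generalize c m = t
  induction t with
  | zero => simp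
  | add x y hx hy =>
    simp only [map_add, TensorProduct.tmul_add, Finset.sum_add_distrib, hx, hy]
  | tmul w u => simp

/-- An action of the algebra `H` on `M`, as a bilinear map. -/
structure IsAction (d : H →ₗ[k] M →ₗ[k] M) : Prop where
  one_apply : ∀ m, d 1 m = m
  mul_apply : ∀ a b m, d (a * b) m = d a (d b m)

lemma IsAction.step {d : H →ₗ[k] M →ₗ[k] M} (hd : IsAction d) : IsAction (diagStep k H d) where
  one_apply y := by
    induction y with
    | zero => simp
    | add x y hx hy => simp only [map_add, hx, hy]
    | tmul g m =>
      simp only [diagStep, LinearMap.comp_apply, Bialgebra.comul_one,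
        Algebra.TensorProduct.one_def, TensorProduct.map_tmul]
      simp [hd.one_apply]
  mul_apply a b y := by
    induction y with
    | zero => simp
    | add x y hx hy => simp only [map_add, hx, hy]
    | tmul g m =>
      simp only [diagStep, LinearMap.comp_apply, Bialgebra.comul_mul]
      generalize comul (R := k) a = s
      generalize comul (R := k) b = t
      induction s with
      | zero => simp
      | add x y hx hy => simp only [add_mul, map_add, LinearMap.add_apply, hx, hy]
      | tmul a₁ a₂ =>
        induction t with
        | zero => simp
        | add x y hx hy => simp only [mul_add, map_add, LinearMap.add_apply, hx, hy]
        | tmul b₁ b₂ => simp [hd.mul_apply, mul_assoc]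

/-- `h ⊗ m ↦ h_(1) ⊗ h_(2) m`. -/
def fan (d : H →ₗ[k] M →ₗ[k] M) : H ⊗[k] M →ₗ[k] H ⊗[k] M :=
  (TensorProduct.lift d).lTensor H ∘ₗ (TensorProduct.assoc k H H M).toLinearMap ∘ₗ comul.rTensor M

/-- `h ⊗ m ↦ h_(1) ⊗ S(h_(2)) m`. -/
def fanInv (d : H →ₗ[k] M →ₗ[k] M) : H ⊗[k] M →ₗ[k] H ⊗[k] M :=
  (TensorProduct.lift d ∘ₗ (antipode k).rTensor M).lTensor H ∘ₗ
    (TensorProduct.assoc k H H M).toLinearMap ∘ₗ comul.rTensor M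

lemma fan_tmul (d : H →ₗ[k] M →ₗ[k] M) (h : H) (m : M) : fan d (h ⊗ₜ[k] m) =
    ∑ i ∈ (ℛ k h).index, (ℛ k h).left i ⊗ₜ[k] d ((ℛ k h).right i) m := by
  simp only [fan, LinearMap.comp_apply, LinearMap.rTensor_tmul]
  conv_lhs => rw [← (ℛ k h).eq]
  simp [TensorProduct.sum_tmul]

lemma fanInv_tmul (d : H →ₗ[k] M →ₗ[k] M) (h : H) (m : M) : fanInv d (h ⊗ₜ[k] m) =
    ∑ i ∈ (ℛ k h).index, (ℛ k h).left i ⊗ₜ[k] d (antipode k ((ℛ k h).right i)) m := by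
  simp only [fanInv, LinearMap.comp_apply, LinearMap.rTensor_tmul]
  conv_lhs => rw [← (ℛ k h).eq]
  simp [TensorProduct.sum_tmul]

lemma IsAction.fan_fanInv {d : H →ₗ[k] M →ₗ[k] M} (hd : IsAction d) (y : H ⊗[k] M) :
    fan d (fanInv d y) = y := by
  induction y with
  | zero => simp
  | add x y hx hy => simp only [map_add, hx, hy]
  | tmul h m =>
    simp only [fanInv_tmul, map_sum, fan_tmul, ← hd.mul_apply]
    rw [← sum_coassoc' (fun a b c => a ⊗ₜ[k] d (b * antipode k c) m),
      sum_mul_antipode_right (fun a b => a ⊗ₜ[k] d b m), hd.one_apply]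
    all_goals
      intros
      constructor <;> intros <;>
        simp [add_mul, mul_add, TensorProduct.tmul_add, TensorProduct.add_tmul,
          ← TensorProduct.smul_tmul']

lemma IsAction.fanInv_fan {d : H →ₗ[k] M →ₗ[k] M} (hd : IsAction d) (y : H ⊗[k] M) :
    fanInv d (fan d y) = y := by
  induction y with
  | zero => simp
  | add x y hx hy => simp only [map_add, hx, hy]
  | tmul h m =>
    simp only [fanInv_tmul, map_sum, fan_tmul, ← hd.mul_apply]
    rw [← sum_coassoc' (fun a b c => a ⊗ₜ[k] d (antipode k b * c) m),
      sum_antipode_mul_right (fun a b => a ⊗ₜ[k] d b m), hd.one_apply]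
    all_goals
      intros
      constructor <;> intros <;>
        simp [add_mul, mul_add, TensorProduct.tmul_add, TensorProduct.add_tmul,
          ← TensorProduct.smul_tmul']

end CoactionSteps

section AlgebraSide

variable {k : Type v} [Field k] {H : Type u} [Ring H] [HopfAlgebra k H]
  {X : Type u} [AddCommGroup X] [Module k X] [Module H X] [IsScalarTower k H X]

lemma isAction_actHom : IsAction (actHom k H X) where
  one_apply x := one_smul H x
  mul_apply a b x := mul_smul a b x

lemma act_tmul (h : H) (x : X) : act k H X (h ⊗ₜ[k] x) = h • x := rfl

lemma twist_twistInv (y : H ⊗[k] X) : twist k H X (twistInv k H X y) = y :=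
  isAction_actHom.fan_fanInv y

lemma twistInv_twist (y : H ⊗[k] X) : twistInv k H X (twist k H X y) = y :=
  isAction_actHom.fanInv_fan y

lemma twist_tmul (h : H) (x : X) : twist k H X (h ⊗ₜ[k] x) =
    ∑ i ∈ (ℛ k h).index, (ℛ k h).left i ⊗ₜ[k] ((ℛ k h).right i • x) :=
  fan_tmul (actHom k H X) h x

lemma dropFirst_comp_twist : dropFirst k H X ∘ₗ twist k H X = act k H X := by
  refine TensorProduct.ext' fun h x => ?_
  simp only [LinearMap.comp_apply, twist_tmul, map_sum, dropFirst_tmul, act_tmul]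
  simp only [← smul_assoc, ← Finset.sum_smul, sum_counit_smul]

section Comodule

variable [LeftComodule k H X]

omit [Module H X] [IsScalarTower k H X] in
lemma coact_coassoc (x : X) :
    TensorProduct.assoc k H H X (comul.rTensor X (coact k H X x)) =
      (coact k H X).lTensor H (coact k H X x) :=
  LinearMap.congr_fun LeftComodule.coassoc x

omit [Module H X] [IsScalarTower k H X] in
lemma counit_coact (x : X) : dropFirst k H X (coact k H X x) = x := by
  exact (congrArg (TensorProduct.lid k X) (LinearMap.congr_fun
    (LeftComodule.counit_coact (k := k) (H := H) (X := X)) x)).trans (by simp)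

omit [Module H X] [IsScalarTower k H X] in
/-- The right coaction `x ↦ x_(0) ⊗ S(x_(-1))`. -/
lemma isRightCoaction_antipode_coact :
    IsRightCoaction ((antipode k).rTensor X ∘ₗ coact k H X) where
  counit_apply x := by
    have : dropFirst k H X ∘ₗ (antipode k).rTensor X = dropFirst k H X := by
      ext h x
      simp
    exact (LinearMap.congr_fun this (coact k H X x)).trans (counit_coact x)
  coassoc_apply x := by
    let Φ : H ⊗[k] (H ⊗[k] X) →ₗ[k] H ⊗[k] (H ⊗[k] X) :=
      TensorProduct.map (antipode k) ((antipode k).rTensor X)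
    have h1 : ∀ t, ((antipode k).rTensor X ∘ₗ coact k H X).lTensor H ((antipode k).rTensor X t) =
        Φ ((coact k H X).lTensor H t) := by
      intro t
      induction t with
      | zero => simp
      | add x y hx hy => simp only [map_add, hx, hy]
      | tmul w u => simp [Φ]
    have h2 : ∀ t, TensorProduct.assoc k H H X
        (((TensorProduct.comm k H H).toLinearMap ∘ₗ comul).rTensor X ((antipode k).rTensor X t)) =
        Φ (TensorProduct.assoc k H H X (comul.rTensor X t)) := by
      intro t
      induction t with
      | zero => simp
      | add x y hx hy => simp only [map_add, hx, hy]
      | tmul w u =>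
        simp only [LinearMap.rTensor_tmul, LinearMap.comp_apply, comul_antipode]
        generalize comul (R := k) w = s
        induction s with
        | zero => simp
        | add x y hx hy => simp only [map_add, TensorProduct.add_tmul, hx, hy]
        | tmul a b => simp [Φ]
    rw [LinearMap.comp_apply, h1, h2, coact_coassoc]

lemma shear_tmul [HasBijectiveAntipode k H] (a : H) (x : X) : shear k H X (a ⊗ₜ[k] x) =
    ∑ i ∈ (ℛ k a).index, TensorProduct.map (LinearMap.mulRight k (sInv k H ((ℛ k a).right i)))
      (actHom k H X ((ℛ k a).left i)) (coact k H X x) := by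
  simp only [shear, LinearMap.comp_apply, TensorProduct.map_tmul]
  generalize coact k H X x = t
  conv_lhs => rw [← (ℛ k a).eq]
  induction t with
  | zero => simp
  | add x y hx hy => simp only [map_add, TensorProduct.tmul_add, hx, hy, Finset.sum_add_distrib]
  | tmul w u => simp [TensorProduct.sum_tmul, act_tmul, actHom_apply]

/-- With `g = S⁻¹(a S(x_(-1)))`: `g_(1) ⊗ S(g_(2)) x_(0) = x_(-1) S⁻¹(a_(2)) ⊗ a_(1) x_(0)`. This
is where `S(x_(-1)) x_(0) = x` is used. -/
lemma twistInv_sInv_coact [HasBijectiveAntipode k H] [IsStable k H X] (a : H) (x : X) :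
    twistInv k H X ((sInv k H ∘ₗ LinearMap.mul k H a).rTensor X
      ((antipode k).rTensor X (coact k H X x))) = shear k H X (a ⊗ₜ[k] x) := by
  let Φ : H ⊗[k] (H ⊗[k] X) →ₗ[k] H ⊗[k] X := ∑ i ∈ (ℛ k a).index,
    TensorProduct.map (LinearMap.mulRight k (sInv k H ((ℛ k a).right i)))
      (actHom k H X ((ℛ k a).left i) ∘ₗ act k H X ∘ₗ (antipode k).rTensor X)
  have h1 : ∀ t, twistInv k H X ((sInv k H ∘ₗ LinearMap.mul k H a).rTensor X
      ((antipode k).rTensor X t)) = Φ (TensorProduct.assoc k H H X (comul.rTensor X t)) := by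
    intro t
    induction t with
    | zero => simp
    | add x y hx hy => simp only [map_add, hx, hy]
    | tmul w u =>
      simp only [LinearMap.rTensor_tmul, LinearMap.comp_apply, LinearMap.mul_apply', sInv_mul,
        sInv_antipode, twistInv, Bialgebra.comul_mul, comul_sInv]
      generalize comul (R := k) w = s
      conv_lhs => rw [← (ℛ k a).eq]
      induction s with
      | zero => simp
      | add x y hx hy => simp only [map_add, add_mul, TensorProduct.add_tmul, hx, hy]
      | tmul b c =>
        simp [Φ, Finset.mul_sum, TensorProduct.sum_tmul, act_tmul, actHom_apply,
          antipode_mul_antidistrib, antipode_sInv, mul_smul, LinearMap.sum_apply]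
  have h2 : ∀ t, Φ ((coact k H X).lTensor H t) = ∑ i ∈ (ℛ k a).index,
      TensorProduct.map (LinearMap.mulRight k (sInv k H ((ℛ k a).right i)))
      (actHom k H X ((ℛ k a).left i)) t := by
    intro t
    induction t with
    | zero => simp
    | add x y hx hy => simp only [map_add, hx, hy, Finset.sum_add_distrib]
    | tmul w u => simp [Φ, LinearMap.sum_apply, IsStable.one_stable]
  rw [h1, coact_coassoc, h2, shear_tmul]

/-- The anti-Yetter-Drinfeld condition, after the antipode is applied to the coaction. -/
lemma absorbRule_zero [HasBijectiveAntipode k H] [IsAntiYetterDrinfeld k H X] :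
    AbsorbRule ((antipode k).rTensor X ∘ₗ coact k H X) (act k H X) (twist k H X) := by
  intro y
  induction y with
  | zero => simp
  | add x y hx hy => simp only [map_add, hx, hy]
  | tmul h x =>
    simp only [act_tmul, LinearMap.comp_apply, IsAntiYetterDrinfeld.coact_smul, coactStep_tmul]
    generalize coact k H X x = t
    induction t with
    | zero => simp
    | add x y hx hy => simp only [map_add, Finset.sum_add_distrib, hx, hy]
    | tmul w u =>
      simp only [map_sum, TensorProduct.map_tmul, LinearMap.rTensor_tmul, LinearMap.comp_apply,
        LinearMap.mulLeft_apply, LinearMap.mulRight_apply, antipode_mul_antidistrib,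
        antipode_sInv, LinearMap.mul_apply', antipodeShift, LinearMap.lTensor_tmul,
        TensorProduct.mk_apply, twist_tmul, TensorProduct.tmul_sum, LinearEquiv.coe_coe,
        TensorProduct.assoc_symm_tmul, LinearMap.mul'_apply, actHom_apply]
      rw [sum_coassoc' (fun a b c => (c * antipode k w * antipode k a) ⊗ₜ[k] (b • u))]
      all_goals
        intros
        constructor <;> intros <;>
          simp [add_mul, mul_add, add_smul, TensorProduct.tmul_add, TensorProduct.add_tmul,
            ← TensorProduct.smul_tmul']

end Comodule

end AlgebraSide

/-! ### The coinvariants of `T^a_*(H, X)` -/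

section Operators

section Step

variable {k : Type v} [Field k] {H : Type u} [AddCommGroup H] [Module k H]
  {M : Type u} [AddCommGroup M] [Module k M]

lemma leftComm_lTensor_comp {f g : H ⊗[k] M →ₗ[k] H ⊗[k] M} (h : f ∘ₗ g = LinearMap.id) :
    ((TensorProduct.leftComm k H H M).toLinearMap ∘ₗ f.lTensor H) ∘ₗ
      (g.lTensor H ∘ₗ (TensorProduct.leftComm k H H M).toLinearMap) = LinearMap.id := by
  have h1 : f.lTensor H ∘ₗ g.lTensor H = LinearMap.id := by
    rw [← LinearMap.lTensor_comp, h, LinearMap.lTensor_id]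
  rw [LinearMap.comp_assoc, ← LinearMap.comp_assoc _ (g.lTensor H), h1, LinearMap.id_comp]
  exact LinearMap.ext (TensorProduct.leftComm k H H M).apply_symm_apply

lemma lTensor_leftComm_comp {f g : H ⊗[k] M →ₗ[k] H ⊗[k] M} (h : g ∘ₗ f = LinearMap.id) :
    (g.lTensor H ∘ₗ (TensorProduct.leftComm k H H M).toLinearMap) ∘ₗ
      ((TensorProduct.leftComm k H H M).toLinearMap ∘ₗ f.lTensor H) = LinearMap.id := by
  have h1 : (TensorProduct.leftComm k H H M).toLinearMap ∘ₗ
      (TensorProduct.leftComm k H H M).toLinearMap = LinearMap.id :=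
    LinearMap.ext (TensorProduct.leftComm k H H M).apply_symm_apply
  rw [LinearMap.comp_assoc, ← LinearMap.comp_assoc (f.lTensor H), h1, LinearMap.id_comp,
    ← LinearMap.lTensor_comp, h, LinearMap.lTensor_id]

lemma lTensor_comp_eq {f g h : M →ₗ[k] M} (e : f ∘ₗ g = h) :
    f.lTensor H ∘ₗ g.lTensor H = h.lTensor H := by
  rw [← LinearMap.lTensor_comp, e]

lemma lTensor_eq_id {f : M →ₗ[k] M} (e : f = LinearMap.id) : f.lTensor H = LinearMap.id := by
  rw [e, LinearMap.lTensor_id]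

end Step

variable (k : Type v) [Field k] (H : Type u) [Ring H] [HopfAlgebra k H]
  (X : Type u) [AddCommGroup X] [Module k X]

lemma rot_rotInv : ∀ n, rot k H X n ∘ₗ rotInv k H X n = LinearMap.id
  | 0 => rfl
  | n + 1 => leftComm_lTensor_comp (rot_rotInv n)

lemma rotInv_rot : ∀ n, rotInv k H X n ∘ₗ rot k H X n = LinearMap.id
  | 0 => rfl
  | n + 1 => lTensor_leftComm_comp (rotInv_rot n)

lemma onLast_comp (f g : H ⊗[k] X →ₗ[k] H ⊗[k] X) :
    ∀ n, onLast k H X f n ∘ₗ onLast k H X g n = onLast k H X (f ∘ₗ g) n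
  | 0 => rfl
  | n + 1 => lTensor_comp_eq (onLast_comp f g n)

lemma onLast_id : ∀ n, onLast k H X LinearMap.id n = LinearMap.id
  | 0 => rfl
  | n + 1 => lTensor_eq_id (onLast_id n)

variable [Module H X] [IsScalarTower k H X]

lemma cycA_cycInvA (n : ℕ) : cycA k H X n ∘ₗ cycInvA k H X n = LinearMap.id := by
  have h : twist k H X ∘ₗ twistInv k H X = LinearMap.id := LinearMap.ext twist_twistInv
  change rot k H X n ∘ₗ (onLast k H X (twist k H X) n ∘ₗ onLast k H X (twistInv k H X) n) ∘ₗ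
    rotInv k H X n = _
  rw [onLast_comp, h, onLast_id, LinearMap.id_comp, rot_rotInv]

lemma cycInvA_cycA (n : ℕ) : cycInvA k H X n ∘ₗ cycA k H X n = LinearMap.id := by
  have h : twistInv k H X ∘ₗ twist k H X = LinearMap.id := LinearMap.ext twistInv_twist
  change onLast k H X (twistInv k H X) n ∘ₗ (rotInv k H X n ∘ₗ rot k H X n) ∘ₗ
    onLast k H X (twist k H X) n = _
  rw [rotInv_rot, LinearMap.id_comp, onLast_comp, h, onLast_id]

end Operators

section Coinvariants

variable {k : Type v} [Field k] {H : Type u} [Ring H] [HopfAlgebra k H]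

section Step

variable {M : Type u} [AddCommGroup M] [Module k M]

lemma dropFirst_comp_step {f g : H ⊗[k] M →ₗ[k] H ⊗[k] M} {ι : H ⊗[k] M →ₗ[k] M}
    (h : dropFirst k H M ∘ₗ f ∘ₗ g = ι) : dropFirst k H (H ⊗[k] M) ∘ₗ
      ((TensorProduct.leftComm k H H M).toLinearMap ∘ₗ f.lTensor H) ∘ₗ g.lTensor H =
      ι.lTensor H := by
  rw [← h, ← dropFirst_comp_leftComm, LinearMap.lTensor_comp, LinearMap.comp_assoc]

lemma AbsorbRule.step_comp {c : M →ₗ[k] H ⊗[k] M} {ι : H ⊗[k] M →ₗ[k] M}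
    {f g : H ⊗[k] M →ₗ[k] H ⊗[k] M} (h : AbsorbRule c ι (f ∘ₗ g)) :
    AbsorbRule (coactStep c) (ι.lTensor H)
      (((TensorProduct.leftComm k H H M).toLinearMap ∘ₗ f.lTensor H) ∘ₗ g.lTensor H) := by
  have h := h.step
  rwa [LinearMap.lTensor_comp] at h

/-- On coinvariants the section after absorption is the cyclic operator, because `S⁻¹(S(g)) = g`. -/
lemma AbsorbRule.coinvSection_eq [HasBijectiveAntipode k H] {c : M →ₗ[k] H ⊗[k] M}
    {ι : H ⊗[k] M →ₗ[k] M} {τ : H ⊗[k] M →ₗ[k] H ⊗[k] M} (h : AbsorbRule c ι τ) {y : H ⊗[k] M}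
    (hy : coactStep c y = 1 ⊗ₜ[k] y) : coinvSection c (ι y) = τ y := by
  have h1 : (sInv k H).rTensor M ∘ₗ (LinearMap.mul' k H ∘ₗ (antipode k).lTensor H).rTensor M ∘ₗ
      (TensorProduct.assoc k H H M).symm.toLinearMap ∘ₗ TensorProduct.mk k H (H ⊗[k] M) 1 =
      LinearMap.id := by
    refine TensorProduct.ext' fun a b => ?_
    simp [sInv_antipode]
  rw [coinvSection, LinearMap.comp_apply, h y, hy]
  exact LinearMap.congr_fun h1 (τ y)

/-- The inductive step of `onLast_twistInv_section`; left multiplication by an arbitrary `a` makes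
room for the part of the coaction that comes from the factors to the left. -/
lemma twistInv_section_step [HasBijectiveAntipode k H]
    {c c₁ : M →ₗ[k] H ⊗[k] M} {f g f' g' : H ⊗[k] M →ₗ[k] H ⊗[k] M}
    (h : ∀ (a : H) (m : M), (f ∘ₗ f') ((sInv k H ∘ₗ LinearMap.mul k H a).rTensor M (c m)) =
      (g ∘ₗ g') ((LinearMap.mul k H a).rTensor M (c₁ m))) (a : H) (y : H ⊗[k] M) :
    (f.lTensor H ∘ₗ f'.lTensor H ∘ₗ (TensorProduct.leftComm k H H M).toLinearMap)
      ((sInv k H ∘ₗ LinearMap.mul k H a).rTensor (H ⊗[k] M) (coactStep c y)) =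
    (g.lTensor H ∘ₗ g'.lTensor H ∘ₗ (TensorProduct.leftComm k H H M).toLinearMap)
      ((LinearMap.mul k H a).rTensor (H ⊗[k] M) (coactStep c₁ y)) := by
  induction y with
  | zero => simp
  | add x y hx hy => simp only [map_add, hx, hy]
  | tmul b m =>
    have h1 : ∀ b, LinearMap.mul k H a ∘ₗ LinearMap.mul k H b = LinearMap.mul k H (a * b) :=
      fun b => LinearMap.ext fun z => by simp [mul_assoc]
    simp only [LinearMap.comp_apply, LinearEquiv.coe_coe] at h ⊢
    simp only [leftComm_rTensor_coactStep, map_sum, LinearMap.lTensor_tmul, LinearMap.comp_assoc,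
      h1, h]

end Step

variable {X : Type u} [AddCommGroup X] [Module k X]

section Coaction

variable [LeftComodule k H X]

lemma isRightCoaction_coactR : ∀ n, IsRightCoaction (coactR k H X n)
  | 0 => isRightCoaction_antipode_coact (k := k) (H := H) (X := X)
  | n + 1 => (isRightCoaction_coactR n).step

lemma lTensor_of_eq_one_tmul {M N : Type u} [AddCommGroup M] [Module k M] [AddCommGroup N]
    [Module k N] {f : M →ₗ[k] N} {z : H ⊗[k] M} {y : M} {w : H ⊗[k] N}
    (hw : w = f.lTensor H z) (hz : z = 1 ⊗ₜ[k] y) : w = 1 ⊗ₜ[k] f y := by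
  rw [hw, hz, LinearMap.lTensor_tmul]

lemma mulFirst_mem_invA {n : ℕ} {y : Tens k H X (n + 2)} (hy : y ∈ invA k H X (n + 1)) :
    mulFirst k H X n y ∈ invA k H X n :=
  lTensor_of_eq_one_tmul (coactStep_coactStep_mul (coactR k H X n) y) hy

lemma insertOne_mem_invA {n : ℕ} {y : Tens k H X (n + 1)} (hy : y ∈ invA k H X n) :
    insertOne k H X n y ∈ invA k H X (n + 1) :=
  lTensor_of_eq_one_tmul (coactStep_coactStep_insertOne (coactR k H X n) y) hy

/-- `m ↦ S⁻¹(m_(1)) ⊗ m_(0)`, from `H^{⊗ n} ⊗ X` to the coinvariants of `T^a_n(H, X)`. -/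
def sectionA (k : Type v) [Field k] (H : Type u) [Ring H] [HopfAlgebra k H]
    (X : Type u) [AddCommGroup X] [Module k X] [LeftComodule k H X] [HasBijectiveAntipode k H]
    (n : ℕ) : Tens k H X n →ₗ[k] Tens k H X (n + 1) :=
  coinvSection (coactR k H X n)

/-- `h^0 ⊗ m ↦ ε(h^0) m`. -/
def dropA (k : Type v) [Field k] (H : Type u) [Ring H] [HopfAlgebra k H]
    (X : Type u) [AddCommGroup X] [Module k X] (n : ℕ) :
    Tens k H X (n + 1) →ₗ[k] Tens k H X n :=
  dropFirst k H (Tens k H X n)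

variable [HasBijectiveAntipode k H]

lemma sectionA_mem_invA (n : ℕ) (m : Tens k H X n) : sectionA k H X n m ∈ invA k H X n :=
  coactStep_coinvSection (isRightCoaction_coactR n) m

lemma dropA_sectionA (n : ℕ) (m : Tens k H X n) : dropA k H X n (sectionA k H X n m) = m :=
  dropFirst_coinvSection (isRightCoaction_coactR n) m

lemma sectionA_dropA {n : ℕ} {y : Tens k H X (n + 1)} (hy : y ∈ invA k H X n) :
    sectionA k H X n (dropA k H X n y) = y :=
  coinvSection_dropFirst hy

variable [Module H X] [IsScalarTower k H X]

omit [LeftComodule k H X] [HasBijectiveAntipode k H] in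
/-- `(ε ⊗ id) τ = i`. -/
lemma dropA_comp_cycA : ∀ n, dropA k H X n ∘ₗ cycA k H X n = absorb k H X n
  | 0 => dropFirst_comp_twist (k := k) (H := H) (X := X)
  | n + 1 => dropFirst_comp_step (dropA_comp_cycA n)

variable [IsAntiYetterDrinfeld k H X]

lemma absorbRule : ∀ n, AbsorbRule (coactR k H X n) (absorb k H X n) (cycA k H X n)
  | 0 => absorbRule_zero (k := k) (H := H) (X := X)
  | n + 1 => (absorbRule n).step_comp

lemma sectionA_absorb {n : ℕ} {y : Tens k H X (n + 1)} (hy : y ∈ invA k H X n) :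
    sectionA k H X n (absorb k H X n y) = cycA k H X n y :=
  (absorbRule n).coinvSection_eq hy

lemma cycA_mem_invA {n : ℕ} {y : Tens k H X (n + 1)} (hy : y ∈ invA k H X n) :
    cycA k H X n y ∈ invA k H X n := by
  rw [← sectionA_absorb hy]
  exact sectionA_mem_invA _ _

omit [IsAntiYetterDrinfeld k H X]
variable [IsStable k H X]

/-- `τ⁻¹` applied to the section and the formula that defines `p`, both with an additional factor
`a` in front of the coaction. -/
lemma onLast_twistInv_section : ∀ (n : ℕ) (a : H) (m : Tens k H X n),
    (onLast k H X (twistInv k H X) n ∘ₗ rotInv k H X n)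
      ((sInv k H ∘ₗ LinearMap.mul k H a).rTensor (Tens k H X n) (coactR k H X n m)) =
    (onLast k H X (shear k H X) n ∘ₗ rotInv k H X n)
      ((LinearMap.mul k H a).rTensor (Tens k H X n)
        (diagCoact k H X (TensorProduct.mk k H X 1) n m))
  | 0, a, m => (twistInv_sInv_coact (k := k) (H := H) (X := X) a m).trans
      (congrArg (fun b : H => shear k H X (b ⊗ₜ[k] (m : X))) (mul_one a).symm)
  | n + 1, a, m => twistInv_section_step (onLast_twistInv_section n) a m

/-- `p = τ⁻¹ s` for the section `s`: this is the reason why `p` parametrizes the coinvariants. -/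
lemma pA_eq (n : ℕ) : pA k H X n = cycInvA k H X n ∘ₗ sectionA k H X n := by
  refine LinearMap.ext fun m => ?_
  have h := onLast_twistInv_section (k := k) (X := X) n (1 : H) m
  have h1 : LinearMap.mul k H (1 : H) = LinearMap.id := LinearMap.ext fun z => by simp
  rw [h1, LinearMap.comp_id, LinearMap.rTensor_id, LinearMap.id_apply] at h
  exact h.symm

lemma cycA_pA (n : ℕ) (m : Tens k H X n) : cycA k H X n (pA k H X n m) = sectionA k H X n m := by
  rw [pA_eq]
  exact LinearMap.congr_fun (cycA_cycInvA k H X n) _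

lemma absorb_pA (n : ℕ) (m : Tens k H X n) : absorb k H X n (pA k H X n m) = m := by
  rw [← dropA_comp_cycA, LinearMap.comp_apply, cycA_pA]
  exact dropA_sectionA n m

end Coaction

end Coinvariants

/-! ### The map `α` -/

section Alpha

variable {k : Type v} [Field k] {H : Type u} [Ring H] [HopfAlgebra k H]

section Step

variable {M : Type u} [AddCommGroup M] [Module k M]

/-- `h ⊗ m ↦ h_(1) ⊗ h_(2) A(m)`, the recursion of `alphaAux`. -/
def alphaStep (d : H →ₗ[k] M →ₗ[k] M) (A : M →ₗ[k] M) : H ⊗[k] M →ₗ[k] H ⊗[k] M :=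
  (TensorProduct.lift d).lTensor H ∘ₗ (TensorProduct.assoc k H H M).toLinearMap ∘ₗ
    TensorProduct.map comul A

lemma alphaStep_eq (d : H →ₗ[k] M →ₗ[k] M) (A : M →ₗ[k] M) :
    alphaStep d A = fan d ∘ₗ A.lTensor H := by
  have : TensorProduct.map comul A =
      comul.rTensor M ∘ₗ A.lTensor H := by
    refine TensorProduct.ext' fun _ _ => ?_
    simp
  rw [alphaStep, this]
  rfl

lemma alphaStep_tmul (d : H →ₗ[k] M →ₗ[k] M) (A : M →ₗ[k] M) (h : H) (m : M) :
    alphaStep d A (h ⊗ₜ[k] m) = diagStep k H d h (1 ⊗ₜ[k] A m) := by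
  rw [alphaStep_eq, LinearMap.comp_apply, LinearMap.lTensor_tmul, fan_tmul, diagStep_tmul]
  simp only [mul_one]

lemma alphaStep_tmul_sum (d : H →ₗ[k] M →ₗ[k] M) (A : M →ₗ[k] M) (h : H) (m : M) :
    alphaStep d A (h ⊗ₜ[k] m) =
      ∑ i ∈ (ℛ k h).index, (ℛ k h).left i ⊗ₜ[k] d ((ℛ k h).right i) (A m) := by
  rw [alphaStep_eq, LinearMap.comp_apply, LinearMap.lTensor_tmul, fan_tmul]

lemma IsAction.alphaStep_bijective {d : H →ₗ[k] M →ₗ[k] M} (hd : IsAction d) {A : M →ₗ[k] M}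
    (hA : Function.Bijective A) : Function.Bijective (alphaStep d A) := by
  have h1 : Function.Bijective (fan d) :=
    Function.bijective_iff_has_inverse.2 ⟨fanInv d, hd.fanInv_fan, hd.fan_fanInv⟩
  have h2 : Function.Bijective (A.lTensor H) :=
    (TensorProduct.congr (LinearEquiv.refl k H) (LinearEquiv.ofBijective A hA)).bijective
  rw [alphaStep_eq, LinearMap.coe_comp]
  exact h1.comp h2

lemma dropFirst_diagStep (d : H →ₗ[k] M →ₗ[k] M) (h : H) (y : H ⊗[k] M) :
    dropFirst k H M (diagStep k H d h y) = d h (dropFirst k H M y) := by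
  induction y with
  | zero => simp
  | add x y hx hy => simp only [map_add, hx, hy]
  | tmul g m =>
    simp only [diagStep_tmul, map_sum, dropFirst_tmul, Bialgebra.counit_mul, map_smul]
    conv_rhs => rw [← sum_counit_smul (ℛ k h)]
    simp only [map_sum, map_smul, LinearMap.sum_apply, LinearMap.smul_apply, Finset.smul_sum,
      smul_smul, mul_comm]

/-- The counit in the first factor turns the outermost `h · (1 ⊗ -)` into the action of `h`, and the
action of `h` on `g · (1 ⊗ -)` is that of `h g`. -/
lemma dropFirst_alphaStep {d : H →ₗ[k] M →ₗ[k] M} (hd : IsAction d) (A : M →ₗ[k] M)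
    (y : H ⊗[k] (H ⊗[k] M)) :
    dropFirst k H (H ⊗[k] M) (alphaStep (diagStep k H d) (alphaStep d A) y) =
      alphaStep d A (((LinearMap.mul' k H).rTensor M ∘ₗ
        (TensorProduct.assoc k H H M).symm.toLinearMap) y) := by
  induction y with
  | zero => simp
  | add x y hx hy => simp only [map_add, hx, hy]
  | tmul h y =>
    induction y with
    | zero => simp
    | add x y hx hy => simp only [map_add, TensorProduct.tmul_add, hx, hy]
    | tmul g m =>
      simp only [LinearMap.comp_apply, LinearEquiv.coe_coe, TensorProduct.assoc_symm_tmul,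
        LinearMap.rTensor_tmul, LinearMap.mul'_apply]
      rw [alphaStep_tmul, dropFirst_diagStep, dropFirst_tmul, Bialgebra.counit_one, one_smul,
        alphaStep_tmul, alphaStep_tmul, hd.step.mul_apply]

lemma alphaStep_insertOne {d : H →ₗ[k] M →ₗ[k] M} (hd : IsAction d) (A : M →ₗ[k] M)
    (y : H ⊗[k] M) :
    alphaStep (diagStep k H d) (alphaStep d A) ((TensorProduct.mk k H M 1).lTensor H y) =
      TensorProduct.assoc k H H M (comul.rTensor M (alphaStep d A y)) := by
  induction y with
  | zero => simp
  | add x y hx hy => simp only [map_add, hx, hy]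
  | tmul h m =>
    rw [LinearMap.lTensor_tmul, TensorProduct.mk_apply, alphaStep_tmul, alphaStep_tmul,
      alphaStep_tmul, comul_equivariant, hd.step.one_apply]
    simp [Algebra.TensorProduct.one_def]

/-- The inverse `[h ⊗ m] ↦ S(h) m` of `m ↦ [1 ⊗ m]` kills `a · y - ε(a) y`. -/
lemma IsAction.lift_antipode_diagStep {d : H →ₗ[k] M →ₗ[k] M} (hd : IsAction d) (a : H)
    (y : H ⊗[k] M) :
    TensorProduct.lift (d ∘ₗ antipode k) (diagStep k H d a y) =
      (counit a : k) • TensorProduct.lift (d ∘ₗ antipode k) y := by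
  induction y with
  | zero => simp
  | add x y hx hy => simp only [map_add, smul_add, hx, hy]
  | tmul h m =>
    simp only [diagStep_tmul, map_sum, TensorProduct.lift.tmul, LinearMap.comp_apply,
      antipode_mul_antidistrib, ← hd.mul_apply, mul_assoc]
    simp only [← LinearMap.sum_apply, ← map_sum, ← Finset.mul_sum, sum_antipode_mul_eq_smul]
    simp

variable {Q : Type*} [AddCommGroup Q] [Module k Q]

lemma IsAction.map_tmul_eq {d : H →ₗ[k] M →ₗ[k] M} (hd : IsAction d) {q : H ⊗[k] M →ₗ[k] Q}
    (hq : ∀ a m, q (diagStep k H d a m) = (counit a : k) • q m) (h : H) (m : M) :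
    q (h ⊗ₜ[k] m) = q (1 ⊗ₜ[k] d (antipode k h) m) := by
  have h1 : ∑ i ∈ (ℛ k h).index, diagStep k H d ((ℛ k h).left i)
      (1 ⊗ₜ[k] d (antipode k ((ℛ k h).right i)) m) = h ⊗ₜ[k] m := by
    simp only [diagStep_tmul, mul_one, ← hd.mul_apply]
    rw [← sum_coassoc' (fun a b c => a ⊗ₜ[k] d (b * antipode k c) m),
      sum_mul_antipode_right (fun a b => a ⊗ₜ[k] d b m), hd.one_apply]
    all_goals
      intros
      constructor <;> intros <;>
        simp [add_mul, mul_add, TensorProduct.tmul_add, TensorProduct.add_tmul,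
          ← TensorProduct.smul_tmul']
  rw [← h1, map_sum]
  simp only [hq]
  conv_rhs => rw [← sum_counit_smul (ℛ k h)]
  simp only [map_sum, map_smul, LinearMap.sum_apply, LinearMap.smul_apply, TensorProduct.tmul_sum,
    TensorProduct.tmul_smul]

/-- `M ≅ k ⊗_H (H ⊗ M)` for the diagonal action on `H ⊗ M`, through `m ↦ [1 ⊗ m]`. -/
lemma IsAction.mkQ_one_tmul_bijective {d : H →ₗ[k] M →ₗ[k] M} (hd : IsAction d)
    {N : Submodule k (H ⊗[k] M)} (hN : N = Submodule.span k
      (Set.range fun a : H × (H ⊗[k] M) => diagStep k H d a.1 a.2 - (counit a.1 : k) • a.2)) :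
    Function.Bijective fun m : M => N.mkQ (1 ⊗ₜ[k] m) := by
  constructor
  · have h1 : N ≤ LinearMap.ker (TensorProduct.lift (d ∘ₗ antipode k)) := by
      rw [hN, Submodule.span_le]
      rintro _ ⟨⟨h, y⟩, rfl⟩
      simp [hd.lift_antipode_diagStep]
    intro m m' h
    have h2 := h1 ((Submodule.Quotient.eq N).1 h)
    rw [LinearMap.mem_ker, ← TensorProduct.tmul_sub, TensorProduct.lift.tmul,
      LinearMap.comp_apply, antipode_one, hd.one_apply] at h2
    exact sub_eq_zero.1 h2
  · have hq : ∀ a m, N.mkQ (diagStep k H d a m) = (counit a : k) • N.mkQ m := by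
      intro a m
      rw [← map_smul, ← sub_eq_zero, ← map_sub]
      refine (Submodule.Quotient.mk_eq_zero _).2 ?_
      rw [hN]
      exact Submodule.subset_span ⟨(a, m), rfl⟩
    intro z
    obtain ⟨y, rfl⟩ := N.mkQ_surjective z
    induction y with
    | zero => exact ⟨0, by simp⟩
    | add x y hx hy =>
      obtain ⟨m, hm⟩ := hx
      obtain ⟨m', hm'⟩ := hy
      refine ⟨m + m', ?_⟩
      simp only at hm hm' ⊢
      rw [TensorProduct.tmul_add, map_add, map_add, hm, hm']
    | tmul h m => exact ⟨_, (hd.map_tmul_eq hq h m).symm⟩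

/-- Modulo the diagonal action, `h_(1) ⊗ h_(2) A(m) = h · (1 ⊗ A(m))` becomes `ε(h) (1 ⊗ A(m))`. -/
lemma map_alphaStep {d : H →ₗ[k] M →ₗ[k] M} {q : H ⊗[k] M →ₗ[k] Q}
    (hq : ∀ a m, q (diagStep k H d a m) = (counit a : k) • q m) (A : M →ₗ[k] M) (y : H ⊗[k] M) :
    q (alphaStep d A y) = q (1 ⊗ₜ[k] A (dropFirst k H M y)) := by
  induction y with
  | zero => simp
  | add x y hx hy => simp only [map_add, TensorProduct.tmul_add, hx, hy]
  | tmul h m => rw [alphaStep_tmul, hq, dropFirst_tmul, map_smul, TensorProduct.tmul_smul, map_smul]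

/-- The commutation of `L : m ↦ g^1 ⊗ ⋯ ⊗ g^n ⊗ x_(-1) ⊗ x_(0)`, for `m = g^1 ⊗ ⋯ ⊗ g^n ⊗ x`, with
the diagonal action. Here `R b` is right multiplication by `b` in the last `H`-factor. -/
def CoactLastRule [HasBijectiveAntipode k H] (d : H →ₗ[k] M →ₗ[k] M) (L : M →ₗ[k] H ⊗[k] M)
    (R : H →ₗ[k] (H ⊗[k] M →ₗ[k] H ⊗[k] M)) : Prop :=
  ∀ a m, L (d a m) = ∑ i ∈ (ℛ k a).index,
    R (sInv k H ((ℛ k a).right i)) (diagStep k H d ((ℛ k a).left i) (L m))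

lemma CoactLastRule.step [HasBijectiveAntipode k H] {d : H →ₗ[k] M →ₗ[k] M}
    {L : M →ₗ[k] H ⊗[k] M} {R : H →ₗ[k] (H ⊗[k] M →ₗ[k] H ⊗[k] M)} (h : CoactLastRule d L R) :
    CoactLastRule (diagStep k H d) (L.lTensor H) (LinearMap.lTensorHom H ∘ₗ R) := by
  intro a y
  induction y with
  | zero => simp
  | add x y hx hy => simp only [map_add, hx, hy, Finset.sum_add_distrib]
  | tmul g m =>
    simp only [diagStep_tmul, map_sum, LinearMap.lTensor_tmul, h _ m, TensorProduct.tmul_sum,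
      LinearMap.comp_apply, LinearMap.coe_lTensorHom]
    rw [sum_coassoc' (fun a b c =>
      (a * g) ⊗ₜ[k] R (sInv k H c) (diagStep k H d b (L m)))]
    all_goals
      intros
      constructor <;> intros <;>
        simp [add_mul, TensorProduct.tmul_add, TensorProduct.add_tmul,
          ← TensorProduct.smul_tmul']

/-- `R` is a right action of `H` on `N` that commutes with the left action `d`. -/
structure IsCommutingRightAction {N : Type u} [AddCommGroup N] [Module k N]
    (d : H →ₗ[k] N →ₗ[k] N) (R : H →ₗ[k] (N →ₗ[k] N)) : Prop where
  one_apply : ∀ y, R 1 y = y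
  mul_apply : ∀ a b y, R (a * b) y = R b (R a y)
  comm : ∀ a b y, R b (d a y) = d a (R b y)

lemma IsCommutingRightAction.step {d : H →ₗ[k] M →ₗ[k] M} {R : H →ₗ[k] (M →ₗ[k] M)}
    (h : IsCommutingRightAction d R) :
    IsCommutingRightAction (diagStep k H d) (LinearMap.lTensorHom H ∘ₗ R) where
  one_apply y := by
    have : R 1 = LinearMap.id := LinearMap.ext h.one_apply
    simp [this]
  mul_apply a b y := by
    have : R (a * b) = R b ∘ₗ R a := LinearMap.ext (h.mul_apply a b)
    simp [this, LinearMap.lTensor_comp]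
  comm a b y := by
    induction y with
    | zero => simp
    | add x y hx hy => simp only [map_add, hx, hy]
    | tmul g m => simp [diagStep_tmul, h.comm]

/-- `w ⊗ y ↦ R(S⁻¹(w)) (A y)`. -/
def sInvShift [HasBijectiveAntipode k H] (R : H →ₗ[k] (M →ₗ[k] M)) (A : M →ₗ[k] M) :
    H ⊗[k] M →ₗ[k] M :=
  TensorProduct.lift (R ∘ₗ sInv k H) ∘ₗ A.lTensor H

lemma sInvShift_tmul [HasBijectiveAntipode k H] (R : H →ₗ[k] (M →ₗ[k] M)) (A : M →ₗ[k] M) (w : H)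
    (y : M) : sInvShift R A (w ⊗ₜ[k] y) = R (sInv k H w) (A y) := by
  simp [sInvShift]

/-- The comparison of `L A ι` with the next stage `A'` of `A`, corrected by the coaction `c`:
`L (A (ι y)) = R(S⁻¹(y_(1))) (A' y_(0))`. On coinvariant elements there is no correction. -/
def AlphaRule [HasBijectiveAntipode k H] (d : H →ₗ[k] M →ₗ[k] M) (c : M →ₗ[k] H ⊗[k] M)
    (L : M →ₗ[k] H ⊗[k] M) (A : M →ₗ[k] M) (ι : H ⊗[k] M →ₗ[k] M)
    (R : H →ₗ[k] (H ⊗[k] M →ₗ[k] H ⊗[k] M)) : Prop :=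
  ∀ y, L (A (ι y)) = sInvShift R (alphaStep d A) (coactStep c y)

lemma AlphaRule.step [HasBijectiveAntipode k H] {d : H →ₗ[k] M →ₗ[k] M} {c : M →ₗ[k] H ⊗[k] M}
    {L : M →ₗ[k] H ⊗[k] M} {A : M →ₗ[k] M} {ι : H ⊗[k] M →ₗ[k] M}
    {R : H →ₗ[k] (H ⊗[k] M →ₗ[k] H ⊗[k] M)} (h : AlphaRule d c L A ι R)
    (hL : CoactLastRule d L R) (hR : IsCommutingRightAction (diagStep k H d) R) :
    AlphaRule (diagStep k H d) (coactStep c) (L.lTensor H) (alphaStep d A) (ι.lTensor H)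
      (LinearMap.lTensorHom H ∘ₗ R) := by
  intro y
  induction y with
  | zero => simp
  | add x y hx hy => simp only [map_add, hx, hy]
  | tmul g y =>
    simp only [LinearMap.lTensor_tmul, alphaStep_tmul_sum, map_sum, hL _ (A (ι y)), h y,
      TensorProduct.tmul_sum, coactStep_tmul (coactStep c)]
    generalize coactStep c y = t
    induction t with
    | zero => simp
    | add x y hx hy =>
      simp only [map_add, TensorProduct.tmul_add, Finset.sum_add_distrib, hx, hy]
    | tmul w u =>
      simp only [TensorProduct.map_tmul, LinearMap.mul_apply', TensorProduct.mk_apply,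
        sInvShift_tmul, sInv_mul, LinearMap.comp_apply, LinearMap.coe_lTensorHom,
        alphaStep_tmul_sum, map_sum, LinearMap.lTensor_tmul, hR.mul_apply, ← hR.comm]
      rw [sum_coassoc' (fun a b c => a ⊗ₜ[k] R (sInv k H c)
        (R (sInv k H w) (diagStep k H d b (alphaStep d A u))))]
      all_goals
        intros
        constructor <;> intros <;>
          simp [TensorProduct.tmul_add, TensorProduct.add_tmul, ← TensorProduct.smul_tmul']

lemma AlphaRule.of_coinvariant [HasBijectiveAntipode k H] {d : H →ₗ[k] M →ₗ[k] M}
    {c : M →ₗ[k] H ⊗[k] M} {L : M →ₗ[k] H ⊗[k] M} {A : M →ₗ[k] M} {ι : H ⊗[k] M →ₗ[k] M}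
    {R : H →ₗ[k] (H ⊗[k] M →ₗ[k] H ⊗[k] M)} (h : AlphaRule d c L A ι R)
    (hR : IsCommutingRightAction (diagStep k H d) R) {y : H ⊗[k] M}
    (hy : coactStep c y = 1 ⊗ₜ[k] y) : L (A (ι y)) = alphaStep d A y := by
  rw [h, hy, sInvShift_tmul, sInv_one, hR.one_apply]

lemma lTensor_comp_leftComm_one {f g : H ⊗[k] M →ₗ[k] H ⊗[k] M} {L : M →ₗ[k] H ⊗[k] M}
    (h : ∀ m, (f ∘ₗ g) (1 ⊗ₜ[k] m) = L m) (y : H ⊗[k] M) :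
    (f.lTensor H ∘ₗ g.lTensor H ∘ₗ (TensorProduct.leftComm k H H M).toLinearMap) (1 ⊗ₜ[k] y) =
      L.lTensor H y := by
  induction y with
  | zero => simp
  | add x y hx hy => simp only [map_add, TensorProduct.tmul_add, hx, hy]
  | tmul a m =>
    rw [LinearMap.lTensor_tmul, ← h]
    simp

end Step

variable {X : Type u} [AddCommGroup X] [Module k X]

/-- `g^1 ⊗ ⋯ ⊗ g^n ⊗ x ↦ g^1 ⊗ ⋯ ⊗ g^n ⊗ x_(-1) ⊗ x_(0)`. -/
def coactLast (k : Type v) [Field k] (H : Type u) [Ring H] [HopfAlgebra k H]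
    (X : Type u) [AddCommGroup X] [Module k X] [LeftComodule k H X] :
    (n : ℕ) → Tens k H X n →ₗ[k] Tens k H X (n + 1)
  | 0 => coact k H X
  | n + 1 => (coactLast k H X n).lTensor H

/-- Right multiplication in the last `H`-factor. -/
def mulLast (k : Type v) [Field k] (H : Type u) [Ring H] [HopfAlgebra k H]
    (X : Type u) [AddCommGroup X] [Module k X] :
    (n : ℕ) → H →ₗ[k] (Tens k H X (n + 1) →ₗ[k] Tens k H X (n + 1))
  | 0 => LinearMap.rTensorHom X ∘ₗ (LinearMap.mul k H).flip
  | n + 1 => LinearMap.lTensorHom H ∘ₗ mulLast k H X n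

section

variable [LeftComodule k H X] [Module H X] [IsScalarTower k H X]

lemma cycC_one_tmul : ∀ (n : ℕ) (m : Tens k H X n),
    cycC k H X n ((1 : H) ⊗ₜ[k] m) = coactLast k H X n m
  | 0, m => by
    have h := cotwist_tmul (k := k) (H := H) (X := X) 1 m
    rw [LinearMap.mulRight_one, LinearMap.rTensor_id] at h
    exact h
  | n + 1, m => lTensor_comp_leftComm_one (cycC_one_tmul n) m

omit [LeftComodule k H X] in
lemma isAction_diag : ∀ n, IsAction (diag k H X n)
  | 0 => isAction_actHom (k := k) (H := H) (X := X)
  | n + 1 => (isAction_diag n).step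

omit [LeftComodule k H X] in
lemma alphaAux_bijective : ∀ n, Function.Bijective (alphaAux k H X n)
  | 0 => Function.bijective_id
  | n + 1 => (isAction_diag n).alphaStep_bijective (alphaAux_bijective n)

omit [LeftComodule k H X] in
lemma isCommutingRightAction_actHom : IsCommutingRightAction (diagStep k H (actHom k H X))
    (LinearMap.rTensorHom X ∘ₗ (LinearMap.mul k H).flip) where
  one_apply y := by
    induction y with
    | zero => simp
    | add x y hx hy => simp only [map_add, hx, hy]
    | tmul g x => simp
  mul_apply a b y := by
    induction y with
    | zero => simp
    | add x y hx hy => simp only [map_add, hx, hy]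
    | tmul g x => simp [mul_assoc]
  comm a b y := by
    induction y with
    | zero => simp
    | add x y hx hy => simp only [map_add, hx, hy]
    | tmul g x => simp [diagStep_tmul, mul_assoc]

omit [LeftComodule k H X] in
lemma isCommutingRightAction_mulLast :
    ∀ n, IsCommutingRightAction (diagStep k H (diag k H X n)) (mulLast k H X n)
  | 0 => isCommutingRightAction_actHom (k := k) (H := H) (X := X)
  | n + 1 => (isCommutingRightAction_mulLast n).step

variable [HasBijectiveAntipode k H] [IsAntiYetterDrinfeld k H X]

/-- The anti-Yetter-Drinfeld condition. -/
lemma coactLastRule_zero : CoactLastRule (actHom k H X) (coact k H X)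
    (LinearMap.rTensorHom X ∘ₗ (LinearMap.mul k H).flip) := by
  intro a x
  simp only [actHom_apply, IsAntiYetterDrinfeld.coact_smul]
  generalize coact k H X x = t
  induction t with
  | zero => simp
  | add x y hx hy => simp only [map_add, Finset.sum_add_distrib, hx, hy]
  | tmul w u =>
    simp only [TensorProduct.map_tmul, LinearMap.comp_apply, LinearMap.mulLeft_apply,
      LinearMap.mulRight_apply, LinearMap.coe_rTensorHom, diagStep_tmul, map_sum,
      LinearMap.rTensor_tmul, LinearMap.flip_apply, LinearMap.mul_apply', ← mul_assoc]
    rw [sum_coassoc' (fun a b c => (a * w * sInv k H c) ⊗ₜ[k] actHom k H X b u)]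
    all_goals
      intros
      constructor <;> intros <;>
        simp [add_mul, mul_add, TensorProduct.tmul_add, TensorProduct.add_tmul,
          ← TensorProduct.smul_tmul']

lemma coactLastRule : ∀ n, CoactLastRule (diag k H X n) (coactLast k H X n) (mulLast k H X n)
  | 0 => coactLastRule_zero (k := k) (H := H) (X := X)
  | n + 1 => (coactLastRule n).step

lemma alphaRule_zero : AlphaRule (actHom k H X) ((antipode k).rTensor X ∘ₗ coact k H X)
    (coact k H X) LinearMap.id (act k H X)
    (LinearMap.rTensorHom X ∘ₗ (LinearMap.mul k H).flip) := by
  intro y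
  induction y with
  | zero => simp
  | add x y hx hy => simp only [map_add, hx, hy]
  | tmul h x =>
    simp only [LinearMap.id_apply, act_tmul, IsAntiYetterDrinfeld.coact_smul, coactStep_tmul,
      LinearMap.comp_apply]
    generalize coact k H X x = t
    induction t with
    | zero => simp
    | add x y hx hy => simp only [map_add, Finset.sum_add_distrib, hx, hy]
    | tmul w u =>
      simp only [TensorProduct.map_tmul, LinearMap.comp_apply, LinearMap.mulLeft_apply,
        LinearMap.mulRight_apply, LinearMap.rTensor_tmul, map_sum, sInvShift_tmul,
        LinearMap.mul_apply', TensorProduct.mk_apply, alphaStep_tmul_sum, LinearMap.id_apply,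
        LinearMap.coe_rTensorHom, LinearMap.flip_apply, sInv_mul, sInv_antipode]
      rw [sum_coassoc' (fun a b c => (a * (w * sInv k H c)) ⊗ₜ[k] actHom k H X b u)]
      all_goals
        intros
        constructor <;> intros <;>
          simp [add_mul, mul_add, TensorProduct.tmul_add, TensorProduct.add_tmul,
            ← TensorProduct.smul_tmul']

lemma alphaRule : ∀ n, AlphaRule (diag k H X n) (coactR k H X n) (coactLast k H X n)
    (alphaAux k H X n) (absorb k H X n) (mulLast k H X n)
  | 0 => alphaRule_zero (k := k) (H := H) (X := X)
  | n + 1 => (alphaRule n).step (coactLastRule n) (isCommutingRightAction_mulLast n)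

/-- On coinvariants, `τ_c (1 ⊗ A_n (i y)) = A_{n+1} y`, where `A` is `alphaAux`. -/
lemma cycC_one_tmul_alphaAux_absorb {n : ℕ} {y : Tens k H X (n + 1)} (hy : y ∈ invA k H X n) :
    cycC k H X n ((1 : H) ⊗ₜ[k] alphaAux k H X n (absorb k H X n y)) =
      alphaAux k H X (n + 1) y :=
  (cycC_one_tmul n _).trans
    ((alphaRule n).of_coinvariant (isCommutingRightAction_mulLast n) hy)

omit [LeftComodule k H X] [HasBijectiveAntipode k H] [IsAntiYetterDrinfeld k H X] in
lemma dropA_alphaAux (n : ℕ) (y : Tens k H X (n + 2)) :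
    dropA k H X (n + 1) (alphaAux k H X (n + 2) y) = alphaAux k H X (n + 1) (mulFirst k H X n y) :=
  dropFirst_alphaStep (isAction_diag n) (alphaAux k H X n) y

omit [LeftComodule k H X] [HasBijectiveAntipode k H] [IsAntiYetterDrinfeld k H X] in
lemma alphaAux_insertOne (n : ℕ) (y : Tens k H X (n + 1)) :
    alphaAux k H X (n + 2) (insertOne k H X n y) =
      comulFirst k H X n (alphaAux k H X (n + 1) y) :=
  alphaStep_insertOne (isAction_diag n) (alphaAux k H X n) y

omit [LeftComodule k H X] [HasBijectiveAntipode k H] [IsAntiYetterDrinfeld k H X] in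
lemma mkQ_one_tmul_bijective (n : ℕ) : Function.Bijective fun m : Tens k H X n =>
    (augSub k H X (n + 1)).mkQ ((1 : H) ⊗ₜ[k] m) :=
  (isAction_diag n).mkQ_one_tmul_bijective (N := augSub k H X (n + 1)) rfl

omit [LeftComodule k H X] [HasBijectiveAntipode k H] [IsAntiYetterDrinfeld k H X] in
lemma mkQ_alphaAux (n : ℕ) (y : Tens k H X (n + 1)) :
    (augSub k H X (n + 1)).mkQ (alphaAux k H X (n + 1) y) =
      (augSub k H X (n + 1)).mkQ ((1 : H) ⊗ₜ[k] alphaAux k H X n (dropA k H X n y)) :=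
  map_alphaStep (q := (augSub k H X (n + 1)).mkQ) (mkQ_diag (n + 1)) (alphaAux k H X n) y

end

end Alpha

/-! ### Cocyclic modules generated by `∂_0`, `σ_0` and `τ` -/

section Generators

variable {k : Type v} [Field k]

/-- `τ^{-i} ∂_0 τ^i`, for every natural number `i`. -/
def ParaCocyclicData.conjCoface (A : ParaCocyclicData.{u} k) (n i : ℕ) :
    A.obj n →ₗ[k] A.obj (n + 1) :=
  (A.cycInv (n + 1) ^ i : Module.End k _) ∘ₗ A.coface n 0 ∘ₗ (A.cyc n ^ i : Module.End k _)

/-- `τ^{-j} σ_0 τ^j`, for every natural number `j`. -/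
def ParaCocyclicData.conjCodegen (A : ParaCocyclicData.{u} k) (n j : ℕ) :
    A.obj (n + 1) →ₗ[k] A.obj n :=
  (A.cycInv n ^ j : Module.End k _) ∘ₗ A.codegen n 0 ∘ₗ (A.cyc (n + 1) ^ j : Module.End k _)

/-- A graded module whose cofaces and codegeneracies are generated by `∂_0`, `σ_0` and an invertible
`τ`, with those cocyclic identities that do not involve the last coface. If moreover
`τ_n ^ (n + 1) = id`, the other identities follow. -/
structure ParaCocyclicData.IsGenerated (A : ParaCocyclicData.{u} k) : Prop where
  cyc_cycInv : ∀ n x, A.cyc n (A.cycInv n x) = x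
  cycInv_cyc : ∀ n x, A.cycInv n (A.cyc n x) = x
  coface_eq : ∀ n i, A.coface n i = A.conjCoface n i
  codegen_eq : ∀ n j, A.codegen n j = A.conjCodegen n j
  coface_coface : ∀ n m, m ≤ n → ∀ x, A.conjCoface (n + 1) (m + 1) (A.conjCoface n 0 x) =
    A.conjCoface (n + 1) 0 (A.conjCoface n m x)
  codegen_codegen : ∀ n m, m ≤ n → ∀ x, A.conjCodegen n m (A.conjCodegen (n + 1) 0 x) =
    A.conjCodegen n 0 (A.conjCodegen (n + 1) (m + 1) x)
  codegen_coface_of_le : ∀ n m, m ≤ n → ∀ x,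
    A.conjCodegen (n + 1) (m + 1) (A.conjCoface (n + 1) 0 x) =
      A.conjCoface n 0 (A.conjCodegen n m x)
  codegen_coface_self : ∀ n x, A.conjCodegen n 0 (A.conjCoface n 0 x) = x
  codegen_coface_succ : ∀ n x, A.conjCodegen n 0 (A.conjCoface n 1 x) = x
  codegen_coface_of_gt : ∀ n m, 0 < m → m ≤ n → ∀ x,
    A.conjCodegen (n + 1) 0 (A.conjCoface (n + 1) (m + 1) x) =
      A.conjCoface n m (A.conjCodegen n 0 x)

namespace ParaCocyclicData

/-- A degreewise surjective family of maps that commutes with all structure maps. -/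
structure IsQuotientMap (A B : ParaCocyclicData.{u} k) (q : ∀ n, A.obj n →ₗ[k] B.obj n) :
    Prop where
  surjective : ∀ n, Function.Surjective (q n)
  coface : ∀ n i x, q (n + 1) (A.coface n i x) = B.coface n i (q n x)
  codegen : ∀ n j x, q n (A.codegen n j x) = B.codegen n j (q (n + 1) x)
  cyc : ∀ n x, q n (A.cyc n x) = B.cyc n (q n x)
  cycInv : ∀ n x, q n (A.cycInv n x) = B.cycInv n (q n x)

lemma map_pow_apply {V W : Type*} [AddCommGroup V] [Module k V] [AddCommGroup W] [Module k W]
    {q : V →ₗ[k] W} {f : Module.End k V} {g : Module.End k W} (h : ∀ x, q (f x) = g (q x)) (i : ℕ) :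
    ∀ x, q ((f ^ i) x) = (g ^ i) (q x) := by
  induction i with
  | zero => exact fun x => rfl
  | succ i ih =>
    intro x
    rw [pow_succ', pow_succ', Module.End.mul_apply, Module.End.mul_apply, h, ih]

section

variable {A B : ParaCocyclicData.{u} k} {q : ∀ n, A.obj n →ₗ[k] B.obj n}

lemma IsQuotientMap.conjCoface (h : IsQuotientMap A B q) (n i : ℕ) (x : A.obj n) :
    q (n + 1) (A.conjCoface n i x) = B.conjCoface n i (q n x) := by
  simp only [ParaCocyclicData.conjCoface, LinearMap.comp_apply]
  rw [map_pow_apply (h.cycInv (n + 1)), h.coface, map_pow_apply (h.cyc n)]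

lemma IsQuotientMap.conjCodegen (h : IsQuotientMap A B q) (n j : ℕ) (x : A.obj (n + 1)) :
    q n (A.conjCodegen n j x) = B.conjCodegen n j (q (n + 1) x) := by
  simp only [ParaCocyclicData.conjCodegen, LinearMap.comp_apply]
  rw [map_pow_apply (h.cycInv n), h.codegen, map_pow_apply (h.cyc (n + 1))]

lemma IsGenerated.of_isQuotientMap (hA : A.IsGenerated) (h : IsQuotientMap A B q) :
    B.IsGenerated where
  cyc_cycInv n x := by
    obtain ⟨x, rfl⟩ := h.surjective n x
    rw [← h.cycInv, ← h.cyc, hA.cyc_cycInv]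
  cycInv_cyc n x := by
    obtain ⟨x, rfl⟩ := h.surjective n x
    rw [← h.cyc, ← h.cycInv, hA.cycInv_cyc]
  coface_eq n i := by
    refine LinearMap.ext fun x => ?_
    obtain ⟨x, rfl⟩ := h.surjective n x
    rw [← h.coface, ← h.conjCoface, hA.coface_eq]
  codegen_eq n j := by
    refine LinearMap.ext fun x => ?_
    obtain ⟨x, rfl⟩ := h.surjective (n + 1) x
    rw [← h.codegen, ← h.conjCodegen, hA.codegen_eq]
  coface_coface n m hm x := by
    obtain ⟨x, rfl⟩ := h.surjective n x
    simp only [← h.conjCoface, hA.coface_coface n m hm]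
  codegen_codegen n m hm x := by
    obtain ⟨x, rfl⟩ := h.surjective (n + 1 + 1) x
    simp only [← h.conjCodegen, hA.codegen_codegen n m hm]
  codegen_coface_of_le n m hm x := by
    obtain ⟨x, rfl⟩ := h.surjective (n + 1) x
    simp only [← h.conjCodegen, ← h.conjCoface, hA.codegen_coface_of_le n m hm]
  codegen_coface_self n x := by
    obtain ⟨x, rfl⟩ := h.surjective n x
    simp only [← h.conjCodegen, ← h.conjCoface, hA.codegen_coface_self]
  codegen_coface_succ n x := by
    obtain ⟨x, rfl⟩ := h.surjective n x
    simp only [← h.conjCodegen, ← h.conjCoface, hA.codegen_coface_succ]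
  codegen_coface_of_gt n m h0 hm x := by
    obtain ⟨x, rfl⟩ := h.surjective (n + 1) x
    simp only [← h.conjCodegen, ← h.conjCoface, hA.codegen_coface_of_gt n m h0 hm]

end

namespace IsGenerated

variable {A : ParaCocyclicData.{u} k} (hA : A.IsGenerated)

include hA in
lemma cyc_injective (n : ℕ) : Function.Injective (A.cyc n) :=
  Function.LeftInverse.injective (hA.cycInv_cyc n)

include hA in
lemma cyc_conjCoface (n i : ℕ) (x : A.obj n) :
    A.cyc (n + 1) (A.conjCoface n (i + 1) x) = A.conjCoface n i (A.cyc n x) := by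
  simp only [ParaCocyclicData.conjCoface, LinearMap.comp_apply, pow_succ']
  rw [Module.End.mul_apply, hA.cyc_cycInv, ← pow_succ', pow_succ, Module.End.mul_apply]

include hA in
lemma cyc_conjCodegen (n j : ℕ) (x : A.obj (n + 1)) :
    A.cyc n (A.conjCodegen n (j + 1) x) = A.conjCodegen n j (A.cyc (n + 1) x) := by
  simp only [ParaCocyclicData.conjCodegen, LinearMap.comp_apply, pow_succ']
  rw [Module.End.mul_apply, hA.cyc_cycInv, ← pow_succ', pow_succ, Module.End.mul_apply]

include hA in
lemma coface_coface_add {n m : ℕ} (h : ∀ x, A.conjCoface (n + 1) (m + 1) (A.conjCoface n 0 x) =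
    A.conjCoface (n + 1) 0 (A.conjCoface n m x)) (i : ℕ) : ∀ x,
    A.conjCoface (n + 1) (i + m + 1) (A.conjCoface n i x) =
      A.conjCoface (n + 1) i (A.conjCoface n (i + m) x) := by
  induction i with
  | zero => simpa using h
  | succ i ih =>
    intro x
    apply hA.cyc_injective
    rw [add_right_comm i 1 m, hA.cyc_conjCoface, hA.cyc_conjCoface, ih, hA.cyc_conjCoface,
      hA.cyc_conjCoface]

include hA in
lemma codegen_codegen_add {n m : ℕ}
    (h : ∀ x, A.conjCodegen n m (A.conjCodegen (n + 1) 0 x) =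
      A.conjCodegen n 0 (A.conjCodegen (n + 1) (m + 1) x)) (i : ℕ) : ∀ x,
    A.conjCodegen n (i + m) (A.conjCodegen (n + 1) i x) =
      A.conjCodegen n i (A.conjCodegen (n + 1) (i + m + 1) x) := by
  induction i with
  | zero => simpa using h
  | succ i ih =>
    intro x
    apply hA.cyc_injective
    rw [add_right_comm i 1 m, hA.cyc_conjCodegen, hA.cyc_conjCodegen, ih, hA.cyc_conjCodegen,
      hA.cyc_conjCodegen]

include hA in
lemma codegen_coface_add_of_le {n m : ℕ}
    (h : ∀ x, A.conjCodegen (n + 1) (m + 1) (A.conjCoface (n + 1) 0 x) =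
      A.conjCoface n 0 (A.conjCodegen n m x)) (i : ℕ) : ∀ x,
    A.conjCodegen (n + 1) (i + m + 1) (A.conjCoface (n + 1) i x) =
      A.conjCoface n i (A.conjCodegen n (i + m) x) := by
  induction i with
  | zero => simpa using h
  | succ i ih =>
    intro x
    apply hA.cyc_injective
    rw [add_right_comm i 1 m, hA.cyc_conjCodegen, hA.cyc_conjCoface, ih, hA.cyc_conjCoface,
      hA.cyc_conjCodegen]

include hA in
lemma codegen_coface_add_of_gt {n m : ℕ}
    (h : ∀ x, A.conjCodegen (n + 1) 0 (A.conjCoface (n + 1) (m + 1) x) =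
      A.conjCoface n m (A.conjCodegen n 0 x)) (j : ℕ) : ∀ x,
    A.conjCodegen (n + 1) j (A.conjCoface (n + 1) (j + m + 1) x) =
      A.conjCoface n (j + m) (A.conjCodegen n j x) := by
  induction j with
  | zero => simpa using h
  | succ j ih =>
    intro x
    apply hA.cyc_injective
    rw [add_right_comm j 1 m, hA.cyc_conjCodegen, hA.cyc_conjCoface, ih, hA.cyc_conjCoface,
      hA.cyc_conjCodegen]

include hA in
lemma codegen_coface_add_of_eq {n m : ℕ} (h : ∀ x, A.conjCodegen n 0 (A.conjCoface n m x) = x)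
    (j : ℕ) : ∀ x, A.conjCodegen n j (A.conjCoface n (j + m) x) = x := by
  induction j with
  | zero => simpa using h
  | succ j ih =>
    intro x
    apply hA.cyc_injective
    rw [add_right_comm j 1 m, hA.cyc_conjCodegen, hA.cyc_conjCoface, ih]

variable (hT : ∀ n, (A.cyc n) ^ (n + 1) = (1 : Module.End k (A.obj n)))

include hA in
lemma cycInv_pow_cyc_pow (n i : ℕ) (x : A.obj n) :
    (A.cycInv n ^ i : Module.End k _) ((A.cyc n ^ i : Module.End k _) x) = x := by
  induction i generalizing x with
  | zero => rfl
  | succ i ih =>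
    rw [pow_succ, pow_succ', Module.End.mul_apply, Module.End.mul_apply, hA.cycInv_cyc, ih]

include hA hT in
lemma cycInv_pow (n : ℕ) (x : A.obj n) :
    (A.cycInv n ^ n : Module.End k _) x = A.cyc n x := by
  have h : (A.cyc n ^ n : Module.End k _) (A.cyc n x) = x := by
    rw [← Module.End.mul_apply, ← pow_succ, hT, Module.End.one_apply]
  conv_lhs => rw [← h]
  rw [hA.cycInv_pow_cyc_pow]

include hA hT in
/-- The last coface is `τ ∂_0`. -/
lemma conjCoface_last (n : ℕ) (x : A.obj n) :
    A.conjCoface n (n + 1) x = A.cyc (n + 1) (A.conjCoface n 0 x) := by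
  simp only [ParaCocyclicData.conjCoface, LinearMap.comp_apply, hT, Module.End.one_apply, pow_zero]
  exact hA.cycInv_pow hT (n + 1) _

include hA hT in
lemma conjCodegen_last (n : ℕ) (x : A.obj (n + 1)) :
    A.conjCodegen n n (A.cyc (n + 1) (A.cyc (n + 1) x)) = A.cyc n (A.conjCodegen n 0 x) := by
  simp only [ParaCocyclicData.conjCodegen, LinearMap.comp_apply, Module.End.one_apply, pow_zero]
  rw [hA.cycInv_pow hT, ← Module.End.mul_apply (A.cyc (n + 1) ^ n), ← pow_succ,
    ← Module.End.mul_apply (A.cyc (n + 1) ^ (n + 1)), ← pow_succ, hT, Module.End.one_apply]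

include hA hT in
theorem isCocyclic : A.IsCocyclic where
  coface_coface n i j hij := by
    have key : ∀ m, m ≤ n + 1 → ∀ x, A.conjCoface (n + 1) (m + 1) (A.conjCoface n 0 x) =
        A.conjCoface (n + 1) 0 (A.conjCoface n m x) := by
      intro m hm
      rcases Nat.lt_or_ge n m with h | h
      · obtain rfl : m = n + 1 := by omega
        intro x
        rw [hA.conjCoface_last hT, hA.conjCoface_last hT, ← hA.cyc_conjCoface,
          hA.coface_coface n 0 (Nat.zero_le n)]
      · exact hA.coface_coface n m h
    obtain ⟨m, hm⟩ := Nat.exists_eq_add_of_le (Fin.le_def.1 hij)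
    refine LinearMap.ext fun x => ?_
    simp only [LinearMap.comp_apply, hA.coface_eq, Fin.val_succ, Fin.val_castSucc, hm]
    exact hA.coface_coface_add (key m (by omega)) i x
  codegen_codegen n i j hij := by
    obtain ⟨m, hm⟩ := Nat.exists_eq_add_of_le (Fin.le_def.1 hij)
    refine LinearMap.ext fun x => ?_
    simp only [LinearMap.comp_apply, hA.codegen_eq, Fin.val_succ, Fin.val_castSucc, hm]
    exact hA.codegen_codegen_add (hA.codegen_codegen n m (by omega)) i x
  codegen_coface_of_le n i j hij := by
    obtain ⟨m, hm⟩ := Nat.exists_eq_add_of_le (Fin.le_def.1 hij)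
    rw [Fin.val_castSucc] at hm
    refine LinearMap.ext fun x => ?_
    simp only [LinearMap.comp_apply, hA.codegen_eq, hA.coface_eq, Fin.val_succ, Fin.val_castSucc,
      hm]
    exact hA.codegen_coface_add_of_le (hA.codegen_coface_of_le n m (by omega)) i x
  codegen_coface_self n j := by
    refine LinearMap.ext fun x => ?_
    simp only [LinearMap.comp_apply, hA.codegen_eq, hA.coface_eq, Fin.val_castSucc]
    exact hA.codegen_coface_add_of_eq (hA.codegen_coface_self n) j x
  codegen_coface_succ n j := by
    refine LinearMap.ext fun x => ?_
    simp only [LinearMap.comp_apply, hA.codegen_eq, hA.coface_eq, Fin.val_succ]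
    exact hA.codegen_coface_add_of_eq (hA.codegen_coface_succ n) j x
  codegen_coface_of_gt n i j hij := by
    have key : ∀ m, 0 < m → m ≤ n + 1 → ∀ x,
        A.conjCodegen (n + 1) 0 (A.conjCoface (n + 1) (m + 1) x) =
          A.conjCoface n m (A.conjCodegen n 0 x) := by
      intro m h0 hm
      rcases Nat.lt_or_ge n m with h | h
      · obtain rfl : m = n + 1 := by omega
        intro x
        rw [hA.conjCoface_last hT, hA.conjCoface_last hT, ← hA.cyc_conjCodegen,
          hA.codegen_coface_of_le n 0 (Nat.zero_le n)]
      · exact hA.codegen_coface_of_gt n m h0 h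
    obtain ⟨m, hm⟩ := Nat.exists_eq_add_of_lt (Fin.lt_def.1 hij)
    rw [Fin.val_castSucc] at hm
    refine LinearMap.ext fun x => ?_
    simp only [LinearMap.comp_apply, hA.codegen_eq, hA.coface_eq, Fin.val_succ, Fin.val_castSucc,
      hm]
    exact hA.codegen_coface_add_of_gt (key (m + 1) m.succ_pos (by omega)) j x
  cyc_cycInv n := LinearMap.ext (hA.cyc_cycInv n)
  cycInv_cyc n := LinearMap.ext (hA.cycInv_cyc n)
  cyc_coface_succ n i := by
    refine LinearMap.ext fun x => ?_
    simp only [LinearMap.comp_apply, hA.coface_eq, Fin.val_succ, Fin.val_castSucc,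
      hA.cyc_conjCoface]
  cyc_coface_zero n := by
    refine LinearMap.ext fun x => ?_
    simp only [LinearMap.comp_apply, hA.coface_eq, Fin.val_last, Fin.val_zero,
      hA.conjCoface_last hT]
  cyc_codegen_succ n j := by
    refine LinearMap.ext fun x => ?_
    simp only [LinearMap.comp_apply, hA.codegen_eq, Fin.val_succ, Fin.val_castSucc,
      hA.cyc_conjCodegen]
  cyc_codegen_zero n := by
    refine LinearMap.ext fun x => ?_
    simp only [LinearMap.comp_apply, hA.codegen_eq, Fin.val_last, Fin.val_zero,
      hA.conjCodegen_last hT]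
  cyc_pow := hT

end IsGenerated

end ParaCocyclicData

end Generators

/-! ### Commutation of the cocyclic operator with comultiplication and counit -/

section CoalgebraSide

variable {k : Type v} [Field k] {H : Type u} [Ring H] [HopfAlgebra k H]

section Step

variable {M N : Type u} [AddCommGroup M] [Module k M] [AddCommGroup N] [Module k N]

/-- `h ⊗ g ⊗ m ↦ g ⊗ R(h ⊗ m)`, the recursion of the cyclic operator. -/
def cycStep (R : H ⊗[k] M →ₗ[k] H ⊗[k] M) : H ⊗[k] (H ⊗[k] M) →ₗ[k] H ⊗[k] (H ⊗[k] M) :=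
  R.lTensor H ∘ₗ (TensorProduct.leftComm k H H M).toLinearMap

variable (k H M) in
/-- `h ⊗ m ↦ h_(1) ⊗ h_(2) ⊗ m`. -/
def comulHead : H ⊗[k] M →ₗ[k] H ⊗[k] (H ⊗[k] M) :=
  (TensorProduct.assoc k H H M).toLinearMap ∘ₗ comul.rTensor M

lemma cycStep_comp {f g : H ⊗[k] M →ₗ[k] H ⊗[k] M} :
    f.lTensor H ∘ₗ g.lTensor H ∘ₗ (TensorProduct.leftComm k H H M).toLinearMap =
      cycStep (f ∘ₗ g) := by
  rw [cycStep, LinearMap.lTensor_comp, LinearMap.comp_assoc]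

lemma cycStep_comulHead (R : H ⊗[k] M →ₗ[k] H ⊗[k] M) :
    cycStep (cycStep R) ∘ₗ (comulHead k H M).lTensor H =
      comulHead k H (H ⊗[k] M) ∘ₗ cycStep R := by
  refine LinearMap.ext fun y => ?_
  induction y with
  | zero => simp
  | add x y hx hy => simp only [map_add, hx, hy]
  | tmul h y =>
    induction y with
    | zero => simp
    | add x y hx hy => simp only [map_add, TensorProduct.tmul_add, hx, hy]
    | tmul g m =>
      simp only [LinearMap.comp_apply, comulHead, LinearMap.lTensor_tmul, LinearMap.rTensor_tmul,
        cycStep, LinearEquiv.coe_coe, TensorProduct.leftComm_tmul]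
      generalize comul (R := k) g = t
      induction t with
      | zero => simp
      | add x y hx hy =>
        simp only [map_add, TensorProduct.tmul_add, TensorProduct.add_tmul, hx, hy]
      | tmul a b => simp

lemma cycStep_dropFirst (R : H ⊗[k] M →ₗ[k] H ⊗[k] M) :
    R ∘ₗ (dropFirst k H M).lTensor H = dropFirst k H (H ⊗[k] M) ∘ₗ cycStep R := by
  ext h g m
  simp [cycStep]

lemma cycStep_lTensor {R : H ⊗[k] M →ₗ[k] H ⊗[k] M} {R' : H ⊗[k] N →ₗ[k] H ⊗[k] N}
    {D : M →ₗ[k] N} {D' : H ⊗[k] M →ₗ[k] H ⊗[k] N} (h : R' ∘ₗ D.lTensor H = D' ∘ₗ R) :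
    cycStep R' ∘ₗ (D.lTensor H).lTensor H = D'.lTensor H ∘ₗ cycStep R := by
  refine LinearMap.ext fun y => ?_
  induction y with
  | zero => simp
  | add x y hx hy => simp only [map_add, hx, hy]
  | tmul a y =>
    induction y with
    | zero => simp
    | add x y hx hy => simp only [map_add, TensorProduct.tmul_add, hx, hy]
    | tmul b m =>
      have := LinearMap.congr_fun h (a ⊗ₜ[k] m)
      simp only [LinearMap.comp_apply, LinearMap.lTensor_tmul] at this
      simp [cycStep, this]

lemma comulHead_naturality (D : M →ₗ[k] N) (y : H ⊗[k] M) :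
    (D.lTensor H).lTensor H (comulHead k H M y) = comulHead k H N (D.lTensor H y) := by
  induction y with
  | zero => simp
  | add x y hx hy => simp only [map_add, hx, hy]
  | tmul h m =>
    simp only [comulHead, LinearMap.comp_apply, LinearMap.rTensor_tmul, LinearMap.lTensor_tmul]
    generalize comul (R := k) h = t
    induction t with
    | zero => simp
    | add x y hx hy => simp only [map_add, TensorProduct.add_tmul, hx, hy]
    | tmul a b => simp

lemma dropFirst_naturality (D : M →ₗ[k] N) (y : H ⊗[k] M) :
    dropFirst k H N (D.lTensor H y) = D (dropFirst k H M y) := by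
  induction y with
  | zero => simp
  | add x y hx hy => simp only [map_add, hx, hy]
  | tmul h m => simp

lemma comulHead_tmul (h : H) (m : M) : comulHead k H M (h ⊗ₜ[k] m) =
    ∑ i ∈ (ℛ k h).index, (ℛ k h).left i ⊗ₜ[k] ((ℛ k h).right i ⊗ₜ[k] m) := by
  simp only [comulHead, LinearMap.comp_apply, LinearMap.rTensor_tmul]
  conv_lhs => rw [← (ℛ k h).eq]
  simp [TensorProduct.sum_tmul]

lemma comulHead_coassoc (y : H ⊗[k] M) :
    (comulHead k H M).lTensor H (comulHead k H M y) =
      comulHead k H (H ⊗[k] M) (comulHead k H M y) := by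
  induction y with
  | zero => simp
  | add x y hx hy => simp only [map_add, hx, hy]
  | tmul h m =>
    simp only [map_sum, LinearMap.lTensor_tmul, comulHead_tmul, TensorProduct.tmul_sum]
    rw [sum_coassoc' (fun a b c => a ⊗ₜ[k] (b ⊗ₜ[k] (c ⊗ₜ[k] m)))]
    all_goals
      intros
      constructor <;> intros <;>
        simp [TensorProduct.tmul_add, TensorProduct.add_tmul, ← TensorProduct.smul_tmul']

lemma dropFirst_comulHead (y : H ⊗[k] M) :
    dropFirst k H (H ⊗[k] M) (comulHead k H M y) = y := by
  induction y with
  | zero => simp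
  | add x y hx hy => simp only [map_add, hx, hy]
  | tmul h m =>
    conv_rhs => rw [← sum_counit_smul (ℛ k h)]
    simp [comulHead_tmul, TensorProduct.sum_tmul, TensorProduct.smul_tmul']

lemma lTensor_dropFirst_comulHead (y : H ⊗[k] M) :
    (dropFirst k H M).lTensor H (comulHead k H M y) = y := by
  induction y with
  | zero => simp
  | add x y hx hy => simp only [map_add, hx, hy]
  | tmul h m =>
    conv_rhs => rw [← sum_tmul_counit_smul (k := k) h]
    simp [comulHead_tmul, TensorProduct.sum_tmul, TensorProduct.smul_tmul']

lemma lTensor_comp_congr {P P' : Type u} [AddCommGroup P] [Module k P] [AddCommGroup P']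
    [Module k P'] {D : P →ₗ[k] N} {E : M →ₗ[k] P} {D' : P' →ₗ[k] N} {E' : M →ₗ[k] P'}
    (h : ∀ x, D (E x) = D' (E' x)) (y : H ⊗[k] M) :
    D.lTensor H (E.lTensor H y) = D'.lTensor H (E'.lTensor H y) := by
  have h1 : D ∘ₗ E = D' ∘ₗ E' := LinearMap.ext h
  rw [← LinearMap.comp_apply, ← LinearMap.lTensor_comp, h1, LinearMap.lTensor_comp,
    LinearMap.comp_apply]

end Step

variable (k H) (X : Type u) [AddCommGroup X] [Module k X]

/-- Comultiplication in the `m`-th of the `n` factors `H`, counted from `0`. The value for `n ≤ m`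
is irrelevant. -/
def comulAt : (m n : ℕ) → Tens k H X n →ₗ[k] Tens k H X (n + 1)
  | _, 0 => 0
  | 0, n + 1 => comulFirst k H X n
  | m + 1, n + 1 => (comulAt m n).lTensor H

/-- The counit in the `m`-th of the `n + 1` factors `H`, counted from `0`. The value for `n < m` is
irrelevant. -/
def counitAt : (m n : ℕ) → Tens k H X (n + 1) →ₗ[k] Tens k H X n
  | 0, n => dropA k H X n
  | _ + 1, 0 => 0
  | m + 1, n + 1 => (counitAt m n).lTensor H

variable [LeftComodule k H X]

lemma cycC_succ (n : ℕ) : cycC k H X (n + 1) = cycStep (cycC k H X n) :=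
  cycStep_comp (f := onLast k H X (cotwist k H X) n) (g := rotInv k H X n)

lemma cycC_comulAt : ∀ n m, m < n →
    cycC k H X (n + 1) ∘ₗ (comulAt k H X m n).lTensor H = comulAt k H X m (n + 1) ∘ₗ cycC k H X n
  | n + 1, 0, _ => by
    rw [cycC_succ, cycC_succ]
    exact cycStep_comulHead (cycC k H X n)
  | n + 1, m + 1, h => by
    have ih := cycC_comulAt n m (Nat.lt_of_succ_lt_succ h)
    rw [cycC_succ k H X (n + 1), cycC_succ k H X n]
    rw [cycC_succ k H X n] at ih
    exact cycStep_lTensor ih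

lemma cycC_counitAt : ∀ n m, m ≤ n →
    cycC k H X n ∘ₗ (counitAt k H X m n).lTensor H =
      counitAt k H X m (n + 1) ∘ₗ cycC k H X (n + 1)
  | n, 0, _ => by
    rw [cycC_succ, counitAt, counitAt]
    exact cycStep_dropFirst (cycC k H X n)
  | n + 1, m + 1, h => by
    have ih := cycC_counitAt n m (Nat.le_of_succ_le_succ h)
    rw [cycC_succ k H X (n + 1), cycC_succ k H X n]
    rw [cycC_succ k H X n] at ih
    exact cycStep_lTensor ih

end CoalgebraSide

/-! ### Generators of `T^c_*(H, X)` -/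

section CocyclicGenerators

variable {k : Type v} [Field k] {H : Type u} [Ring H] [HopfAlgebra k H]
variable {X : Type u} [AddCommGroup X] [Module k X] [LeftComodule k H X]

section Inverse

lemma cotwist_eq (g : H) (x : X) : cotwist k H X (g ⊗ₜ[k] x) =
    ((LinearMap.mul k H).flip g).rTensor X (coact k H X x) := by
  simp only [cotwist, LinearMap.comp_apply, LinearMap.lTensor_tmul]
  generalize coact k H X x = t
  induction t with
  | zero => simp
  | add x y hx hy => simp only [TensorProduct.tmul_add, map_add, hx, hy]
  | tmul y u => simp

lemma cotwistInv_eq [HasBijectiveAntipode k H] (g : H) (x : X) : cotwistInv k H X (g ⊗ₜ[k] x) =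
    ((LinearMap.mul k H).flip g ∘ₗ sInv k H).rTensor X (coact k H X x) := by
  simp only [cotwistInv, LinearMap.comp_apply, LinearMap.lTensor_tmul]
  generalize coact k H X x = t
  induction t with
  | zero => simp
  | add x y hx hy => simp only [TensorProduct.tmul_add, map_add, hx, hy]
  | tmul y u => simp

/-- If `φ(w_(1) ⊗ w_(2)) = ε(w) g` then `φ(x_(-2) ⊗ x_(-1)) ⊗ x_(0) = g ⊗ x`. -/
lemma rTensor_coact_cancel (φ : H ⊗[k] H →ₗ[k] H) (g : H)
    (hφ : ∀ w, φ (comul w) = (counit w : k) • g) (x : X) :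
    φ.rTensor X ((TensorProduct.assoc k H H X).symm ((coact k H X).lTensor H (coact k H X x))) =
      g ⊗ₜ[k] x := by
  rw [← coact_coassoc, LinearEquiv.symm_apply_apply]
  have : ∀ t : H ⊗[k] X, φ.rTensor X (comul.rTensor X t) = g ⊗ₜ[k] dropFirst k H X t := by
    intro t
    induction t with
    | zero => simp
    | add x y hx hy => simp only [map_add, TensorProduct.tmul_add, hx, hy]
    | tmul w u => simp [hφ, TensorProduct.smul_tmul]
  rw [this, counit_coact]

variable [HasBijectiveAntipode k H]

lemma cotwist_cotwistInv (y : H ⊗[k] X) : cotwist k H X (cotwistInv k H X y) = y := by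
  induction y with
  | zero => simp
  | add x y hx hy => simp only [map_add, hx, hy]
  | tmul g x =>
    rw [cotwistInv_eq, ← rTensor_coact_cancel ((LinearMap.mul k H).flip g ∘ₗ LinearMap.mul' k H ∘ₗ
      (TensorProduct.comm k H H).toLinearMap ∘ₗ (sInv k H).rTensor H) g _ x]
    · generalize coact k H X x = t
      induction t with
      | zero => simp
      | add x y hx hy => simp only [map_add, hx, hy]
      | tmul w u =>
        simp only [LinearMap.rTensor_tmul, cotwist_eq, LinearMap.lTensor_tmul]
        generalize coact k H X u = s
        induction s with
        | zero => simp
        | add x y hx hy => simp only [map_add, TensorProduct.tmul_add, hx, hy]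
        | tmul z m => simp [mul_assoc]
    · intro w
      conv_lhs => rw [← (ℛ k w).eq]
      simp [← Finset.sum_mul, sum_mul_sInv]

lemma cotwistInv_cotwist (y : H ⊗[k] X) : cotwistInv k H X (cotwist k H X y) = y := by
  induction y with
  | zero => simp
  | add x y hx hy => simp only [map_add, hx, hy]
  | tmul g x =>
    rw [cotwist_eq, ← rTensor_coact_cancel ((LinearMap.mul k H).flip g ∘ₗ LinearMap.mul' k H ∘ₗ
      (TensorProduct.comm k H H).toLinearMap ∘ₗ (sInv k H).lTensor H) g _ x]
    · generalize coact k H X x = t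
      induction t with
      | zero => simp
      | add x y hx hy => simp only [map_add, hx, hy]
      | tmul w u =>
        simp only [LinearMap.rTensor_tmul, cotwistInv_eq, LinearMap.lTensor_tmul]
        generalize coact k H X u = s
        induction s with
        | zero => simp
        | add x y hx hy => simp only [map_add, TensorProduct.tmul_add, hx, hy]
        | tmul z m => simp [mul_assoc]
    · intro w
      conv_lhs => rw [← (ℛ k w).eq]
      simp [← Finset.sum_mul, sum_sInv_mul]

variable (k H X)

lemma cycC_cycInvC (n : ℕ) : cycC k H X n ∘ₗ cycInvC k H X n = LinearMap.id := by
  have h : cotwist k H X ∘ₗ cotwistInv k H X = LinearMap.id := LinearMap.ext cotwist_cotwistInv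
  change onLast k H X (cotwist k H X) n ∘ₗ (rotInv k H X n ∘ₗ rot k H X n) ∘ₗ
    onLast k H X (cotwistInv k H X) n = _
  rw [rotInv_rot, LinearMap.id_comp, onLast_comp, h, onLast_id]

lemma cycInvC_cycC (n : ℕ) : cycInvC k H X n ∘ₗ cycC k H X n = LinearMap.id := by
  have h : cotwistInv k H X ∘ₗ cotwist k H X = LinearMap.id := LinearMap.ext cotwistInv_cotwist
  change rot k H X n ∘ₗ (onLast k H X (cotwistInv k H X) n ∘ₗ onLast k H X (cotwist k H X) n) ∘ₗ
    rotInv k H X n = _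
  rw [onLast_comp, h, onLast_id, LinearMap.id_comp, rot_rotInv]

lemma conjCoface_Tc (n : ℕ) : ∀ m, m ≤ n →
    (Tc k H X).conjCoface n m = comulAt k H X m (n + 1)
  | 0, _ => rfl
  | m + 1, h => by
    refine LinearMap.ext fun y => ?_
    have ih := conjCoface_Tc n m (Nat.le_of_succ_le h)
    have h1 : (Tc k H X).conjCoface n (m + 1) y = cycInvC k H X (n + 1)
        ((Tc k H X).conjCoface n m (cycC k H X n y)) := by
      simp only [ParaCocyclicData.conjCoface, LinearMap.comp_apply, pow_succ' (M := Module.End k _)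
        ((Tc k H X).cycInv (n + 1)), pow_succ (M := Module.End k _) ((Tc k H X).cyc n)]
      rfl
    rw [h1, ih]
    have h2 := LinearMap.congr_fun (cycC_comulAt k H X n m h) y
    have h3 := LinearMap.congr_fun (cycInvC_cycC k H X (n + 1)) (comulAt k H X (m + 1) (n + 1) y)
    exact (congrArg (cycInvC k H X (n + 1)) h2.symm).trans h3

lemma conjCodegen_Tc (n : ℕ) : ∀ m, m ≤ n →
    (Tc k H X).conjCodegen n m = counitAt k H X (m + 1) (n + 1)
  | 0, _ => rfl
  | m + 1, h => by
    refine LinearMap.ext fun y => ?_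
    have ih := conjCodegen_Tc n m (Nat.le_of_succ_le h)
    have h1 : (Tc k H X).conjCodegen n (m + 1) y = cycInvC k H X n
        ((Tc k H X).conjCodegen n m (cycC k H X (n + 1) y)) := by
      simp only [ParaCocyclicData.conjCodegen, LinearMap.comp_apply, pow_succ' (M := Module.End k _)
        ((Tc k H X).cycInv n), pow_succ (M := Module.End k _) ((Tc k H X).cyc (n + 1))]
      rfl
    rw [h1, ih]
    have h2 := LinearMap.congr_fun (cycC_counitAt k H X n (m + 1) h) y
    have h3 := LinearMap.congr_fun (cycInvC_cycC k H X n) (counitAt k H X (m + 2) (n + 1) y)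
    exact (congrArg (cycInvC k H X n) h2.symm).trans h3

omit [HasBijectiveAntipode k H] in
lemma cycC_counitSecond (n : ℕ) (y : Tens k H X (n + 2)) :
    cycC k H X n (counitSecond k H X n y) = dropA k H X (n + 1) (cycC k H X (n + 1) y) :=
  LinearMap.congr_fun (cycC_counitAt k H X n 0 n.zero_le) y

lemma Tc_isGenerated : (Tc k H X).IsGenerated where
  cyc_cycInv n := LinearMap.congr_fun (cycC_cycInvC k H X n)
  cycInv_cyc n := LinearMap.congr_fun (cycInvC_cycC k H X n)
  coface_eq n i := rfl
  codegen_eq n j := rfl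
  coface_coface n m hm x := by
    rw [conjCoface_Tc k H X (n + 1) (m + 1) (by omega), conjCoface_Tc k H X n 0 n.zero_le,
      conjCoface_Tc k H X (n + 1) 0 (by omega), conjCoface_Tc k H X n m hm]
    cases m with
    | zero => exact comulHead_coassoc (k := k) (H := H) (M := Tens k H X n) x
    | succ m => exact comulHead_naturality (comulAt k H X m n) x
  codegen_codegen n m hm x := by
    rw [conjCodegen_Tc k H X (n + 1) (m + 1) (by omega), conjCodegen_Tc k H X n 0 n.zero_le,
      conjCodegen_Tc k H X (n + 1) 0 (by omega), conjCodegen_Tc k H X n m hm]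
    exact lTensor_comp_congr (H := H) (fun x =>
      (dropFirst_naturality (counitAt k H X m n) x).symm) x
  codegen_coface_of_le n m hm x := by
    rw [conjCodegen_Tc k H X (n + 1) (m + 1) (by omega), conjCodegen_Tc k H X n m hm,
      conjCoface_Tc k H X (n + 1) 0 (by omega), conjCoface_Tc k H X n 0 n.zero_le]
    exact comulHead_naturality (counitAt k H X m n) x
  codegen_coface_self n x :=
    lTensor_dropFirst_comulHead (k := k) (H := H) (M := Tens k H X n) x
  codegen_coface_succ n x := by
    -- `σ_0 ∂_1 = τ⁻¹ (τ σ_0) τ⁻¹ ∂_0 τ = τ⁻¹ δ ∂_0 τ = id`, where `δ` is the counit in the first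
    -- factor
    have h1 : ∀ y, counitSecond k H X n (cycInvC k H X (n + 1) y) =
        cycInvC k H X n (dropA k H X (n + 1) y) := by
      intro y
      have h2 := cycC_counitSecond k H X n (cycInvC k H X (n + 1) y)
      rw [← LinearMap.comp_apply (cycC k H X (n + 1)), cycC_cycInvC, LinearMap.id_apply] at h2
      rw [← h2]
      exact (LinearMap.congr_fun (cycInvC_cycC k H X n) _).symm
    refine (h1 _).trans ?_
    refine (congrArg (cycInvC k H X n) (dropFirst_comulHead (k := k) (H := H)
      (M := Tens k H X n) (cycC k H X n x))).trans ?_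
    exact LinearMap.congr_fun (cycInvC_cycC k H X n) x
  codegen_coface_of_gt n m h0 hm x := by
    rw [conjCodegen_Tc k H X (n + 1) 0 (by omega), conjCodegen_Tc k H X n 0 n.zero_le,
      conjCoface_Tc k H X (n + 1) (m + 1) (by omega), conjCoface_Tc k H X n m hm]
    obtain ⟨m, rfl⟩ := Nat.exists_eq_succ_of_ne_zero h0.ne'
    exact lTensor_comp_congr (H := H) (fun x =>
      dropFirst_naturality (comulAt k H X m n) x) x

end Inverse

end CocyclicGenerators

/-! ### The cyclic relation on `CM^c_*(H, X)` -/

section CyclicPower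

variable {k : Type v} [Field k] {H : Type u} [Ring H] [HopfAlgebra k H]
variable {X : Type u} [AddCommGroup X] [Module k X]

section Coaction

variable [LeftComodule k H X]

/-- The tensor in `H^{⊗ n} ⊗ X` whose `i`-th factor is `g` if `f i = inl g`, and `z g` if
`f i = inr g`, where `z` runs through the factors of the iterated coaction
`x ↦ x_(-r) ⊗ ⋯ ⊗ x_(-1) ⊗ x_(0)` from left to right. Only the values `f i` with `i < n` matter. -/
def mixedTensor : (n : ℕ) → (ℕ → H ⊕ H) → X →ₗ[k] Tens k H X n
  | 0, _ => LinearMap.id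
  | n + 1, f => (f 0).elim
      (fun g => TensorProduct.mk k H (Tens k H X n) g ∘ₗ mixedTensor n fun i => f (i + 1))
      (fun g => TensorProduct.map ((LinearMap.mul k H).flip g) (mixedTensor n fun i => f (i + 1)) ∘ₗ
        coact k H X)

lemma mixedTensor_congr : ∀ (n : ℕ) {f f' : ℕ → H ⊕ H}, (∀ i < n, f i = f' i) →
    mixedTensor (k := k) (X := X) n f = mixedTensor n f'
  | 0, _, _, _ => rfl
  | n + 1, f, f', h => by
    simp only [mixedTensor, h 0 n.succ_pos,
      mixedTensor_congr n fun i hi => h (i + 1) (Nat.succ_lt_succ hi)]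

lemma mixedTensor_succ_inl (n : ℕ) {f : ℕ → H ⊕ H} {g : H} (h : f 0 = Sum.inl g) (x : X) :
    mixedTensor (k := k) (n + 1) f x = g ⊗ₜ[k] mixedTensor n (fun i => f (i + 1)) x := by
  simp only [mixedTensor, h]
  rfl

lemma mixedTensor_succ_inr (n : ℕ) {f : ℕ → H ⊕ H} {g : H} (h : f 0 = Sum.inr g) (x : X) :
    mixedTensor (k := k) (n + 1) f x = TensorProduct.map ((LinearMap.mul k H).flip g)
      (mixedTensor n fun i => f (i + 1)) (coact k H X x) := by
  simp only [mixedTensor, h]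
  rfl

lemma cycStep_map {M N : Type u} [AddCommGroup M] [Module k M] [AddCommGroup N] [Module k N]
    (R : H ⊗[k] M →ₗ[k] H ⊗[k] M) (φ : H →ₗ[k] H) (P : N →ₗ[k] M) (P' : N →ₗ[k] H ⊗[k] M) (h : H)
    (hP : ∀ x, R (h ⊗ₜ[k] P x) = P' x) (t : H ⊗[k] N) :
    cycStep R (h ⊗ₜ[k] TensorProduct.map φ P t) = TensorProduct.map φ P' t := by
  induction t with
  | zero => simp
  | add x y hx hy => simp only [map_add, TensorProduct.tmul_add, hx, hy]
  | tmul a x => simp [cycStep, hP]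

/-- The cyclic operator moves the first factor to the end, where it becomes a factor of the second
kind. -/
lemma cycC_tmul_mixedTensor : ∀ (n : ℕ) (f : ℕ → H ⊕ H) (h : H) (x : X),
    cycC k H X n (h ⊗ₜ[k] mixedTensor n f x) =
      mixedTensor (n + 1) (fun i => if i < n then f i else Sum.inr h) x
  | 0, f, h, x => by
    rw [mixedTensor_succ_inr (g := h) 0 (by simp)]
    exact cotwist_eq (k := k) (X := X) h x
  | n + 1, f, h, x => by
    have ih := fun x => cycC_tmul_mixedTensor n (fun i => f (i + 1)) h x
    have e : (fun i => (if i + 1 < n + 1 then f (i + 1) else Sum.inr h : H ⊕ H)) =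
        fun i => if i < n then f (i + 1) else Sum.inr h := by
      funext i
      simp
    rw [cycC_succ]
    rcases hf : f 0 with g | g
    · rw [mixedTensor_succ_inl n hf, mixedTensor_succ_inl (g := g) (n + 1) (by simp [hf]), e, ← ih]
      rfl
    · rw [mixedTensor_succ_inr n hf, mixedTensor_succ_inr (g := g) (n + 1) (by simp [hf]), e]
      exact cycStep_map _ _ _ _ h ih _

/-- The `j`-fold rotation of `g 0 ⊗ ⋯ ⊗ g n ⊗ x` by the cyclic operator. -/
lemma cycC_pow_mixedTensor (n : ℕ) (g : ℕ → H) (x : X) : ∀ j ≤ n + 1,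
    (cycC k H X n ^ j : Module.End k _) (mixedTensor (n + 1) (fun i => Sum.inl (g i)) x) =
      mixedTensor (n + 1) (fun i => if i + j ≤ n then Sum.inl (g (i + j))
        else Sum.inr (g (i + j - (n + 1)))) x
  | 0, _ => by
    rw [pow_zero, Module.End.one_apply]
    refine LinearMap.congr_fun
      (mixedTensor_congr (k := k) (H := H) (X := X) (n + 1) fun i hi => ?_) x
    simp [Nat.lt_succ_iff.1 hi]
  | j + 1, hj => by
    rw [pow_succ', Module.End.mul_apply, cycC_pow_mixedTensor n g x j (by omega),
      mixedTensor_succ_inl (g := g j) n (by simp [Nat.le_of_succ_le_succ hj])]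
    rw [cycC_tmul_mixedTensor, mixedTensor_congr (n + 1) fun i hi => ?_]
    by_cases h : i < n
    · simp only [h, if_true, add_right_comm i 1 j, add_assoc]
    · obtain rfl : i = n := by omega
      simp only [lt_irrefl, if_false]
      rw [if_neg (by omega)]
      congr 2
      omega

lemma cycC_pow_succ_mixedTensor (n : ℕ) (g : ℕ → H) (x : X) :
    (cycC k H X n ^ (n + 1) : Module.End k _)
      (mixedTensor (n + 1) (fun i => Sum.inl (g i)) x) =
      mixedTensor (n + 1) (fun i => Sum.inr (g i)) x := by
  rw [cycC_pow_mixedTensor n g x (n + 1) le_rfl, mixedTensor_congr (n + 1) fun i hi => ?_]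
  rw [if_neg (by omega), Nat.add_sub_cancel]

/-- Pure tensors span. -/
lemma ext_mixedTensor {Q : Type*} [AddCommGroup Q] [Module k Q] : ∀ (n : ℕ)
    {φ ψ : Tens k H X n →ₗ[k] Q},
    (∀ (g : ℕ → H) (x : X), φ (mixedTensor n (fun i => Sum.inl (g i)) x) =
      ψ (mixedTensor n (fun i => Sum.inl (g i)) x)) → φ = ψ
  | 0, _, _, h => LinearMap.ext fun x => h (fun _ => 0) x
  | n + 1, φ, ψ, h => by
    have h1 : ∀ a : H, (φ ∘ₗ TensorProduct.mk k H (Tens k H X n) a : Tens k H X n →ₗ[k] Q) =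
        ψ ∘ₗ TensorProduct.mk k H (Tens k H X n) a := by
      intro a
      refine ext_mixedTensor n fun g x => ?_
      exact h (fun i => i.casesOn a g) x
    exact TensorProduct.ext' fun a m => LinearMap.congr_fun (h1 a) m

/-- The inductive step of `mixedTensor_inr`, by coassociativity of the coaction. -/
lemma map_lift_coact {M : Type u} [AddCommGroup M] [Module k M] (d : H →ₗ[k] M →ₗ[k] M)
    (P P' : X →ₗ[k] M) (hP : ∀ x, P' x = TensorProduct.lift d (P.lTensor H (coact k H X x))) (g : H)
    (x : X) :
    TensorProduct.map ((LinearMap.mul k H).flip g) P' (coact k H X x) =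
      TensorProduct.lift (diagStep k H d)
        ((TensorProduct.mk k H M g ∘ₗ P).lTensor H (coact k H X x)) := by
  obtain rfl : P' = TensorProduct.lift d ∘ₗ P.lTensor H ∘ₗ coact k H X := LinearMap.ext hP
  have h1 : TensorProduct.map ((LinearMap.mul k H).flip g)
      (TensorProduct.lift d ∘ₗ P.lTensor H ∘ₗ coact k H X) (coact k H X x) =
      TensorProduct.map ((LinearMap.mul k H).flip g) (TensorProduct.lift d ∘ₗ P.lTensor H)
        ((coact k H X).lTensor H (coact k H X x)) := by
    rw [← LinearMap.comp_assoc, ← LinearMap.map_comp_lTensor, LinearMap.comp_apply]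
  rw [h1, ← coact_coassoc]
  generalize coact k H X x = t
  induction t with
  | zero => simp
  | add x y hx hy => simp only [map_add, hx, hy]
  | tmul h m =>
    simp only [LinearMap.rTensor_tmul, LinearMap.lTensor_tmul, TensorProduct.lift.tmul,
      LinearMap.comp_apply, TensorProduct.mk_apply, diagStep_tmul]
    conv_lhs => rw [← (ℛ k h).eq]
    simp [TensorProduct.sum_tmul]

variable [Module H X] [IsScalarTower k H X] [IsStable k H X]

/-- By stability, the tensor with all factors of the second kind is obtained from the pure tensor
by the diagonal action of the coacting element. -/
lemma mixedTensor_inr : ∀ (n : ℕ) (g : ℕ → H) (x : X),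
    mixedTensor n (fun i => Sum.inr (g i)) x = TensorProduct.lift (diag k H X n)
      ((mixedTensor n fun i => Sum.inl (g i)).lTensor H (coact k H X x))
  | 0, g, x => by
    have h := IsStable.zero_stable (k := k) (H := H) x
    refine h.symm.trans ?_
    exact congrArg (act k H X) (LinearMap.congr_fun (LinearMap.lTensor_id H X).symm _)
  | n + 1, g, x => map_lift_coact (diag k H X n) (mixedTensor n fun i => Sum.inl (g (i + 1)))
      (mixedTensor n fun i => Sum.inr (g (i + 1))) (mixedTensor_inr n fun i => g (i + 1)) (g 0) x

/-- The diagonal action becomes trivial in the quotient, so that `τ^{n+1}` acts as the identity. -/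
lemma mkQ_cycC_pow (n : ℕ) (y : Tens k H X (n + 1)) :
    (augSub k H X (n + 1)).mkQ ((cycC k H X n ^ (n + 1) : Module.End k _) y) =
      (augSub k H X (n + 1)).mkQ y := by
  suffices h : (augSub k H X (n + 1)).mkQ ∘ₗ (cycC k H X n ^ (n + 1) : Module.End k _) =
      (augSub k H X (n + 1)).mkQ from LinearMap.congr_fun h y
  refine ext_mixedTensor (n + 1) fun g x => ?_
  rw [LinearMap.comp_apply, cycC_pow_succ_mixedTensor, mixedTensor_inr]
  conv_rhs => rw [← counit_coact (k := k) (H := H) x]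
  generalize coact k H X x = t
  induction t with
  | zero => simp
  | add x y hx hy => simp only [map_add, hx, hy]
  | tmul h m =>
    rw [LinearMap.lTensor_tmul, TensorProduct.lift.tmul, mkQ_diag, dropFirst_tmul, map_smul,
      map_smul]

end Coaction

variable [Module H X] [IsScalarTower k H X] [HasBijectiveAntipode k H] [LeftComodule k H X]
  [IsAntiYetterDrinfeld k H X]

variable (k H X)

lemma isQuotientMap_mkQ : ParaCocyclicData.IsQuotientMap (Tc k H X) (CMc k H X)
    fun n => (augSub k H X (n + 1)).mkQ where
  surjective n := Submodule.mkQ_surjective (augSub k H X (n + 1))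
  coface _ _ _ := rfl
  codegen _ _ _ := rfl
  cyc _ _ := rfl
  cycInv _ _ := rfl

lemma CMc_isGenerated : (CMc k H X).IsGenerated :=
  (Tc_isGenerated k H X).of_isQuotientMap (isQuotientMap_mkQ k H X)

variable [IsStable k H X]

lemma CMc_cyc_pow (n : ℕ) : (CMc k H X).cyc n ^ (n + 1) =
    (1 : Module.End k ((CMc k H X).obj n)) := by
  refine LinearMap.ext fun x => ?_
  obtain ⟨x, rfl⟩ := (isQuotientMap_mkQ k H X).surjective n x
  exact (ParaCocyclicData.map_pow_apply ((isQuotientMap_mkQ k H X).cyc n) (n + 1) x).symm.trans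
    (mkQ_cycC_pow n x)

theorem CMc_isCocyclic : (CMc k H X).IsCocyclic :=
  (CMc_isGenerated k H X).isCocyclic (CMc_cyc_pow k H X)

end CyclicPower

/-! ### Duality of cocyclic and cyclic modules -/

section Duality

variable {k : Type v} [Field k]

namespace ParaCocyclicData

section

variable (A : ParaCocyclicData.{u} k)

lemma dual_face_zero (n : ℕ) (x : A.obj (n + 1)) :
    A.dual.face n 0 x = A.codegen n (Fin.last n) (A.cyc (n + 1) x) := rfl

lemma dual_face_succ (n : ℕ) (i : Fin (n + 1)) (x : A.obj (n + 1)) :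
    A.dual.face n i.succ x = A.codegen n i x := rfl

end

variable {A : ParaCocyclicData.{u} k}

lemma IsParaCocyclic.cycInv_eq_iff (hA : A.IsParaCocyclic) {n : ℕ} {x y : A.obj n} :
    A.cycInv n x = y ↔ x = A.cyc n y := by
  have h1 : ∀ z, A.cyc n (A.cycInv n z) = z := LinearMap.congr_fun (hA.cyc_cycInv n)
  have h2 : ∀ z, A.cycInv n (A.cyc n z) = z := LinearMap.congr_fun (hA.cycInv_cyc n)
  constructor
  · rintro rfl
    exact (h1 x).symm
  · rintro rfl
    exact h2 y

/-- Connes' duality for cocyclic modules. -/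
theorem IsCocyclic.dual (hA : A.IsCocyclic) : A.dual.IsCyclic := by
  have hinv {n : ℕ} {x y : A.obj n} : A.cycInv n x = y ↔ x = A.cyc n y :=
    hA.toIsParaCocyclic.cycInv_eq_iff
  have cyc_cycInv n x : A.cyc n (A.cycInv n x) = x := (hinv.1 rfl).symm
  have coface_coface n i j hij x : A.coface (n + 1) j.succ (A.coface n i x) =
      A.coface (n + 1) i.castSucc (A.coface n j x) :=
    LinearMap.congr_fun (hA.coface_coface n i j hij) x
  have codegen_codegen n i j hij x : A.codegen n j (A.codegen (n + 1) i.castSucc x) =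
      A.codegen n i (A.codegen (n + 1) j.succ x) :=
    LinearMap.congr_fun (hA.codegen_codegen n i j hij) x
  have codegen_coface_of_le n i j hij x : A.codegen (n + 1) j.succ
      (A.coface (n + 1) i.castSucc x) = A.coface n i (A.codegen n j x) :=
    LinearMap.congr_fun (hA.codegen_coface_of_le n i j hij) x
  have codegen_coface_of_gt n i j hij x : A.codegen (n + 1) j.castSucc
      (A.coface (n + 1) i.succ x) = A.coface n i (A.codegen n j x) :=
    LinearMap.congr_fun (hA.codegen_coface_of_gt n i j hij) x
  have codegen_coface_succ n j x : A.codegen n j (A.coface n j.succ x) = x :=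
    LinearMap.congr_fun (hA.codegen_coface_succ n j) x
  have cyc_coface_succ n (i : Fin (n + 1)) x : A.cyc (n + 1) (A.coface n i.succ x) =
      A.coface n i.castSucc (A.cyc n x) := LinearMap.congr_fun (hA.cyc_coface_succ n i) x
  have cyc_coface_zero n x : A.cyc (n + 1) (A.coface n 0 x) = A.coface n (Fin.last (n + 1)) x :=
    LinearMap.congr_fun (hA.cyc_coface_zero n) x
  have cyc_codegen_succ n (j : Fin n) x : A.cyc n (A.codegen n j.succ x) =
      A.codegen n j.castSucc (A.cyc (n + 1) x) := LinearMap.congr_fun (hA.cyc_codegen_succ n j) x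
  have cyc_codegen_zero n x : A.cyc n (A.codegen n 0 x) =
      A.codegen n (Fin.last n) (A.cyc (n + 1) (A.cyc (n + 1) x)) :=
    LinearMap.congr_fun (hA.cyc_codegen_zero n) x
  refine
    { face_face := fun n i j hij => LinearMap.ext fun (x : A.obj (n + 2)) => ?_
      degen_degen := fun n i j hij => LinearMap.ext fun (x : A.obj n) => ?_
      face_degen_of_le := fun n i j hij => LinearMap.ext fun (x : A.obj (n + 1)) => ?_
      face_degen_self := fun n j => LinearMap.ext fun (x : A.obj n) => ?_
      face_degen_succ := hA.codegen_coface_self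
      face_degen_of_gt := fun n i j hij => LinearMap.ext fun (x : A.obj (n + 1)) => ?_
      cyc_cycInv := hA.cycInv_cyc
      cycInv_cyc := hA.cyc_cycInv
      face_succ_cyc := fun n i => LinearMap.ext fun (x : A.obj (n + 1)) => ?_
      face_zero_cyc := fun n => LinearMap.ext fun (x : A.obj (n + 1)) => ?_
      degen_succ_cyc := fun n j => LinearMap.ext fun (x : A.obj n) => ?_
      degen_zero_cyc := fun n => LinearMap.ext fun (x : A.obj n) => ?_
      cyc_pow := fun n => LinearMap.ext fun (x : A.obj n) => ?_ }
  · change A.dual.face n i (A.codegen (n + 1) j x) = _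
    induction i using Fin.cases with
    | zero =>
      change A.codegen n (Fin.last n) (A.cyc (n + 1) (A.codegen (n + 1) j x)) =
        A.dual.face n j (A.codegen (n + 1) (Fin.last (n + 1)) (A.cyc (n + 2) x))
      induction j using Fin.cases with
      | zero =>
        rw [cyc_codegen_zero, dual_face_zero, ← Fin.succ_last, cyc_codegen_succ,
          codegen_codegen n (Fin.last n) (Fin.last n) le_rfl]
      | succ j =>
        rw [cyc_codegen_succ, dual_face_succ, ← Fin.succ_last,
          codegen_codegen n j (Fin.last n) (Fin.le_last j)]
    | succ i =>
      induction j using Fin.cases with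
      | zero => exact absurd hij (by simp)
      | succ j => exact (codegen_codegen n i j (Fin.succ_le_succ_iff.1 hij) x).symm
  · exact (coface_coface n i.castSucc j.castSucc hij x).symm
  · induction i using Fin.cases with
    | zero =>
      change A.codegen (n + 1) (Fin.last n).succ (A.cyc (n + 2) (A.coface (n + 1)
        j.castSucc.succ x)) = A.coface n j.castSucc (A.codegen n (Fin.last n) (A.cyc (n + 1) x))
      rw [cyc_coface_succ, codegen_coface_of_le n j.castSucc (Fin.last n)
        (Fin.le_def.2 (Fin.le_last j))]
    | succ i => exact codegen_coface_of_gt n j.castSucc i hij x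
  · cases n with
    | zero =>
      obtain rfl : j = 0 := Fin.fin_one_eq_zero _
      change A.codegen 0 0 (A.cyc 1 (A.coface 0 0 x)) = x
      rw [cyc_coface_zero]
      exact codegen_coface_succ 0 0 x
    | succ n =>
      induction j using Fin.cases with
      | zero =>
        change A.codegen (n + 1) (Fin.last (n + 1)) (A.cyc (n + 2) (A.coface (n + 1) 0 x)) = x
        rw [cyc_coface_zero]
        exact codegen_coface_succ (n + 1) (Fin.last (n + 1)) x
      | succ j => exact codegen_coface_succ (n + 1) j.castSucc x
  · induction i using Fin.cases with
    | zero => exact absurd hij (by simp)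
    | succ i => exact codegen_coface_of_le n j.castSucc i (Fin.le_def.2 (Nat.lt_succ_iff.1 hij)) x
  · refine (hinv.2 ?_).symm
    change A.dual.face n i.castSucc x = A.cyc n (A.codegen n i (A.cycInv (n + 1) x))
    cases n with
    | zero =>
      obtain rfl : i = 0 := Fin.fin_one_eq_zero _
      rw [cyc_codegen_zero, cyc_cycInv]
      rfl
    | succ n =>
      induction i using Fin.cases with
      | zero =>
        rw [cyc_codegen_zero, cyc_cycInv]
        rfl
      | succ i =>
        rw [cyc_codegen_succ, cyc_cycInv]
        rfl
  · exact congrArg (A.codegen n (Fin.last n)) (cyc_cycInv (n + 1) x)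
  · refine (hinv.2 ?_).symm
    change A.coface n j.castSucc.castSucc x =
      A.cyc (n + 1) (A.coface n j.castSucc.succ (A.cycInv n x))
    rw [cyc_coface_succ, cyc_cycInv]
  · refine (hinv.2 (hinv.2 ?_)).symm
    change A.coface n (Fin.last n).castSucc x =
      A.cyc (n + 1) (A.cyc (n + 1) (A.coface n 0 (A.cycInv n x)))
    rw [cyc_coface_zero, ← Fin.succ_last, cyc_coface_succ, cyc_cycInv]
  · have h : ∀ (m : ℕ) (x : A.obj n), (A.cycInv n ^ m : Module.End k _)
        ((A.cyc n ^ m : Module.End k _) x) = x := by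
      intro m
      induction m with
      | zero => exact fun _ => rfl
      | succ m ih =>
        intro x
        rw [pow_succ, pow_succ', Module.End.mul_apply, Module.End.mul_apply, hinv.2 rfl, ih]
    have h1 := h (n + 1) x
    rwa [hA.cyc_pow] at h1

end ParaCocyclicData

end Duality

/-! ### Transport of cyclic structures -/

section Comparison

variable {k : Type v} [Field k]

namespace ParaCyclicData

lemma pow_apply_mem {V : Type*} [AddCommGroup V] [Module k V] {N : Submodule k V}
    {f : Module.End k V} (hf : ∀ x ∈ N, f x ∈ N) (i : ℕ) : ∀ x ∈ N, (f ^ i) x ∈ N := by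
  induction i with
  | zero => exact fun x hx => hx
  | succ i ih =>
    intro x hx
    rw [pow_succ, Module.End.mul_apply]
    exact ih _ (hf x hx)

lemma map_pow_apply_of_mem {V W : Type*} [AddCommGroup V] [Module k V] [AddCommGroup W] [Module k W]
    {N : Submodule k V} {q : V →ₗ[k] W} {f : Module.End k V} {g : Module.End k W}
    (hf : ∀ x ∈ N, f x ∈ N) (h : ∀ x ∈ N, q (f x) = g (q x)) (i : ℕ) :
    ∀ x ∈ N, q ((f ^ i) x) = (g ^ i) (q x) := by
  induction i with
  | zero => exact fun x _ => rfl
  | succ i ih =>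
    intro x hx
    rw [pow_succ, pow_succ, Module.End.mul_apply, Module.End.mul_apply, ih _ (hf x hx), h x hx]

section

variable {B : ParaCyclicData.{u} k}

lemma IsParaCyclic.cyc_pow_cycInv_pow (hB : B.IsParaCyclic) (n i : ℕ) (x : B.obj n) :
    (B.cyc n ^ i : Module.End k _) ((B.cycInv n ^ i : Module.End k _) x) = x := by
  induction i generalizing x with
  | zero => rfl
  | succ i ih =>
    have h : ∀ y, B.cyc n (B.cycInv n y) = y := LinearMap.congr_fun (hB.cyc_cycInv n)
    rw [pow_succ, pow_succ', Module.End.mul_apply, Module.End.mul_apply, h, ih]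

/-- `∂_i τ^i = τ^i ∂_0`. -/
lemma IsParaCyclic.face_cyc_pow (hB : B.IsParaCyclic) (n : ℕ) (i : Fin (n + 2))
    (x : B.obj (n + 1)) : B.face n i ((B.cyc (n + 1) ^ (i : ℕ) : Module.End k _) x) =
      (B.cyc n ^ (i : ℕ) : Module.End k _) (B.face n 0 x) := by
  induction i using Fin.induction with
  | zero => rfl
  | succ i ih =>
    have h : ∀ y, B.face n i.succ (B.cyc (n + 1) y) = B.cyc n (B.face n i.castSucc y) :=
      LinearMap.congr_fun (hB.face_succ_cyc n i)
    rw [Fin.val_succ, pow_succ', pow_succ', Module.End.mul_apply, Module.End.mul_apply, h]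
    exact congrArg _ ih

/-- `σ_j τ^j = τ^j σ_0`. -/
lemma IsParaCyclic.degen_cyc_pow (hB : B.IsParaCyclic) (n : ℕ) (j : Fin (n + 1)) (x : B.obj n) :
    B.degen n j ((B.cyc n ^ (j : ℕ) : Module.End k _) x) =
      (B.cyc (n + 1) ^ (j : ℕ) : Module.End k _) (B.degen n 0 x) := by
  induction j using Fin.induction with
  | zero => rfl
  | succ j ih =>
    have h : ∀ y, B.degen n j.succ (B.cyc n y) = B.cyc (n + 1) (B.degen n j.castSucc y) :=
      LinearMap.congr_fun (hB.degen_succ_cyc n j)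
    rw [Fin.val_succ, pow_succ', pow_succ', Module.End.mul_apply, Module.End.mul_apply, h]
    exact congrArg _ ih

/-- Cyclic modules pull back along injective morphisms. -/
theorem IsCyclic.of_injective {C : ParaCyclicData.{u} k} (hB : B.IsCyclic)
    {f : ∀ n, C.obj n →ₗ[k] B.obj n} (hf : IsMorphism C B f)
    (hinv : ∀ n x, f n (C.cycInv n x) = B.cycInv n (f n x))
    (hinj : ∀ n, Function.Injective (f n)) : C.IsCyclic := by
  have face n i x : f n (C.face n i x) = B.face n i (f (n + 1) x) :=
    LinearMap.congr_fun (hf.face n i) x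
  have degen n j x : f (n + 1) (C.degen n j x) = B.degen n j (f n x) :=
    LinearMap.congr_fun (hf.degen n j) x
  have cyc n x : f n (C.cyc n x) = B.cyc n (f n x) := LinearMap.congr_fun (hf.cyc n) x
  constructor
  · constructor
    all_goals intros
    all_goals refine LinearMap.ext fun x => hinj _ ?_
    all_goals simp only [LinearMap.comp_apply, LinearMap.id_apply, face, degen, cyc, hinv]
    all_goals generalize f _ x = y
    · exact LinearMap.congr_fun (hB.face_face _ _ _ ‹_›) y
    · exact LinearMap.congr_fun (hB.degen_degen _ _ _ ‹_›) y
    · exact LinearMap.congr_fun (hB.face_degen_of_le _ _ _ ‹_›) y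
    · exact LinearMap.congr_fun (hB.face_degen_self _ _) y
    · exact LinearMap.congr_fun (hB.face_degen_succ _ _) y
    · exact LinearMap.congr_fun (hB.face_degen_of_gt _ _ _ ‹_›) y
    · exact LinearMap.congr_fun (hB.cyc_cycInv _) y
    · exact LinearMap.congr_fun (hB.cycInv_cyc _) y
    · exact LinearMap.congr_fun (hB.face_succ_cyc _ _) y
    · exact LinearMap.congr_fun (hB.face_zero_cyc _) y
    · exact LinearMap.congr_fun (hB.degen_succ_cyc _ _) y
    · exact LinearMap.congr_fun (hB.degen_zero_cyc _) y
  · intro n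
    refine LinearMap.ext fun x => hinj _ ?_
    rw [ParaCocyclicData.map_pow_apply (cyc n), hB.cyc_pow]
    rfl

end

/-- A graded subspace `I` of `A`, whose structure maps are generated by `∂_0`, `σ_0` and an
invertible `τ`, together with a comparison `F` to `B` that restricts to a bijection on `I` and is
compatible there with `∂_0`, `σ_0` and `τ`. Stability of `I` under `τ⁻¹` is not required,
but follows if `B` is cyclic (`Comparison.cycInv_mem`). -/
structure Comparison (A B : ParaCyclicData.{u} k) (I : ∀ n, Submodule k (A.obj n))
    (F : ∀ n, A.obj n →ₗ[k] B.obj n) : Prop where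
  cyc_cycInv : ∀ n x, A.cyc n (A.cycInv n x) = x
  cycInv_cyc : ∀ n x, A.cycInv n (A.cyc n x) = x
  face_eq : ∀ n i x, A.face n i x = (A.cyc n ^ (i : ℕ) : Module.End k _)
    (A.face n 0 ((A.cycInv (n + 1) ^ (i : ℕ) : Module.End k _) x))
  degen_eq : ∀ n j x, A.degen n j x = (A.cyc (n + 1) ^ (j : ℕ) : Module.End k _)
    (A.degen n 0 ((A.cycInv n ^ (j : ℕ) : Module.End k _) x))
  cyc_mem : ∀ n, ∀ x ∈ I n, A.cyc n x ∈ I n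
  face_zero_mem : ∀ n, ∀ x ∈ I (n + 1), A.face n 0 x ∈ I n
  degen_zero_mem : ∀ n, ∀ x ∈ I n, A.degen n 0 x ∈ I (n + 1)
  map_cyc : ∀ n, ∀ x ∈ I n, F n (A.cyc n x) = B.cyc n (F n x)
  map_face_zero : ∀ n, ∀ x ∈ I (n + 1), F n (A.face n 0 x) = B.face n 0 (F (n + 1) x)
  map_degen_zero : ∀ n, ∀ x ∈ I n, F (n + 1) (A.degen n 0 x) = B.degen n 0 (F n x)
  injOn : ∀ n, Set.InjOn (F n) (I n)
  surjOn : ∀ n z, ∃ x ∈ I n, F n x = z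

namespace Comparison

variable {A B : ParaCyclicData.{u} k} {I : ∀ n, Submodule k (A.obj n)}
  {F : ∀ n, A.obj n →ₗ[k] B.obj n}

/-- As `τ^{n+1} = id` on `B`, also `τ^{n+1} = id` on `I`, and so `τ⁻¹ = τ^n` there. -/
lemma cycInv_mem (h : Comparison A B I F) (hB : B.IsCyclic) (n : ℕ) (x : A.obj n) (hx : x ∈ I n) :
    A.cycInv n x ∈ I n := by
  have h1 : (A.cyc n ^ (n + 1) : Module.End k _) x = x := by
    refine h.injOn n (pow_apply_mem (h.cyc_mem n) _ x hx) hx ?_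
    rw [map_pow_apply_of_mem (h.cyc_mem n) (h.map_cyc n) _ x hx, hB.cyc_pow]
    rfl
  rw [← h1, pow_succ', Module.End.mul_apply, h.cycInv_cyc]
  exact pow_apply_mem (h.cyc_mem n) _ x hx

lemma map_cycInv (h : Comparison A B I F) (hB : B.IsCyclic) (n : ℕ) (x : A.obj n) (hx : x ∈ I n) :
    F n (A.cycInv n x) = B.cycInv n (F n x) := by
  have h1 := h.map_cyc n _ (h.cycInv_mem hB n x hx)
  rw [h.cyc_cycInv] at h1
  rw [h1]
  exact (LinearMap.congr_fun (hB.cycInv_cyc n) _).symm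

lemma degen_mem (h : Comparison A B I F) (hB : B.IsCyclic) (n : ℕ) (j : Fin (n + 1))
    (x : A.obj n) (hx : x ∈ I n) : A.degen n j x ∈ I (n + 1) := by
  rw [h.degen_eq]
  exact pow_apply_mem (h.cyc_mem (n + 1)) _ _ (h.degen_zero_mem n _
    (pow_apply_mem (h.cycInv_mem hB n) _ x hx))

lemma map_face (h : Comparison A B I F) (hB : B.IsCyclic) (n : ℕ) (i : Fin (n + 2))
    (x : A.obj (n + 1)) (hx : x ∈ I (n + 1)) : F n (A.face n i x) = B.face n i (F (n + 1) x) := by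
  have hy := pow_apply_mem (h.cycInv_mem hB (n + 1)) i x hx
  rw [h.face_eq, map_pow_apply_of_mem (h.cyc_mem n) (h.map_cyc n) _ _ (h.face_zero_mem n _ hy),
    h.map_face_zero n _ hy, map_pow_apply_of_mem (h.cycInv_mem hB (n + 1)) (h.map_cycInv hB (n + 1))
      _ x hx, ← hB.face_cyc_pow, hB.cyc_pow_cycInv_pow]

lemma map_degen (h : Comparison A B I F) (hB : B.IsCyclic) (n : ℕ) (j : Fin (n + 1))
    (x : A.obj n) (hx : x ∈ I n) : F (n + 1) (A.degen n j x) = B.degen n j (F n x) := by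
  have hy := pow_apply_mem (h.cycInv_mem hB n) j x hx
  rw [h.degen_eq, map_pow_apply_of_mem (h.cyc_mem (n + 1)) (h.map_cyc (n + 1)) _ _
      (h.degen_zero_mem n _ hy),
    h.map_degen_zero n _ hy, map_pow_apply_of_mem (h.cycInv_mem hB n) (h.map_cycInv hB n)
      _ x hx, ← hB.degen_cyc_pow, hB.cyc_pow_cycInv_pow]

end Comparison

/-- A graded space `C` with maps `p`, `e` that identify it with `I`, and the structure maps
transported from `A` along this identification. -/
structure Transported (C A : ParaCyclicData.{u} k) (I : ∀ n, Submodule k (A.obj n))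
    (p : ∀ n, C.obj n →ₗ[k] A.obj n) (e : ∀ n, A.obj n →ₗ[k] C.obj n) : Prop where
  mem : ∀ n v, p n v ∈ I n
  map_section : ∀ n, ∀ x ∈ I n, p n (e n x) = x
  section_map : ∀ n v, e n (p n v) = v
  cyc_eq : ∀ n v, C.cyc n v = e n (A.cyc n (p n v))
  cycInv_eq : ∀ n v, C.cycInv n v = e n (A.cycInv n (p n v))
  face_eq : ∀ n i v, C.face n i v = (C.cyc n ^ (i : ℕ) : Module.End k _)
    (C.face n 0 ((C.cycInv (n + 1) ^ (i : ℕ) : Module.End k _) v))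
  degen_eq : ∀ n j v, C.degen n j v = e (n + 1) (A.degen n j (p n v))
  map_face_zero : ∀ n v, p n (C.face n 0 v) = A.face n 0 (p (n + 1) v)

namespace Transported

variable {A B C : ParaCyclicData.{u} k} {I : ∀ n, Submodule k (A.obj n)}
  {F : ∀ n, A.obj n →ₗ[k] B.obj n} {p : ∀ n, C.obj n →ₗ[k] A.obj n}
  {e : ∀ n, A.obj n →ₗ[k] C.obj n}

lemma map_injective (t : Transported C A I p e) (n : ℕ) : Function.Injective (p n) :=
  Function.LeftInverse.injective (t.section_map n)

lemma range_map (t : Transported C A I p e) (n : ℕ) : LinearMap.range (p n) = I n := by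
  ext x
  constructor
  · rintro ⟨v, rfl⟩
    exact t.mem n v
  · exact fun hx => ⟨e n x, t.map_section n x hx⟩

lemma map_cycInv (t : Transported C A I p e) (h : Comparison A B I F) (hB : B.IsCyclic) (n : ℕ)
    (v : C.obj n) : p n (C.cycInv n v) = A.cycInv n (p n v) := by
  rw [t.cycInv_eq, t.map_section n _ (h.cycInv_mem hB n _ (t.mem n v))]

lemma map_cyc (t : Transported C A I p e) (h : Comparison A B I F) (n : ℕ) (v : C.obj n) :
    p n (C.cyc n v) = A.cyc n (p n v) := by
  rw [t.cyc_eq, t.map_section n _ (h.cyc_mem n _ (t.mem n v))]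

lemma isMorphism (t : Transported C A I p e) (h : Comparison A B I F) (hB : B.IsCyclic) :
    IsMorphism C A p where
  face n i := by
    refine LinearMap.ext fun v => ?_
    rw [LinearMap.comp_apply, LinearMap.comp_apply, t.face_eq,
      ParaCocyclicData.map_pow_apply (t.map_cyc h n), t.map_face_zero,
      ParaCocyclicData.map_pow_apply (t.map_cycInv h hB (n + 1)), ← h.face_eq]
  degen n j := by
    refine LinearMap.ext fun v => ?_
    rw [LinearMap.comp_apply, LinearMap.comp_apply, t.degen_eq,
      t.map_section (n + 1) _ (h.degen_mem hB n j _ (t.mem n v))]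
  cyc n := LinearMap.ext (t.map_cyc h n)

lemma isMorphism_comp (t : Transported C A I p e) (h : Comparison A B I F) (hB : B.IsCyclic) :
    IsMorphism C B fun n => F n ∘ₗ p n where
  face n i := by
    refine LinearMap.ext fun v => ?_
    have h1 : p n (C.face n i v) = _ := LinearMap.congr_fun ((t.isMorphism h hB).face n i) v
    simp only [LinearMap.comp_apply] at h1 ⊢
    rw [h1, h.map_face hB n i _ (t.mem _ v)]
  degen n j := by
    refine LinearMap.ext fun v => ?_
    have h1 : p _ (C.degen n j v) = _ := LinearMap.congr_fun ((t.isMorphism h hB).degen n j) v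
    simp only [LinearMap.comp_apply] at h1 ⊢
    rw [h1, h.map_degen hB n j _ (t.mem _ v)]
  cyc n := by
    refine LinearMap.ext fun v => ?_
    simp only [LinearMap.comp_apply]
    rw [t.map_cyc h, h.map_cyc n _ (t.mem _ v)]

lemma bijective_comp (t : Transported C A I p e) (h : Comparison A B I F) (n : ℕ) :
    Function.Bijective (F n ∘ₗ p n) := by
  constructor
  · intro v w hvw
    exact t.map_injective n (h.injOn n (t.mem n v) (t.mem n w) hvw)
  · intro z
    obtain ⟨x, hx, rfl⟩ := h.surjOn n z
    exact ⟨e n x, congrArg (F n) (t.map_section n x hx)⟩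

theorem isCyclic (t : Transported C A I p e) (h : Comparison A B I F) (hB : B.IsCyclic) :
    C.IsCyclic := by
  refine hB.of_injective (t.isMorphism_comp h hB) (fun n v => ?_)
    fun n => (t.bijective_comp h n).1
  simp only [LinearMap.comp_apply]
  rw [t.map_cycInv h hB, h.map_cycInv hB n _ (t.mem n v)]

end Transported

end ParaCyclicData

end Comparison

/-! ### Comparison of `CM^a_*(H, X)` and `CM^c_*(H, X)^∨` -/

section Instances

variable {k : Type v} [Field k] {H : Type u} [Ring H] [HopfAlgebra k H]
variable {X : Type u} [AddCommGroup X] [Module k X] [Module H X] [IsScalarTower k H X]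

lemma mul_lTensor {M N : Type u} [AddCommGroup M] [Module k M] [AddCommGroup N] [Module k N]
    (f : M →ₗ[k] N) (y : H ⊗[k] (H ⊗[k] M)) :
    ((LinearMap.mul' k H).rTensor N ∘ₗ (TensorProduct.assoc k H H N).symm.toLinearMap)
        ((f.lTensor H).lTensor H y) =
      f.lTensor H (((LinearMap.mul' k H).rTensor M ∘ₗ
        (TensorProduct.assoc k H H M).symm.toLinearMap) y) := by
  refine LinearMap.congr_fun (f := ((LinearMap.mul' k H).rTensor N ∘ₗ
    (TensorProduct.assoc k H H N).symm.toLinearMap) ∘ₗ (f.lTensor H).lTensor H)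
    (g := f.lTensor H ∘ₗ (LinearMap.mul' k H).rTensor M ∘ₗ
      (TensorProduct.assoc k H H M).symm.toLinearMap) ?_ y
  ext a b m
  simp

lemma act_lTensor_act (y : H ⊗[k] (H ⊗[k] X)) : act k H X ((act k H X).lTensor H y) =
    act k H X (((LinearMap.mul' k H).rTensor X ∘ₗ
      (TensorProduct.assoc k H H X).symm.toLinearMap) y) := by
  refine LinearMap.congr_fun (f := act k H X ∘ₗ (act k H X).lTensor H)
    (g := act k H X ∘ₗ (LinearMap.mul' k H).rTensor X ∘ₗ
      (TensorProduct.assoc k H H X).symm.toLinearMap) ?_ y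
  ext a b x
  simp [act_tmul, mul_smul]

/-- `d_0 i = i ∂_0`. -/
lemma faceZeroCMa_absorb : ∀ (n : ℕ) (y : Tens k H X (n + 2)),
    faceZeroCMa k H X n (absorb k H X (n + 1) y) = absorb k H X n (mulFirst k H X n y)
  | 0, y => by
    have h : ∀ y : H ⊗[k] (H ⊗[k] X), _ := act_lTensor_act
    exact h y
  | n + 1, y => mul_lTensor (H := H) (absorb k H X n) y

variable [HasBijectiveAntipode k H] [LeftComodule k H X] [IsAntiYetterDrinfeld k H X]
  [IsStable k H X]

omit [IsAntiYetterDrinfeld k H X] [IsStable k H X] in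
lemma exists_mkQ_alphaAux_eq (n : ℕ) (z : Tens k H X (n + 1) ⧸ augSub k H X (n + 1)) :
    ∃ y ∈ invA k H X n, (augSub k H X (n + 1)).mkQ (alphaAux k H X (n + 1) y) = z := by
  obtain ⟨m, rfl⟩ := (mkQ_one_tmul_bijective (k := k) (H := H) (X := X) n).2 z
  obtain ⟨m, rfl⟩ := (alphaAux_bijective (k := k) (H := H) (X := X) n).2 m
  refine ⟨sectionA k H X n m, sectionA_mem_invA n m, ?_⟩
  rw [mkQ_alphaAux, dropA_sectionA]

omit [IsAntiYetterDrinfeld k H X] [IsStable k H X] in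
lemma mkQ_alphaAux_injOn (n : ℕ) : Set.InjOn
    (fun y => (augSub k H X (n + 1)).mkQ (alphaAux k H X (n + 1) y)) (invA k H X n) := by
  intro y hy y' hy' h
  simp only [mkQ_alphaAux] at h
  have h1 := (alphaAux_bijective (k := k) (H := H) (X := X) n).1
    ((mkQ_one_tmul_bijective (k := k) (H := H) (X := X) n).1 h)
  rw [← sectionA_dropA hy, h1, sectionA_dropA hy']

omit [IsStable k H X] in
lemma mkQ_alphaAux_cycA (n : ℕ) {y : Tens k H X (n + 1)} (hy : y ∈ invA k H X n) :
    (augSub k H X (n + 1)).mkQ (alphaAux k H X (n + 1) (cycA k H X n y)) =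
      (augSub k H X (n + 1)).mkQ (cycInvC k H X n (alphaAux k H X (n + 1) y)) := by
  have h1 : dropA k H X n (cycA k H X n y) = absorb k H X n y :=
    LinearMap.congr_fun (dropA_comp_cycA n) y
  rw [mkQ_alphaAux, h1, ← cycC_one_tmul_alphaAux_absorb hy]
  exact congrArg _ (LinearMap.congr_fun (cycInvC_cycC k H X n) _).symm

variable (k H X)

/-- On `CM^c_*(H, X)`, the face `∂^∨_0 = σ_n τ` is the counit in the first factor. This needs the
cyclic relation: `σ_n τ = τ σ_0 τ⁻¹`, and `τ σ_0 = (ε ⊗ id) τ` on `T^c_*(H, X)`. -/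
lemma CMc_codegen_last_cyc (n : ℕ) (y : Tens k H X (n + 2)) :
    (CMc k H X).codegen n (Fin.last n) ((CMc k H X).cyc (n + 1) ((augSub k H X (n + 2)).mkQ y)) =
      (augSub k H X (n + 1)).mkQ (dropA k H X (n + 1) y) := by
  have h1 := LinearMap.congr_fun ((CMc_isCocyclic k H X).cyc_codegen_zero n)
    ((augSub k H X (n + 2)).mkQ (cycInvC k H X (n + 1) y))
  have h2 : ∀ z, cycC k H X (n + 1) (cycInvC k H X (n + 1) z) = z :=
    LinearMap.congr_fun (cycC_cycInvC k H X (n + 1))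
  have h3 := cycC_counitSecond k H X n (cycInvC k H X (n + 1) y)
  rw [h2] at h3
  have h4 : (CMc k H X).cyc (n + 1) ((augSub k H X (n + 2)).mkQ (cycInvC k H X (n + 1) y)) =
      (augSub k H X (n + 2)).mkQ y := congrArg (augSub k H X (n + 2)).mkQ (h2 y)
  rw [← h3, ← h4]
  exact h1.symm

/-- The map `q α` identifies the coinvariants of `T^a_*(H, X)` with `CM^c_*(H, X)^∨`. -/
theorem comparison : ParaCyclicData.Comparison (Ta k H X) (CMc k H X).dual (invA k H X)
    (fun n => qC k H X n ∘ₗ alpha k H X n) where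
  cyc_cycInv n := LinearMap.congr_fun (cycA_cycInvA k H X n)
  cycInv_cyc n := LinearMap.congr_fun (cycInvA_cycA k H X n)
  face_eq _ _ _ := rfl
  degen_eq _ _ _ := rfl
  cyc_mem _ _ hx := cycA_mem_invA hx
  face_zero_mem _ _ hx := mulFirst_mem_invA hx
  degen_zero_mem _ _ hx := insertOne_mem_invA hx
  map_cyc n _ hx := mkQ_alphaAux_cycA n hx
  map_face_zero n (x : Tens k H X (n + 2)) _ := by
    have h1 := CMc_codegen_last_cyc k H X n (alphaAux k H X (n + 2) x)
    rw [dropA_alphaAux] at h1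
    exact h1.symm
  map_degen_zero n x _ := congrArg (augSub k H X (n + 2)).mkQ (alphaAux_insertOne n x)
  injOn n := mkQ_alphaAux_injOn n
  surjOn n := exists_mkQ_alphaAux_eq n

/-- The maps `p` and `i` identify `CM^a_*(H, X)` with the coinvariants of `T^a_*(H, X)`. -/
theorem transported : ParaCyclicData.Transported (CMa k H X) (Ta k H X) (invA k H X)
    (pA k H X) (absorb k H X) := by
  have hmem : ∀ n v, pA k H X n v ∈ invA k H X n := by
    intro n v
    rw [pA_eq]
    exact (comparison k H X).cycInv_mem (CMc_isCocyclic k H X).dual n _ (sectionA_mem_invA n v)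
  have hsection : ∀ n, ∀ y ∈ invA k H X n, pA k H X n (absorb k H X n y) = y := by
    intro n y hy
    rw [pA_eq, LinearMap.comp_apply, sectionA_absorb hy]
    exact LinearMap.congr_fun (cycInvA_cycA k H X n) y
  exact
    { mem := hmem
      map_section := hsection
      section_map := absorb_pA
      cyc_eq := fun _ _ => rfl
      cycInv_eq := fun _ _ => rfl
      face_eq := fun _ _ _ => rfl
      degen_eq := fun _ _ _ => rfl
      map_face_zero := fun n (v : Tens k H X (n + 1)) => by
        have h1 := faceZeroCMa_absorb n (pA k H X (n + 1) v)
        rw [absorb_pA] at h1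
        exact (congrArg (pA k H X n) h1).trans
          (hsection n _ (mulFirst_mem_invA (hmem (n + 1) v))) }

end Instances

end HopfCyclic

end

theorem mainTheorem1 (k : Type v) [Field k]
    (H : Type u) [Ring H] [HopfAlgebra k H] [HopfCyclic.HasBijectiveAntipode k H]
    (X : Type u) [AddCommGroup X] [Module k X] [Module H X] [IsScalarTower k H X]
    [HopfCyclic.LeftComodule k H X]
    [HopfCyclic.IsAntiYetterDrinfeld k H X] [HopfCyclic.IsStable k H X] :
    -- the source is a cyclic module, and `p` identifies it with the coinvariants of `T^a`
    (HopfCyclic.CMa k H X).IsCyclic ∧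
    HopfCyclic.ParaCyclicData.IsMorphism (HopfCyclic.CMa k H X) (HopfCyclic.Ta k H X)
      (HopfCyclic.pA k H X) ∧
    (∀ n : ℕ, Function.Injective (HopfCyclic.pA k H X n) ∧
      LinearMap.range (HopfCyclic.pA k H X n) = HopfCyclic.invA k H X n) ∧
    -- the target is the cyclic dual of a cocyclic module
    (HopfCyclic.CMc k H X).IsCocyclic ∧
    (HopfCyclic.CMc k H X).dual.IsCyclic ∧
    -- the map `q α` on the image of `p` is an isomorphism of cyclic modules
    HopfCyclic.ParaCyclicData.IsMorphism (HopfCyclic.CMa k H X) (HopfCyclic.CMc k H X).dual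
      (fun n => HopfCyclic.qC k H X n ∘ₗ HopfCyclic.alpha k H X n ∘ₗ HopfCyclic.pA k H X n) ∧
    ∀ n : ℕ, Function.Bijective
      (HopfCyclic.qC k H X n ∘ₗ HopfCyclic.alpha k H X n ∘ₗ HopfCyclic.pA k H X n) := by
  have hc := HopfCyclic.comparison k H X
  have ht := HopfCyclic.transported k H X
  have hB := (HopfCyclic.CMc_isCocyclic k H X).dual
  exact ⟨ht.isCyclic hc hB, ht.isMorphism hc hB, fun n => ⟨ht.map_injective n, ht.range_map n⟩,
    HopfCyclic.CMc_isCocyclic k H X, hB, ht.isMorphism_comp hc hB, ht.bijective_comp hc⟩
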